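/- Let $M$ be a smooth manifold of finite dimension $n$ with a pseudo-Riemannian metric $g$ (a smooth field of nondegenerate symmetric bilinear forms, of arbitrary signature), and write $a\cdot b=g(a,b)$ for tangent vectors. Let $GT_pM$ be the geometric (Clifford) algebra of $(T_pM,g_p)$, in which $aa=a\cdot a$ for vectors, and let $\langle A\rangle_k$ denote the grade-$k$ part of a multivector. For multivectors $A_j,B_k$ of pure grades $j,k$ put $A_j\wedge B_k=\langle A_jB_k\rangle_{j+k}$ and $A_j\cdot B_k=\langle A_jB_k\rangle_{k-j}$ (zero if $k<j$), extended bilinearly. A multivector field is smooth if its coefficients in the multivector frames $e_{j_1}\wedge\dots\wedge e_{j_r}$ ($j_1<\dots<j_r$) of coordinate frames $e_i=\partial/\partial x^i$ are smooth. A *multivector directional derivative* (MDD) assigns to a tangent vector $a\in T_pM$ and a multivector field $A$ smooth near $p$ a multivector $D_aA\in GT_pM$ such that $D_aA$ is linear in $a$ and additive in $A$, $D_a\varphi=a(\varphi)$ for scalar fields $\varphi$, $D_av\in T_pM$ for vector fields $v$, and $D_a(AB)=(D_aA)B+A(D_aB)$. It is *torsion-free* if $D_ab-D_ba=[a,b]$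 for all smooth vector fields $a,b$. Its curl is $D\wedge A=\sum_i e^i\wedge D_{e_i}A$, where $(e_i)$ is any basis of $T_pM$ and $(e^i)$ the reciprocal basis, $e^i\cdot e_j=\delta^i_j$. The *tensor conjugate* of a multivector field $A$ is the differential form $\hat A=\sum_k\hat A_k$ of mixed degree with $$\hat A_k(a_1,\dots,a_k)=\langle A\rangle_k\cdot(a_k\wedge\dots\wedge a_1),$$ so that $\widehat{b_1\wedge\dots\wedge b_k}(a_1,\dots,a_k)=\det(b_i\cdot a_j)$ for vectors. Forms carry the usual wedge product (with $(\alpha\wedge\beta)(a,b)=\alpha(a)\beta(b)-\alpha(b)\beta(a)$ for one-forms) and the usual exterior derivative $\hat d$. **Theorem (Equivalence of forms to multivectors).** The map $A\mapsto\hat A$ is a bijection from the multivector fields on $M$ to the differential forms on $M$. A multivector field is smooth at a point if and only if its conjugate is, so the map restricts to a bijection from the smooth multivector fields to the smooth differential forms. Moreover: 1. $\widehat{\alpha A+\beta B}=\alpha\hat A+\beta\hat B$ for all scalar fields (in particular all constants) $\alpha,\beta$ and multivector fields $A,B$. 2. $\widehat{A\wedge B}=\hat A\wedge\hat B$ for all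 multivector fields $A,B$. 3. A torsion-free MDD $\nabla$ exists, and for every torsion-free MDD $\nabla$, with $d=\nabla\wedge$ its curl (computed in any basis), $\widehat{dA}=\hat d\hat A$ at every point near which the multivector field $A$ is smooth. If the vectors are wedged in the given order instead, only a sign changes: $\langle A\rangle_k\cdot(a_1\wedge\dots\wedge a_k)=(-1)^{k(k-1)/2}\,\hat A_k(a_1,\dots,a_k)$. -/

import Mathlib

open scoped Manifold ContDiff Topology Bundle

noncomputable section

/-! ### Geometric algebra of a quadratic space

The geometric algebra of `(V, Q)` is Mathlib's `CliffordAlgebra Q`, in which `a * a = Q a`. -/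

namespace GeomAlg

open CliffordAlgebra

variable {V : Type*} [AddCommGroup V] [Module ℝ V]

/-- The projection of the exterior algebra to its `k`-th exterior power. -/
abbrev extProj (k : ℕ) : ExteriorAlgebra ℝ V →ₗ[ℝ] ExteriorAlgebra ℝ V :=
  GradedAlgebra.proj (fun i : ℕ => ⋀[ℝ]^i V) k

/-- The grade operator `⟨A⟩ₖ`.  The grade-`k` part of the geometric algebra corresponds to the
`k`-th exterior power under the standard linear isomorphism with the exterior algebra, which sends
an antisymmetrized geometric product of vectors to their exterior product. -/
def grade (Q : QuadraticForm ℝ V) (k : ℕ) : CliffordAlgebra Q →ₗ[ℝ] CliffordAlgebra Q :=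
  (equivExterior Q).symm.toLinearMap ∘ₗ
    extProj k ∘ₗ (equivExterior Q).toLinearMap

/-- The real number that the grade-`0` part of a multivector is. -/
def scalarPart (Q : QuadraticForm ℝ V) : CliffordAlgebra Q →ₗ[ℝ] ℝ :=
  ExteriorAlgebra.algebraMapInv.toLinearMap ∘ₗ (equivExterior Q).toLinearMap

/-- The wedge product: `Aⱼ ∧ Bₖ = ⟨Aⱼ Bₖ⟩ⱼ₊ₖ` on pure grades, extended by linearity. -/
def wedge (Q : QuadraticForm ℝ V) (A B : CliffordAlgebra Q) : CliffordAlgebra Q :=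
  ∑ j ∈ Finset.range (Module.finrank ℝ V + 1), ∑ k ∈ Finset.range (Module.finrank ℝ V + 1),
    grade Q (j + k) (grade Q j A * grade Q k B)

/-- The dot product: `Aⱼ · Bₖ = ⟨Aⱼ Bₖ⟩ₖ₋ⱼ` on pure grades (zero if `k < j`), extended by
linearity. -/
def dot (Q : QuadraticForm ℝ V) (A B : CliffordAlgebra Q) : CliffordAlgebra Q :=
  ∑ k ∈ Finset.range (Module.finrank ℝ V + 1), ∑ j ∈ Finset.range (k + 1),
    grade Q (k - j) (grade Q j A * grade Q k B)

/-- `a₁ ∧ ⋯ ∧ aₖ` for a list of vectors, and `1` for the empty list. -/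
def wedgeList (Q : QuadraticForm ℝ V) (l : List V) : CliffordAlgebra Q :=
  (l.map (ι Q)).foldr (wedge Q) 1

/-! #### The wedge product is the exterior product -/

section Aux

theorem proj_eq_self {k : ℕ} {x : ExteriorAlgebra ℝ V} (hx : x ∈ ⋀[ℝ]^k V) : extProj k x = x := by
  rw [GradedAlgebra.proj_apply]; exact DirectSum.decompose_of_mem_same _ hx

theorem proj_eq_zero {k i : ℕ} {x : ExteriorAlgebra ℝ V} (hx : x ∈ ⋀[ℝ]^k V) (h : k ≠ i) :
    extProj i x = 0 := by
  rw [GradedAlgebra.proj_apply]; exact DirectSum.decompose_of_mem_ne _ hx h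

theorem proj_mem (k : ℕ) (x : ExteriorAlgebra ℝ V) : extProj k x ∈ ⋀[ℝ]^k V := by
  rw [GradedAlgebra.proj_apply]; exact SetLike.coe_mem _

theorem ι_mem (a : V) : ExteriorAlgebra.ι ℝ a ∈ ⋀[ℝ]^1 V := by
  change _ ∈ (LinearMap.range (ExteriorAlgebra.ι ℝ (M := V))) ^ 1
  rw [pow_one]; exact LinearMap.mem_range_self _ a

theorem proj_ι_mul (a : V) (i : ℕ) (x : ExteriorAlgebra ℝ V) :
    extProj (i + 1) (ExteriorAlgebra.ι ℝ a * x) = ExteriorAlgebra.ι ℝ a * extProj i x := by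
  simp only [GradedAlgebra.proj_apply]
  rw [add_comm i 1]
  exact DirectSum.coe_decompose_mul_add_of_left_mem _ (ι_mem a)

theorem contract_mem (d : Module.Dual ℝ V) : ∀ (k : ℕ) (x : ExteriorAlgebra ℝ V),
    x ∈ ⋀[ℝ]^k V →
      (k = 0 → contractLeft (Q := (0 : QuadraticForm ℝ V)) d x = 0) ∧
      ∀ j, k = j + 1 → contractLeft (Q := (0 : QuadraticForm ℝ V)) d x ∈ ⋀[ℝ]^j V := by
  intro k
  induction k with
  | zero =>
    intro x hx
    change x ∈ (LinearMap.range (ExteriorAlgebra.ι ℝ (M := V))) ^ 0 at hx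
    rw [pow_zero, Submodule.mem_one] at hx
    obtain ⟨r, rfl⟩ := hx
    exact ⟨fun _ => contractLeft_algebraMap _ d r, fun j hj => by omega⟩
  | succ k ih =>
    intro x hx
    refine ⟨fun h => by omega, ?_⟩
    rintro j hj
    obtain rfl : j = k := by omega
    change x ∈ (LinearMap.range (ExteriorAlgebra.ι ℝ (M := V))) ^ (j + 1) at hx
    rw [pow_succ'] at hx
    induction hx using Submodule.mul_induction_on' with
    | mem_mul_mem m hm n hn =>
      obtain ⟨a, rfl⟩ := hm
      have := contractLeft_ι_mul (Q := (0 : QuadraticForm ℝ V)) (d := d) a n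
      change contractLeft d (ι 0 a * n) ∈ _
      rw [this]
      refine Submodule.sub_mem _ (Submodule.smul_mem _ _ hn) ?_
      rcases j with _ | j
      · rw [(ih n hn).1 rfl, mul_zero]; exact Submodule.zero_mem _
      · change _ ∈ (LinearMap.range (ExteriorAlgebra.ι ℝ (M := V))) ^ (j + 1)
        rw [pow_succ']
        exact Submodule.mul_mem_mul (LinearMap.mem_range_self _ a) ((ih n hn).2 j rfl)
    | add x _ y _ hx hy => rw [map_add]; exact Submodule.add_mem _ hx hy

theorem proj_contract (d : Module.Dual ℝ V) (i : ℕ) (x : ExteriorAlgebra ℝ V) :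
    extProj i (contractLeft (Q := (0 : QuadraticForm ℝ V)) d x) =
      contractLeft (Q := (0 : QuadraticForm ℝ V)) d (extProj (i + 1) x) := by
  induction x using DirectSum.Decomposition.inductionOn fun i : ℕ => ⋀[ℝ]^i V with
  | zero => simp only [map_zero]
  | add x y hx hy => simp only [map_add, hx, hy]
  | @homogeneous k m =>
    obtain ⟨m, hm⟩ := m
    obtain ⟨h0, h1⟩ := contract_mem d k m hm
    change extProj i (contractLeft d m) = contractLeft d (extProj (i + 1) m)
    by_cases hk : k = i + 1
    · subst hk
      rw [proj_eq_self hm, proj_eq_self (h1 i rfl)]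
    · rw [proj_eq_zero hm hk, map_zero]
      rcases k with _ | k
      · rw [h0 rfl, map_zero]
      · exact proj_eq_zero (h1 k rfl) (by omega)

variable (Q : QuadraticForm ℝ V)

theorem equivExterior_ι_mul (a : V) (y : CliffordAlgebra Q) :
    equivExterior Q (ι Q a * y) = ExteriorAlgebra.ι ℝ a * equivExterior Q y -
      contractLeft (Q := (0 : QuadraticForm ℝ V))
        (QuadraticMap.associated (R := ℝ) (M := V) (-Q) a) (equivExterior Q y) :=
  changeForm_ι_mul changeForm.associated_neg_proof a y

theorem proj_mul (j : ℕ) : ∀ u ∈ ⋀[ℝ]^j V, ∀ (k : ℕ), ∀ v ∈ ⋀[ℝ]^k V, ∀ i, j + k ≤ i →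
    extProj i (equivExterior Q ((equivExterior Q).symm u * (equivExterior Q).symm v)) = extProj i (u * v) := by
  induction j using Nat.strong_induction_on with
  | _ j ih =>
  intro u hu k v hv i hi
  rcases j with _ | j
  · change u ∈ (LinearMap.range (ExteriorAlgebra.ι ℝ (M := V))) ^ 0 at hu
    rw [pow_zero, Submodule.mem_one] at hu
    obtain ⟨r, rfl⟩ := hu
    have h : (equivExterior Q).symm (algebraMap ℝ (ExteriorAlgebra ℝ V) r) =
        algebraMap ℝ (CliffordAlgebra Q) r := by
      rw [LinearEquiv.symm_apply_eq]
      exact (changeForm_algebraMap changeForm.associated_neg_proof r).symm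
    rw [h, ← Algebra.smul_def, ← Algebra.smul_def, map_smul, LinearEquiv.apply_symm_apply]
  · change u ∈ (LinearMap.range (ExteriorAlgebra.ι ℝ (M := V))) ^ (j + 1) at hu
    rw [pow_succ'] at hu
    induction hu using Submodule.mul_induction_on' with
    | add x _ y _ hx hy => simp only [map_add, add_mul, hx, hy]
    | mem_mul_mem m hm n hn =>
      obtain ⟨a, rfl⟩ := hm
      set d := QuadraticMap.associated (R := ℝ) (M := V) (-Q) a with hd
      have h : (equivExterior Q).symm (ExteriorAlgebra.ι ℝ a * n) =
          ι Q a * (equivExterior Q).symm n + (equivExterior Q).symm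
            (contractLeft (Q := (0 : QuadraticForm ℝ V)) d n) := by
        rw [LinearEquiv.symm_apply_eq, map_add, equivExterior_ι_mul,
          LinearEquiv.apply_symm_apply, LinearEquiv.apply_symm_apply]
        exact (sub_add_cancel _ _).symm
      obtain ⟨i, rfl⟩ : ∃ i', i = i' + 1 := ⟨i - 1, by omega⟩
      have h1 := ih j (by omega) n hn k v hv
      have hnv : n * v ∈ ⋀[ℝ]^(j + k) V := SetLike.mul_mem_graded hn hv
      have hc : extProj (i + 1) (equivExterior Q ((equivExterior Q).symm
          (contractLeft (Q := (0 : QuadraticForm ℝ V)) d n) * (equivExterior Q).symm v)) = 0 := by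
        obtain ⟨h0, h2⟩ := contract_mem d j n hn
        rcases j with _ | j
        · rw [h0 rfl]; simp
        · rw [ih j (by omega) _ (h2 j rfl) k v hv _ (by omega)]
          exact proj_eq_zero (SetLike.mul_mem_graded (h2 j rfl) hv) (by omega)
      rw [h, add_mul, mul_assoc, map_add, map_add, hc, add_zero, equivExterior_ι_mul, map_sub,
        proj_ι_mul, ← hd]
      rw [proj_contract, h1 i (by omega), h1 (i + 1 + 1) (by omega),
        proj_eq_zero (i := i + 1 + 1) hnv (by omega), map_zero, sub_zero, mul_assoc, proj_ι_mul]

theorem sum_proj [FiniteDimensional ℝ V] (x : ExteriorAlgebra ℝ V) :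
    ∑ j ∈ Finset.range (Module.finrank ℝ V + 1), extProj j x = x := by
  induction x using DirectSum.Decomposition.inductionOn fun i : ℕ => ⋀[ℝ]^i V with
  | zero => simp only [map_zero, Finset.sum_const_zero]
  | add x y hx hy => simp only [map_add, Finset.sum_add_distrib, hx, hy]
  | @homogeneous k m =>
    obtain ⟨m, hm⟩ := m
    change ∑ j ∈ Finset.range (Module.finrank ℝ V + 1), extProj j m = m
    by_cases hk : k < Module.finrank ℝ V + 1
    · rw [Finset.sum_eq_single_of_mem k (Finset.mem_range.2 hk)
        (fun j _ hj => proj_eq_zero hm hj.symm), proj_eq_self hm]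
    · have h0 : Module.finrank ℝ (⋀[ℝ]^k V) = 0 := by
        rw [exteriorPower.finrank_eq]; exact Nat.choose_eq_zero_of_lt (by omega)
      have : Subsingleton (⋀[ℝ]^k V) := Module.finrank_zero_iff.1 h0
      have hm0 : m = 0 := congrArg Subtype.val (Subsingleton.elim (⟨m, hm⟩ : ⋀[ℝ]^k V) 0)
      subst hm0
      simp only [map_zero, Finset.sum_const_zero]

theorem equivExterior_wedge [FiniteDimensional ℝ V] (A B : CliffordAlgebra Q) :
    equivExterior Q (wedge Q A B) = equivExterior Q A * equivExterior Q B := by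
  conv_rhs => rw [← sum_proj (equivExterior Q A), ← sum_proj (equivExterior Q B)]
  rw [wedge, map_sum, Finset.sum_mul]
  refine Finset.sum_congr rfl fun j _ => ?_
  rw [map_sum, Finset.mul_sum]
  refine Finset.sum_congr rfl fun k _ => ?_
  change equivExterior Q ((equivExterior Q).symm (extProj (j + k) (equivExterior Q
    ((equivExterior Q).symm (extProj j (equivExterior Q A)) *
      (equivExterior Q).symm (extProj k (equivExterior Q B)))))) = _
  rw [LinearEquiv.apply_symm_apply, proj_mul Q j _ (proj_mem j _) k _ (proj_mem k _) _ le_rfl]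
  exact proj_eq_self (SetLike.mul_mem_graded (proj_mem j _) (proj_mem k _))

theorem equivExterior_wedgeList [FiniteDimensional ℝ V] (l : List V) :
    equivExterior Q (wedgeList Q l) = (l.map (ExteriorAlgebra.ι ℝ)).prod := by
  induction l with
  | nil => exact changeForm_one changeForm.associated_neg_proof
  | cons a l ih =>
    change equivExterior Q (wedge Q (ι Q a) (wedgeList Q l)) = _
    rw [equivExterior_wedge, ih, List.map_cons, List.prod_cons]
    congr 1
    exact changeForm_ι changeForm.associated_neg_proof a

theorem wedgeList_reverse_ofFn [FiniteDimensional ℝ V] {k : ℕ} (a : Fin k → V) :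
    wedgeList Q (List.ofFn a).reverse =
      (equivExterior Q).symm (ExteriorAlgebra.ιMulti ℝ k (a ∘ Fin.rev)) := by
  have h : (List.ofFn a).reverse = List.ofFn (a ∘ Fin.rev) := by
    apply List.ext_getElem
    · simp
    · intro i h1 h2
      simp only [List.getElem_reverse, List.getElem_ofFn, List.length_ofFn, Function.comp]
      congr 1
      ext
      simp only [Fin.val_rev]
      omega
  rw [LinearEquiv.eq_symm_apply, equivExterior_wedgeList, ExteriorAlgebra.ιMulti_apply,
    h, List.map_ofFn]
  rfl

end Aux

/-- The dot product with a fixed left factor, as a linear map. -/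
def dotLeft (Q : QuadraticForm ℝ V) (A : CliffordAlgebra Q) :
    CliffordAlgebra Q →ₗ[ℝ] CliffordAlgebra Q where
  toFun B := dot Q A B
  map_add' B C := by simp only [dot, map_add, mul_add, Finset.sum_add_distrib]
  map_smul' r B := by
    simp only [dot, map_smul, mul_smul_comm, Finset.smul_sum, RingHom.id_apply]

/-- The alternating form `Âₖ(a₁, …, aₖ) = ⟨A⟩ₖ · (aₖ ∧ ⋯ ∧ a₁)` conjugate to the grade-`k` part of
a multivector `A`. -/
def tensorConj [FiniteDimensional ℝ V] (Q : QuadraticForm ℝ V) (k : ℕ) (A : CliffordAlgebra Q) :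
    V [⋀^Fin k]→ₗ[ℝ] ℝ :=
  have key : ∀ a : Fin k → V,
      scalarPart Q (dot Q (grade Q k A) (wedgeList Q (List.ofFn a).reverse)) =
        (((scalarPart Q ∘ₗ dotLeft Q (grade Q k A) ∘ₗ
          (equivExterior Q).symm.toLinearMap).compAlternatingMap
            (ExteriorAlgebra.ιMulti ℝ k)).domDomCongr Fin.revPerm) a := fun a => by
    rw [wedgeList_reverse_ofFn]; rfl
  { toFun := fun a => scalarPart Q (dot Q (grade Q k A) (wedgeList Q (List.ofFn a).reverse))
    map_update_add' := fun a i x y => by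
      classical
      simp only [key]
      convert! AlternatingMap.map_update_add _ a i x y
    map_update_smul' := fun a i r x => by
      classical
      simp only [key]
      convert! AlternatingMap.map_update_smul _ a i r x
    map_eq_zero_of_eq' := fun a i j h hij => by
      simp only [key]
      exact AlternatingMap.map_eq_zero_of_eq _ a h hij }

end GeomAlg

/-! ### Pseudo-Riemannian manifolds, multivector fields and differential forms -/

namespace GeomCalc

open GeomAlg Module Filter

variable {E : Type*} [NormedAddCommGroup E] [NormedSpace ℝ E] [FiniteDimensional ℝ E]
  {M : Type*} [TopologicalSpace M] [ChartedSpace E M]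

instance instFiniteDimensionalTangentSpace (p : M) :
    FiniteDimensional ℝ (TangentSpace 𝓘(ℝ, E) p) :=
  inferInstanceAs (FiniteDimensional ℝ E)

variable [IsManifold 𝓘(ℝ, E) ∞ M]

/-- A smooth field of nondegenerate symmetric bilinear forms, of arbitrary signature. -/
structure PseudoRiemannianMetric (E : Type*) [NormedAddCommGroup E] [NormedSpace ℝ E]
    (M : Type*) [TopologicalSpace M] [ChartedSpace E M] [IsManifold 𝓘(ℝ, E) ∞ M] where
  inner (p : M) : TangentSpace 𝓘(ℝ, E) p →L[ℝ] TangentSpace 𝓘(ℝ, E) p →L[ℝ] ℝ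
  symm (p : M) (a b : TangentSpace 𝓘(ℝ, E) p) : inner p a b = inner p b a
  nondegenerate (p : M) (v : TangentSpace 𝓘(ℝ, E) p) (hv : ∀ w, inner p v w = 0) : v = 0
  contMDiff : ContMDiff 𝓘(ℝ, E) (𝓘(ℝ, E).prod 𝓘(ℝ, E →L[ℝ] E →L[ℝ] ℝ)) ∞
    (fun p ↦ Bundle.TotalSpace.mk' (E →L[ℝ] E →L[ℝ] ℝ)
      (E := fun p : M ↦ TangentSpace 𝓘(ℝ, E) p →L[ℝ] TangentSpace 𝓘(ℝ, E) p →L[ℝ] ℝ) p (inner p))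

/-- The dot product of tangent vectors at `p`. -/
def PseudoRiemannianMetric.form (g : PseudoRiemannianMetric E M) (p : M) :
    LinearMap.BilinForm ℝ (TangentSpace 𝓘(ℝ, E) p) :=
  LinearMap.mk₂ ℝ (fun v w => g.inner p v w) (by simp) (by simp) (by simp) (by simp)

theorem PseudoRiemannianMetric.form_nondegenerate (g : PseudoRiemannianMetric E M) (p : M) :
    (g.form p).Nondegenerate :=
  ⟨fun v hv => g.nondegenerate p v hv,
    fun w hw => g.nondegenerate p w fun v => (g.symm p w v).trans (hw v)⟩

/-- The quadratic form `v ↦ v · v` on the tangent space at `p`. -/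
def PseudoRiemannianMetric.quad (g : PseudoRiemannianMetric E M) (p : M) :
    QuadraticForm ℝ (TangentSpace 𝓘(ℝ, E) p) :=
  (g.form p).toQuadraticMap

/-- The geometric tangent space at `p`. -/
abbrev GT (g : PseudoRiemannianMetric E M) (p : M) : Type _ := CliffordAlgebra (g.quad p)

/-- Multivector fields, not necessarily smooth.  A field that is only defined near a point is
represented by an arbitrary extension. -/
abbrev MVField (g : PseudoRiemannianMetric E M) : Type _ := ∀ p : M, GT g p

/-- In the chart at `p`, the tangent vector at `x` with given coordinate components: it sends `v`
to `∑ᵢ vⁱ ∂/∂xⁱ` at `x`. -/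
def coordVec (p x : M) : E →L[ℝ] TangentSpace 𝓘(ℝ, E) x :=
  (trivializationAt E (TangentSpace 𝓘(ℝ, E)) p).symmL ℝ x

/-- The canonical multivector frame `E_J = E_{j₁} ∧ ⋯ ∧ E_{jᵣ}`, with `j₁ < ⋯ < jᵣ` the elements of
`J`, made from the coordinate frame `Eᵢ` of the chart at `p`. -/
def coordFrame (g : PseudoRiemannianMetric E M) (p x : M) (J : Finset (Fin (finrank ℝ E))) :
    GT g x :=
  wedgeList (g.quad x) ((J.sort (· ≤ ·)).map fun i => coordVec p x (finBasis ℝ E i))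

/-- A real function is smooth in a neighbourhood of `p`. -/
def ScalarSmoothNear (φ : M → ℝ) (p : M) : Prop :=
  ∀ᶠ x in 𝓝 p, ContMDiffAt 𝓘(ℝ, E) 𝓘(ℝ, ℝ) ∞ φ x

/-- A vector field is smooth in a neighbourhood of `p`. -/
def VectorSmoothNear (a : ∀ x : M, TangentSpace 𝓘(ℝ, E) x) (p : M) : Prop :=
  ∀ᶠ x in 𝓝 p, ContMDiffAt 𝓘(ℝ, E) 𝓘(ℝ, E).tangent ∞
    (fun y => (⟨y, a y⟩ : TangentBundle 𝓘(ℝ, E) M)) x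

/-- A multivector field is smooth at `p`: its coefficients in the coordinate multivector frame
are. -/
def MVSmoothAt (g : PseudoRiemannianMetric E M) (A : MVField g) (p : M) : Prop :=
  ∃ c : Finset (Fin (finrank ℝ E)) → M → ℝ,
    (∀ J, ContMDiffAt 𝓘(ℝ, E) 𝓘(ℝ, ℝ) ∞ (c J) p) ∧
    ∀ᶠ x in 𝓝 p, A x = ∑ J, c J x • coordFrame g p x J

/-- A multivector field is smooth in a neighbourhood of `p`. -/
def MVSmoothNear (g : PseudoRiemannianMetric E M) (A : MVField g) (p : M) : Prop :=
  ∀ᶠ x in 𝓝 p, MVSmoothAt g A x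

/-- The smooth multivector fields on `M`. -/
def smoothMVFields (g : PseudoRiemannianMetric E M) : Set (MVField g) :=
  {A | ∀ p, MVSmoothAt g A p}

/-! #### The torsion-free multivector directional derivative and its curl -/

/-- `D` is a multivector directional derivative: `D p a A` is the derivative at `p`, in the
direction of the tangent vector `a` at `p`, of a multivector field `A` that is smooth near `p`
(for other `A` the value of `D p a A` is arbitrary). -/
structure IsMDD (g : PseudoRiemannianMetric E M)
    (D : ∀ p : M, TangentSpace 𝓘(ℝ, E) p → MVField g → GT g p) : Prop where
  linear_dir : ∀ (p : M) (a b : TangentSpace 𝓘(ℝ, E) p) (α β : ℝ) (A : MVField g),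
    MVSmoothNear g A p → D p (α • a + β • b) A = α • D p a A + β • D p b A
  scalar : ∀ (p : M) (a : TangentSpace 𝓘(ℝ, E) p) (φ : M → ℝ), ScalarSmoothNear (E := E) φ p →
    D p a (fun x => algebraMap ℝ (GT g x) (φ x)) =
      algebraMap ℝ (GT g p) (mvfderiv 𝓘(ℝ, E) φ p a)
  vector : ∀ (p : M) (a : TangentSpace 𝓘(ℝ, E) p) (v : ∀ x : M, TangentSpace 𝓘(ℝ, E) x),
    VectorSmoothNear v p →
    grade (g.quad p) 1 (D p a (fun x => CliffordAlgebra.ι (g.quad x) (v x))) =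
      D p a (fun x => CliffordAlgebra.ι (g.quad x) (v x))
  add : ∀ (p : M) (a : TangentSpace 𝓘(ℝ, E) p) (A B : MVField g),
    MVSmoothNear g A p → MVSmoothNear g B p →
    D p a (fun x => A x + B x) = D p a A + D p a B
  mul : ∀ (p : M) (a : TangentSpace 𝓘(ℝ, E) p) (A B : MVField g),
    MVSmoothNear g A p → MVSmoothNear g B p →
    D p a (fun x => A x * B x) = D p a A * B p + A p * D p a B

/-- The torsion of `D` vanishes: `D_a b - D_b a = [a, b]` for all smooth vector fields. -/
def IsTorsionFree (g : PseudoRiemannianMetric E M)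
    (D : ∀ p : M, TangentSpace 𝓘(ℝ, E) p → MVField g → GT g p) : Prop :=
  ∀ (p : M) (a b : ∀ x : M, TangentSpace 𝓘(ℝ, E) x), VectorSmoothNear a p →
    VectorSmoothNear b p →
    D p (a p) (fun x => CliffordAlgebra.ι (g.quad x) (b x)) -
        D p (b p) (fun x => CliffordAlgebra.ι (g.quad x) (a x)) =
      CliffordAlgebra.ι (g.quad p) (VectorField.mlieBracket 𝓘(ℝ, E) a b p)

/-- The curl `D ∧ A = ∑ᵢ eⁱ ∧ D_{eᵢ} A`, computed with a basis `eᵢ` of each tangent space and its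
reciprocal basis `eⁱ`. -/
def curl (g : PseudoRiemannianMetric E M)
    (D : ∀ p : M, TangentSpace 𝓘(ℝ, E) p → MVField g → GT g p)
    (e : ∀ p : M, Basis (Fin (finrank ℝ E)) ℝ (TangentSpace 𝓘(ℝ, E) p)) (A : MVField g) :
    MVField g := fun p =>
  ∑ i, wedge (g.quad p)
    (CliffordAlgebra.ι (g.quad p) ((g.form p).dualBasis (g.form_nondegenerate p) (e p) i))
    (D p (e p i) A)

/-! #### Differential forms -/

/-- Differential forms of mixed degree, not necessarily smooth: a totally antisymmetric tensor of
each degree `k` at each point (it is zero for `k` above the dimension). -/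
abbrev DForm (E : Type*) [NormedAddCommGroup E] [NormedSpace ℝ E]
    (M : Type*) [TopologicalSpace M] [ChartedSpace E M] : Type _ :=
  ∀ (p : M) (k : ℕ), TangentSpace 𝓘(ℝ, E) p [⋀^Fin k]→ₗ[ℝ] ℝ

/-- The wedge product of alternating forms, with the normalization
`(α ∧ β)(v₁, …, vⱼ₊ₖ) = ∑_σ sign σ α(v_{σ1}, …, v_{σj}) β(v_{σ(j+1)}, …, v_{σ(j+k)})`,
where `σ` runs over the shuffles. -/
def altWedge {V : Type*} [AddCommGroup V] [Module ℝ V] {j k : ℕ}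
    (α : V [⋀^Fin j]→ₗ[ℝ] ℝ) (β : V [⋀^Fin k]→ₗ[ℝ] ℝ) : V [⋀^Fin (j + k)]→ₗ[ℝ] ℝ :=
  ((LinearMap.mul' ℝ ℝ).compAlternatingMap (α.domCoprod β)).domDomCongr finSumFinEquiv

/-- The wedge product of differential forms of mixed degree. -/
def formWedge (w u : DForm E M) : DForm E M := fun p m =>
  ∑ jk : Finset.HasAntidiagonal.antidiagonal m, (altWedge (w p jk.1.1) (u p jk.1.2)).domDomCongr
    (finCongr (Finset.HasAntidiagonal.mem_antidiagonal.1 jk.2))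

theorem continuous_of_alternating {k : ℕ} (f : E [⋀^Fin k]→ₗ[ℝ] ℝ) : Continuous f := by
  let b := finBasis ℝ E
  have h : ∀ v : Fin k → E, f v =
      ∑ r : Fin k → Fin (finrank ℝ E), (∏ i, b.repr (v i) (r i)) • f fun i => b (r i) := by
    intro v
    conv_lhs => rw [show v = fun i => ∑ j, b.repr (v i) j • b j from
      funext fun i => (b.sum_repr (v i)).symm]
    refine (f.toMultilinearMap.map_sum _).trans (Finset.sum_congr rfl fun r _ => ?_)
    exact f.toMultilinearMap.map_smul_univ _ _
  rw [show (f : (Fin k → E) → ℝ) = _ from funext h]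
  refine continuous_finsetSum _ fun r _ => Continuous.mul (continuous_finsetProd _ fun i _ => ?_)
    continuous_const
  exact ((b.coord (r i)).continuous_of_finiteDimensional).comp (continuous_apply i)

/-- An alternating form on a finite-dimensional normed space, as a continuous one. -/
def toContinuousAlternating {k : ℕ} (f : E [⋀^Fin k]→ₗ[ℝ] ℝ) : E [⋀^Fin k]→L[ℝ] ℝ :=
  { f with cont := continuous_of_alternating f }

/-- The coordinate expression, in the chart at `p`, of the degree-`k` part of a form. -/
def formInChart (w : DForm E M) (p : M) (k : ℕ) : E → E [⋀^Fin k]→L[ℝ] ℝ := fun y =>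
  toContinuousAlternating ((w ((extChartAt 𝓘(ℝ, E) p).symm y) k).compLinearMap
    (coordVec p ((extChartAt 𝓘(ℝ, E) p).symm y)).toLinearMap)

/-- A differential form is smooth at `p`: its coordinate expression is. -/
def FormSmoothAt (w : DForm E M) (p : M) : Prop :=
  ∀ k, ContDiffAt ℝ ∞ (formInChart w p k) (extChartAt 𝓘(ℝ, E) p p)

/-- The smooth differential forms on `M`. -/
def smoothForms (E : Type*) [NormedAddCommGroup E] [NormedSpace ℝ E] [FiniteDimensional ℝ E]
    (M : Type*) [TopologicalSpace M] [ChartedSpace E M] [IsManifold 𝓘(ℝ, E) ∞ M] :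
    Set (DForm E M) :=
  {w | ∀ p, FormSmoothAt w p}

/-- The exterior derivative of differential forms, computed at `p` in the chart at `p`. -/
def formExtDeriv (w : DForm E M) : DForm E M := fun p k =>
  match k with
  | 0 => 0
  | k + 1 => (extDeriv (formInChart w p k) (extChartAt 𝓘(ℝ, E) p p)).toAlternatingMap.compLinearMap
      ((trivializationAt E (TangentSpace 𝓘(ℝ, E)) p).continuousLinearMapAt ℝ p).toLinearMap

/-! #### The tensor conjugate of a multivector field -/

/-- The tensor conjugate `Â`, whose degree-`k` part at `p` is
`(a₁, …, aₖ) ↦ ⟨A⟩ₖ · (aₖ ∧ ⋯ ∧ a₁)`. -/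
def fieldConj (g : PseudoRiemannianMetric E M) (A : MVField g) : DForm E M := fun p k =>
  tensorConj (g.quad p) k (A p)

end GeomCalc

end

/-! Pointwise algebra. For a vector `a` the geometric product splits as `a A = a ∧ A + a ⌋ A`, and
for `A` of grade `k` multiplication on the right gives `(-1)^k (a ∧ A - a ⌋ A)`. Since a product
with too few vectors cannot lower the grade to zero, a vector can be moved from the right factor to
the left one inside a scalar part. Iterating this gives `⟨(b₁ ∧ ⋯ ∧ bₖ)(aₖ ∧ ⋯ ∧ a₁)⟩₀ = det (bᵢ ·
aⱼ)` as repeated Laplace expansion (`scalarPart_wedgeList_mul`). Bijectivity follows, because the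
wedges of a frame and of its reciprocal frame are dual to each other under the conjugate.
Compatibility with wedge products follows too, because determinants are alternatizations of products
of linear forms (`tensorConj_wedge`).

Gauges. Near each point `p` there are linear isometries from the tangent spaces to `T_pM`, smooth in
the base point, equal to the identity at `p` and with symmetric first derivative in coordinates
(`nonempty_gauge`). They come from a square root of the metric relative to its value at `p`,
corrected by a Cayley transform; the resulting derivative is the Christoffel symbol, so the
signature plays no role. Through the gauge a multivector field becomes a function with values in the
fixed algebra `GT_pM`, where all operations are fixed linear or bilinear maps. This gives the
stability of smoothness under the operations. It also gives a torsion-free MDD: differentiate at `p`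
in the gauge at `p`. The Leibniz rule holds because isometries induce algebra homomorphisms, and
torsion vanishes because the derivative of the gauge is symmetric.

Curl. Let `∂ᵢ` be the coordinate frame of a chart and `eⁱ` its reciprocal frame. The conjugate of
`e^J` is `dx^J`, with constant components in the chart, so a field is smooth exactly when its
coefficients in the `e^J` are, and exactly when its conjugate is. For any torsion-free MDD,
differentiating the constant `eⁱ · ∂ⱼ` shows that `D_a eⁱ · b` is symmetric in `a` and `b`. Hence
`eⁱ` is curl-free, and so is every `e^J`. Writing `A = ∑ c_J e^J`, only the derivatives of the `c_J`
survive in the curl, and its conjugate is `∑ dc_J ∧ dx^J`, the exterior derivative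
(`fieldConj_curl`). -/

set_option linter.unusedSectionVars false
set_option linter.unusedVariables false

noncomputable section

namespace GeomAlg

open CliffordAlgebra

/-! ### Left and right multiplication by a vector, and scalar parts of products. -/

section Contraction

variable {V : Type*} [AddCommGroup V] [Module ℝ V] (Q : QuadraticForm ℝ V)

/-- Left contraction of a multivector by a vector. -/
def vecContract (a : V) : CliffordAlgebra Q →ₗ[ℝ] CliffordAlgebra Q :=
  contractLeft (QuadraticMap.associated (R := ℝ) (M := V) Q a)

/-- Exterior multiplication of a multivector by a vector from the left. -/
def vecWedge (a : V) : CliffordAlgebra Q →ₗ[ℝ] CliffordAlgebra Q :=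
  LinearMap.mulLeft ℝ (ι Q a) - vecContract Q a

/-- The multivectors of pure grade `k`. -/
def pureGrade (k : ℕ) : Submodule ℝ (CliffordAlgebra Q) :=
  (⋀[ℝ]^k V).comap (equivExterior Q).toLinearMap

variable {Q}

theorem mem_pureGrade {k : ℕ} {A : CliffordAlgebra Q} :
    A ∈ pureGrade Q k ↔ equivExterior Q A ∈ ⋀[ℝ]^k V := Iff.rfl

theorem equivExterior_contractLeft (d : Module.Dual ℝ V) (A : CliffordAlgebra Q) :
    equivExterior Q (contractLeft d A) =
      contractLeft (Q := (0 : QuadraticForm ℝ V)) d (equivExterior Q A) :=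
  changeForm_contractLeft changeForm.associated_neg_proof d A

theorem equivExterior_algebraMap (r : ℝ) :
    equivExterior Q (algebraMap ℝ _ r) = algebraMap ℝ _ r :=
  changeForm_algebraMap changeForm.associated_neg_proof r

theorem equivExterior_ι (a : V) : equivExterior Q (ι Q a) = ExteriorAlgebra.ι ℝ a :=
  changeForm_ι changeForm.associated_neg_proof a

theorem equivExterior_vecWedge (a : V) (A : CliffordAlgebra Q) :
    equivExterior Q (vecWedge Q a A) = ExteriorAlgebra.ι ℝ a * equivExterior Q A := by
  rw [vecWedge, LinearMap.sub_apply, LinearMap.mulLeft_apply, map_sub, equivExterior_ι_mul,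
    vecContract, equivExterior_contractLeft]
  simp only [map_neg, LinearMap.neg_apply]
  abel

theorem ι_mul_eq (a : V) (A : CliffordAlgebra Q) :
    ι Q a * A = vecWedge Q a A + vecContract Q a A := by
  simp [vecWedge]

theorem vecContract_ι_mul (a b : V) (A : CliffordAlgebra Q) :
    vecContract Q a (ι Q b * A) =
      QuadraticMap.associated (R := ℝ) (M := V) Q a b • A - ι Q b * vecContract Q a A :=
  contractLeft_ι_mul _ _ _

theorem vecContract_comm (a b : V) (A : CliffordAlgebra Q) :
    vecContract Q a (vecContract Q b A) = -vecContract Q b (vecContract Q a A) :=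
  contractLeft_comm _ _ _

theorem vecContract_vecWedge (a b : V) (A : CliffordAlgebra Q) :
    vecContract Q a (vecWedge Q b A) =
      QuadraticMap.associated (R := ℝ) (M := V) Q a b • A - vecWedge Q b (vecContract Q a A) := by
  rw [vecWedge, LinearMap.sub_apply, LinearMap.sub_apply, LinearMap.mulLeft_apply,
    LinearMap.mulLeft_apply, map_sub, vecContract_ι_mul, vecContract_comm]
  abel

theorem vecWedge_vecWedge_comm (a b : V) (A : CliffordAlgebra Q) :
    vecWedge Q a (vecWedge Q b A) = -vecWedge Q b (vecWedge Q a A) := by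
  apply (equivExterior Q).injective
  simp only [map_neg, equivExterior_vecWedge, ← mul_assoc]
  rw [eq_neg_iff_add_eq_zero, ← add_mul, ExteriorAlgebra.ι_add_mul_swap, zero_mul]

theorem vecWedge_mem {k : ℕ} (a : V) {A : CliffordAlgebra Q} (hA : A ∈ pureGrade Q k) :
    vecWedge Q a A ∈ pureGrade Q (k + 1) := by
  rw [mem_pureGrade, equivExterior_vecWedge, add_comm]
  exact SetLike.mul_mem_graded (ι_mem a) hA

theorem vecContract_mem {k : ℕ} (a : V) {A : CliffordAlgebra Q} (hA : A ∈ pureGrade Q (k + 1)) :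
    vecContract Q a A ∈ pureGrade Q k := by
  rw [mem_pureGrade, vecContract, equivExterior_contractLeft]
  exact (contract_mem _ (k + 1) _ hA).2 k rfl

theorem vecContract_eq_zero (a : V) {A : CliffordAlgebra Q} (hA : A ∈ pureGrade Q 0) :
    vecContract Q a A = 0 := by
  apply (equivExterior Q).injective
  rw [vecContract, equivExterior_contractLeft, map_zero]
  exact (contract_mem _ 0 _ hA).1 rfl

theorem mem_pureGrade_zero {A : CliffordAlgebra Q} :
    A ∈ pureGrade Q 0 ↔ ∃ r, algebraMap ℝ _ r = A := by
  rw [mem_pureGrade]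
  change _ ∈ (LinearMap.range (ExteriorAlgebra.ι ℝ (M := V))) ^ 0 ↔ _
  rw [pow_zero, Submodule.mem_one]
  simp only [← equivExterior_algebraMap (Q := Q), EmbeddingLike.apply_eq_iff_eq]

theorem one_mem_pureGrade : (1 : CliffordAlgebra Q) ∈ pureGrade Q 0 :=
  mem_pureGrade_zero.2 ⟨1, map_one _⟩

theorem ι_mem_pureGrade (a : V) : ι Q a ∈ pureGrade Q 1 := by
  rw [mem_pureGrade, equivExterior_ι]; exact ι_mem a

/-- The exterior powers are the powers of the range of `ι`, so grade `k + 1` is spanned by products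
`a ∧ A` with `A` of grade `k`. -/
theorem pureGrade_induction (P : ℕ → CliffordAlgebra Q → Prop)
    (algebraMap : ∀ r, P 0 (algebraMap ℝ _ r))
    (wedge : ∀ k a A, A ∈ pureGrade Q k → P k A → P (k + 1) (vecWedge Q a A))
    (add : ∀ k A B, P k A → P k B → P k (A + B)) :
    ∀ k, ∀ A ∈ pureGrade Q k, P k A := by
  intro k
  induction k with
  | zero =>
    intro A hA
    obtain ⟨r, rfl⟩ := mem_pureGrade_zero.1 hA
    exact algebraMap r
  | succ k ih =>
    intro A hA
    have key : ∀ u ∈ (LinearMap.range (ExteriorAlgebra.ι ℝ (M := V))) *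
        (LinearMap.range (ExteriorAlgebra.ι ℝ (M := V))) ^ k,
        P (k + 1) ((equivExterior Q).symm u) := by
      intro u hu
      induction hu using Submodule.mul_induction_on' with
      | mem_mul_mem m hm n hn =>
        obtain ⟨a, rfl⟩ := hm
        have hn' : (equivExterior Q).symm n ∈ pureGrade Q k := by
          rw [mem_pureGrade, LinearEquiv.apply_symm_apply]; exact hn
        have := wedge k a _ hn' (ih _ hn')
        rwa [← (equivExterior Q).symm_apply_apply (vecWedge Q a _), equivExterior_vecWedge,
          LinearEquiv.apply_symm_apply] at this
      | add x _ y _ hx hy => rw [map_add]; exact add _ _ _ hx hy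
    rw [← (equivExterior Q).symm_apply_apply A]
    refine key _ ?_
    rw [← pow_succ']
    exact hA

/-- Moving `a` from the left of `A` to the right costs `(-1)^k` on the wedge part and the opposite
sign on the contraction. Together with `ι_mul_eq` this recovers both parts from the two geometric
products. -/
theorem mul_ι_eq (a : V) : ∀ (k : ℕ), ∀ A ∈ pureGrade Q k,
    A * ι Q a = (-1 : ℝ) ^ k • (vecWedge Q a A - vecContract Q a A) := by
  intro k
  -- Replacing `b ∧ A` by `b A - b ⌋ A` brings in grade `j` and grade `j - 1`. The structural
  -- induction below supplies the first; strong induction supplies the second.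
  induction k using Nat.strong_induction_on with
  | _ k IH =>
  intro A hA
  have h0 : ∀ r : ℝ, algebraMap ℝ _ r * ι Q a = vecWedge Q a (algebraMap ℝ _ r) -
      vecContract Q a (algebraMap ℝ _ r) := by
    intro r
    rw [vecContract_eq_zero a (mem_pureGrade_zero.2 ⟨r, rfl⟩), sub_zero, vecWedge,
      LinearMap.sub_apply, vecContract_eq_zero a (mem_pureGrade_zero.2 ⟨r, rfl⟩), sub_zero,
      LinearMap.mulLeft_apply, Algebra.commutes]
  refine pureGrade_induction (fun j A => j ≤ k → A * ι Q a =
    (-1 : ℝ) ^ j • (vecWedge Q a A - vecContract Q a A)) ?_ ?_ ?_ k A hA le_rfl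
  · intro r _; rw [pow_zero, one_smul, h0]
  · intro j b A hA ih hj
    have hb : vecWedge Q b A = ι Q b * A - vecContract Q b A := by rw [ι_mul_eq]; abel
    have hc : vecContract Q b A * ι Q a = -((-1 : ℝ) ^ j •
        (vecWedge Q a (vecContract Q b A) - vecContract Q a (vecContract Q b A))) := by
      rcases j with _ | j
      · rw [vecContract_eq_zero b hA]; simp
      · rw [IH j (by omega) _ (vecContract_mem b hA), pow_succ]
        simp
    rw [hb, sub_mul, mul_assoc, ih (by omega), hc, mul_smul_comm, mul_sub, ι_mul_eq, ι_mul_eq,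
      vecContract_vecWedge, ← hb, vecContract_vecWedge, vecWedge_vecWedge_comm a b,
      vecContract_comm a b, pow_succ, QuadraticMap.associated_isSymm ℝ Q a b]
    simp only [mul_neg, mul_one, neg_smul]
    module
  · intro j A B hA hB hj
    rw [add_mul, hA hj, hB hj, map_add, map_add, ← smul_add]
    congr 1; abel

/-- The contractions in the two products cancel. The wedge with a vector is thus expressed by
geometric products alone, so that a Leibniz rule for the latter passes to the former. -/
theorem vecWedge_eq {a : V} {k : ℕ} {A : CliffordAlgebra Q} (hA : A ∈ pureGrade Q k) :
    vecWedge Q a A = (2⁻¹ : ℝ) • (ι Q a * A + (-1 : ℝ) ^ k • (A * ι Q a)) := by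
  rw [mul_ι_eq a k A hA, ι_mul_eq, smul_smul, ← mul_pow]
  norm_num
  module

theorem scalarPart_algebraMap (r : ℝ) : scalarPart Q (algebraMap ℝ _ r) = r := by
  change ExteriorAlgebra.algebraMapInv (equivExterior Q _) = r
  rw [equivExterior_algebraMap]
  exact ExteriorAlgebra.algebraMap_leftInverse V r

theorem scalarPart_eq_zero {k : ℕ} {A : CliffordAlgebra Q} (hA : A ∈ pureGrade Q (k + 1)) :
    scalarPart Q A = 0 := by
  refine pureGrade_induction (fun j A => j ≠ 0 → scalarPart Q A = 0) (fun r h => absurd rfl h)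
    ?_ ?_ (k + 1) A hA (by omega)
  · intro k a A _ _ _
    change ExteriorAlgebra.algebraMapInv (equivExterior Q _) = 0
    rw [equivExterior_vecWedge, map_mul, ExteriorAlgebra.algebraMapInv,
      ExteriorAlgebra.lift_ι_apply, LinearMap.zero_apply, zero_mul]
  · intro j A B hA hB hj
    rw [map_add, hA hj, hB hj, add_zero]

/-- Each vector factor of `B` changes the grade of what stands to its left by one, so fewer than `j`
vectors cannot bring grade `j` down to zero. -/
theorem scalarPart_mul_eq_zero : ∀ (k : ℕ), ∀ B ∈ pureGrade Q k, ∀ j, k < j →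
    ∀ A ∈ pureGrade Q j, scalarPart Q (A * B) = 0 := by
  intro k
  induction k using Nat.strong_induction_on with
  | _ k IH =>
  intro B hB
  refine pureGrade_induction (fun k' B => k' ≤ k → ∀ j, k' < j →
    ∀ A ∈ pureGrade Q j, scalarPart Q (A * B) = 0) ?_ ?_ ?_ k B hB le_rfl
  · intro r _ j hj A hA
    obtain ⟨j, rfl⟩ : ∃ i, j = i + 1 := ⟨j - 1, by omega⟩
    rw [← Algebra.commutes, ← Algebra.smul_def, map_smul, scalarPart_eq_zero hA, smul_zero]
  · intro i b B hB ih hi j hj A hA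
    obtain ⟨j, rfl⟩ : ∃ i, j = i + 1 := ⟨j - 1, by omega⟩
    have hb : vecWedge Q b B = ι Q b * B - vecContract Q b B := by rw [ι_mul_eq]; abel
    have hc : scalarPart Q (A * vecContract Q b B) = 0 := by
      rcases i with _ | i
      · rw [vecContract_eq_zero b hB]; simp
      · exact IH i (by omega) _ (vecContract_mem b hB) _ (by omega) A hA
    rw [hb, mul_sub, ← mul_assoc, mul_ι_eq b _ A hA, map_sub, hc, sub_zero, smul_mul_assoc,
      map_smul, sub_mul, map_sub, ih (by omega) _ (by omega) _ (vecWedge_mem b hA),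
      ih (by omega) _ (by omega) _ (vecContract_mem b hA), sub_zero, smul_zero]
  · intro i A B hA hB hi j hj C hC
    rw [mul_add, map_add, hA hi j hj C hC, hB hi j hj C hC, add_zero]

/-- In `A (a ∧ B) = A a B - A (a ⌋ B)` the last term has no scalar part for reasons of grade. In `A
a = (-1)^(k+1) (a ∧ A - a ⌋ A)` the wedge drops out for the same reason, leaving the sign `(-1)^k`.
This is the adjointness of wedge and contraction that drives the determinant formula. -/
theorem scalarPart_mul_vecWedge {k : ℕ} (a : V) {A B : CliffordAlgebra Q}
    (hA : A ∈ pureGrade Q (k + 1)) (hB : B ∈ pureGrade Q k) :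
    scalarPart Q (A * vecWedge Q a B) = (-1) ^ k * scalarPart Q (vecContract Q a A * B) := by
  have hb : vecWedge Q a B = ι Q a * B - vecContract Q a B := by rw [ι_mul_eq]; abel
  have hc : scalarPart Q (A * vecContract Q a B) = 0 := by
    rcases k with _ | k
    · rw [vecContract_eq_zero a hB]; simp
    · exact scalarPart_mul_eq_zero k _ (vecContract_mem a hB) _ (by omega) A hA
  rw [hb, mul_sub, ← mul_assoc, mul_ι_eq a _ A hA, map_sub, hc, sub_zero, smul_mul_assoc,
    map_smul, sub_mul, map_sub,
    scalarPart_mul_eq_zero k B hB (k + 1 + 1) (by omega) _ (vecWedge_mem a hA), pow_succ]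
  simp

end Contraction

end GeomAlg

end

noncomputable section

namespace GeomAlg

open CliffordAlgebra

/-! ### Grades, and the tensor conjugate of a product of vectors as a determinant. -/

section Grade

variable {V : Type*} [AddCommGroup V] [Module ℝ V] {Q : QuadraticForm ℝ V}

theorem equivExterior_grade (k : ℕ) (A : CliffordAlgebra Q) :
    equivExterior Q (grade Q k A) = extProj k (equivExterior Q A) :=
  (equivExterior Q).apply_symm_apply _

theorem grade_mem (k : ℕ) (A : CliffordAlgebra Q) : grade Q k A ∈ pureGrade Q k := by
  rw [mem_pureGrade, equivExterior_grade]; exact proj_mem k _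

theorem grade_eq_self {k : ℕ} {A : CliffordAlgebra Q} (hA : A ∈ pureGrade Q k) :
    grade Q k A = A := by
  apply (equivExterior Q).injective
  rw [equivExterior_grade]; exact proj_eq_self hA

theorem grade_eq_zero {k i : ℕ} {A : CliffordAlgebra Q} (hA : A ∈ pureGrade Q k) (h : k ≠ i) :
    grade Q i A = 0 := by
  apply (equivExterior Q).injective
  rw [equivExterior_grade, map_zero]; exact proj_eq_zero hA h

theorem grade_zero_eq (A : CliffordAlgebra Q) :
    grade Q 0 A = algebraMap ℝ _ (scalarPart Q A) := by
  have h : ∀ x : ExteriorAlgebra ℝ V,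
      extProj 0 x = algebraMap ℝ _ (ExteriorAlgebra.algebraMapInv x) := by
    intro x
    induction x using DirectSum.Decomposition.inductionOn fun i : ℕ => ⋀[ℝ]^i V with
    | zero => simp only [map_zero]
    | add x y hx hy => simp only [map_add, hx, hy]
    | @homogeneous k m =>
      obtain ⟨m, hm⟩ := m
      change extProj 0 m = algebraMap ℝ _ (ExteriorAlgebra.algebraMapInv m)
      have hm' : (equivExterior Q).symm m ∈ pureGrade Q k := by
        rw [mem_pureGrade, LinearEquiv.apply_symm_apply]; exact hm
      rcases k with _ | k
      · obtain ⟨r, hr⟩ := mem_pureGrade_zero.1 hm'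
        rw [LinearEquiv.eq_symm_apply, equivExterior_algebraMap] at hr
        rw [proj_eq_self hm, ← hr, ExteriorAlgebra.algebraMap_leftInverse]
      · have := scalarPart_eq_zero hm'
        rw [proj_eq_zero hm (by omega)]
        change ExteriorAlgebra.algebraMapInv (equivExterior Q ((equivExterior Q).symm m)) = 0 at this
        rw [LinearEquiv.apply_symm_apply] at this
        rw [this, map_zero]
  apply (equivExterior Q).injective
  rw [equivExterior_grade, equivExterior_algebraMap, h]
  rfl

variable [FiniteDimensional ℝ V]

theorem sum_grade (A : CliffordAlgebra Q) :
    ∑ k ∈ Finset.range (Module.finrank ℝ V + 1), grade Q k A = A := by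
  apply (equivExterior Q).injective
  rw [map_sum]
  simp only [equivExterior_grade]
  exact sum_proj _

theorem eq_zero_of_finrank_lt {k : ℕ} (hk : Module.finrank ℝ V < k) {A : CliffordAlgebra Q}
    (hA : A ∈ pureGrade Q k) : A = 0 := by
  rw [← sum_grade A]
  refine Finset.sum_eq_zero fun j hj => grade_eq_zero hA ?_
  have := Finset.mem_range.1 hj
  omega

theorem grade_eq_zero_of_finrank_lt {k : ℕ} (hk : Module.finrank ℝ V < k)
    (A : CliffordAlgebra Q) : grade Q k A = 0 :=
  eq_zero_of_finrank_lt hk (grade_mem k A)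

theorem wedge_ι (a : V) (A : CliffordAlgebra Q) : wedge Q (ι Q a) A = vecWedge Q a A := by
  apply (equivExterior Q).injective
  rw [equivExterior_wedge, equivExterior_vecWedge, equivExterior_ι]

theorem wedgeList_cons (a : V) (l : List V) :
    wedgeList Q (a :: l) = vecWedge Q a (wedgeList Q l) := by
  rw [← wedge_ι]; rfl

theorem wedgeList_mem (l : List V) : wedgeList Q l ∈ pureGrade Q l.length := by
  induction l with
  | nil => exact one_mem_pureGrade
  | cons a l ih => rw [wedgeList_cons]; exact vecWedge_mem a ih

theorem dot_eq {k : ℕ} {A B : CliffordAlgebra Q} (hA : A ∈ pureGrade Q k)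
    (hB : B ∈ pureGrade Q k) : dot Q A B = algebraMap ℝ _ (scalarPart Q (A * B)) := by
  -- The sums that define `dot` stop at the dimension; above it the grade is zero, so both sides
  -- vanish.
  by_cases hk : Module.finrank ℝ V < k
  · rw [eq_zero_of_finrank_lt hk hA]
    simp [dot]
  · rw [dot, Finset.sum_eq_single_of_mem k (Finset.mem_range.2 (by omega)),
      Finset.sum_eq_single_of_mem k (Finset.mem_range.2 (by omega)), grade_eq_self hA,
      grade_eq_self hB, Nat.sub_self, grade_zero_eq]
    · intro j _ hj
      rw [grade_eq_zero hA hj.symm, zero_mul, map_zero]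
    · intro j _ hj
      refine Finset.sum_eq_zero fun i _ => ?_
      rw [grade_eq_zero hB hj.symm, mul_zero, map_zero]

theorem wedgeList_reverse_mem {k : ℕ} (a : Fin k → V) :
    wedgeList Q (List.ofFn a).reverse ∈ pureGrade Q k := by
  have := wedgeList_mem (Q := Q) (List.ofFn a).reverse
  rwa [List.length_reverse, List.length_ofFn] at this

theorem wedgeList_ofFn_mem {k : ℕ} (a : Fin k → V) :
    wedgeList Q (List.ofFn a) ∈ pureGrade Q k := by
  have := wedgeList_mem (Q := Q) (List.ofFn a)
  rwa [List.length_ofFn] at this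

theorem tensorConj_apply (k : ℕ) (A : CliffordAlgebra Q) (a : Fin k → V) :
    tensorConj Q k A a = scalarPart Q (grade Q k A * wedgeList Q (List.ofFn a).reverse) := by
  change scalarPart Q (dot Q (grade Q k A) (wedgeList Q (List.ofFn a).reverse)) = _
  rw [dot_eq (grade_mem k A) (wedgeList_reverse_mem a), scalarPart_algebraMap]

theorem tensorConj_add (k : ℕ) (A B : CliffordAlgebra Q) :
    tensorConj Q k (A + B) = tensorConj Q k A + tensorConj Q k B := by
  ext a
  simp only [tensorConj_apply, AlternatingMap.add_apply, map_add, add_mul]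

theorem tensorConj_smul (k : ℕ) (r : ℝ) (A : CliffordAlgebra Q) :
    tensorConj Q k (r • A) = r • tensorConj Q k A := by
  ext a
  simp only [tensorConj_apply, AlternatingMap.smul_apply, map_smul, smul_mul_assoc]

variable (Q) in
/-- The tensor conjugate as a linear map. -/
def tensorConjHom (k : ℕ) : CliffordAlgebra Q →ₗ[ℝ] V [⋀^Fin k]→ₗ[ℝ] ℝ where
  toFun := tensorConj Q k
  map_add' := tensorConj_add k
  map_smul' := tensorConj_smul k

theorem tensorConj_sum {ι : Type*} (s : Finset ι) (k : ℕ) (A : ι → CliffordAlgebra Q) :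
    tensorConj Q k (∑ i ∈ s, A i) = ∑ i ∈ s, tensorConj Q k (A i) :=
  map_sum (tensorConjHom Q k) A s

theorem tensorConj_eq_zero {k j : ℕ} (h : j ≠ k) {A : CliffordAlgebra Q}
    (hA : A ∈ pureGrade Q j) : tensorConj Q k A = 0 := by
  ext a
  rw [tensorConj_apply, grade_eq_zero hA h, zero_mul, map_zero, AlternatingMap.zero_apply]

/-- Contraction by a vector is an antiderivation of the wedge product. The alternating sum is what
becomes a column expansion of a determinant. -/
theorem vecContract_wedgeList (a : V) : ∀ (k : ℕ) (b : Fin (k + 1) → V),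
    vecContract Q a (wedgeList Q (List.ofFn b)) =
      ∑ i : Fin (k + 1), ((-1) ^ (i : ℕ) * QuadraticMap.associated (R := ℝ) (M := V) Q (b i) a) •
        wedgeList Q (List.ofFn (b ∘ i.succAbove)) := by
  intro k
  induction k with
  | zero =>
    intro b
    rw [List.ofFn_succ, wedgeList_cons, vecContract_vecWedge,
      vecContract_eq_zero a (wedgeList_ofFn_mem _), map_zero, sub_zero,
      QuadraticMap.associated_isSymm ℝ Q a (b 0)]
    simp
  | succ k ih =>
    intro b
    rw [List.ofFn_succ, wedgeList_cons, vecContract_vecWedge, ih, map_sum,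
      Fin.sum_univ_succ (n := k + 1),
      QuadraticMap.associated_isSymm ℝ Q a (b 0), sub_eq_add_neg, ← Finset.sum_neg_distrib]
    congr 1
    · simp only [Fin.val_zero, pow_zero, one_mul]
      rfl
    · refine Finset.sum_congr rfl fun i _ => ?_
      rw [List.ofFn_succ (f := b ∘ i.succ.succAbove), wedgeList_cons, map_smul, ← neg_smul,
        Fin.val_succ, pow_succ, mul_neg_one, neg_mul]
      congr 3
      congr 1
      ext j
      simp

theorem ofFn_reverse_succ {α : Type*} {k : ℕ} (a : Fin (k + 1) → α) :
    (List.ofFn a).reverse = a (Fin.last k) :: (List.ofFn (a ∘ Fin.castSucc)).reverse := by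
  rw [List.ofFn_succ', List.concat_eq_append, List.reverse_append]; rfl

/-- The reversed wedge begins with the last vector; moving it to the left as a contraction produces
the Laplace expansion along the last column. The `(-1)^k` of the move and the `(-1)^i` of the
contraction give exactly the cofactor sign, which is why the conjugate reverses its arguments. -/
theorem scalarPart_wedgeList_mul : ∀ (k : ℕ) (b a : Fin k → V),
    scalarPart Q (wedgeList Q (List.ofFn b) * wedgeList Q (List.ofFn a).reverse) =
      (Matrix.of fun i j => QuadraticMap.associated (R := ℝ) (M := V) Q (b i) (a j)).det := by
  intro k
  induction k with
  | zero =>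
    intro b a
    simp only [List.ofFn_zero, List.reverse_nil, Matrix.det_fin_zero]
    change scalarPart Q (1 * 1) = 1
    rw [one_mul, ← map_one (algebraMap ℝ (CliffordAlgebra Q)), scalarPart_algebraMap]
  | succ k ih =>
    intro b a
    rw [ofFn_reverse_succ, wedgeList_cons, scalarPart_mul_vecWedge _ (wedgeList_ofFn_mem b)
      (wedgeList_reverse_mem _), vecContract_wedgeList, Finset.sum_mul, map_sum, Finset.mul_sum,
      Matrix.det_succ_column _ (Fin.last k)]
    refine Finset.sum_congr rfl fun i _ => ?_
    rw [smul_mul_assoc, map_smul, ih, Fin.val_last, pow_add, smul_eq_mul, Fin.succAbove_last]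
    simp only [Matrix.of_apply]
    rw [← mul_assoc, ← mul_assoc, mul_comm ((-1 : ℝ) ^ k)]
    rfl

theorem tensorConj_wedgeList {k : ℕ} (b a : Fin k → V) :
    tensorConj Q k (wedgeList Q (List.ofFn b)) a =
      (Matrix.of fun i j => QuadraticMap.associated (R := ℝ) (M := V) Q (b i) (a j)).det := by
  rw [tensorConj_apply, grade_eq_self (wedgeList_ofFn_mem b), scalarPart_wedgeList_mul]

/-- Linear maps on multivectors are equal if they agree on wedge products of vectors. -/
theorem hom_ext_wedgeList {W : Type*} [AddCommGroup W] [Module ℝ W]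
    {f g : CliffordAlgebra Q →ₗ[ℝ] W}
    (h : ∀ k (b : Fin k → V), f (wedgeList Q (List.ofFn b)) = g (wedgeList Q (List.ofFn b))) :
    f = g := by
  have : f ∘ₗ (equivExterior Q).symm.toLinearMap = g ∘ₗ (equivExterior Q).symm.toLinearMap := by
    refine ExteriorAlgebra.lhom_ext fun k => ?_
    ext b
    have hb : (equivExterior Q).symm (ExteriorAlgebra.ιMulti ℝ k b) =
        wedgeList Q (List.ofFn b) := by
      rw [LinearEquiv.symm_apply_eq, equivExterior_wedgeList, ExteriorAlgebra.ιMulti_apply,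
        List.map_ofFn]
      rfl
    have := h k b
    rw [← hb] at this
    exact this
  refine LinearMap.ext fun A => ?_
  have := LinearMap.congr_fun this (equivExterior Q A)
  change f ((equivExterior Q).symm (equivExterior Q A)) =
    g ((equivExterior Q).symm (equivExterior Q A)) at this
  rwa [LinearEquiv.symm_apply_apply] at this

end Grade

end GeomAlg

end

noncomputable section

namespace GeomAlg

open CliffordAlgebra

/-! ### The conjugate of a wedge product. -/

section Conjugate

variable {V : Type*} [AddCommGroup V] [Module ℝ V] [FiniteDimensional ℝ V] {Q : QuadraticForm ℝ V}

/-- Both sides are linear in `A`, so `A` may be a wedge of vectors. Then `v` adds a top row to the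
determinant, and the formula is the expansion along that row. It turns the curl into the alternating
sum found in the exterior derivative. -/
theorem tensorConj_vecWedge (k : ℕ) (v : V) (A : CliffordAlgebra Q) (a : Fin (k + 1) → V) :
    tensorConj Q (k + 1) (vecWedge Q v A) a =
      ∑ m : Fin (k + 1), (-1) ^ (m : ℕ) * QuadraticMap.associated (R := ℝ) (M := V) Q v (a m) *
        tensorConj Q k A (m.removeNth a) := by
  let ev : ∀ {j : ℕ} (a : Fin j → V), (V [⋀^Fin j]→ₗ[ℝ] ℝ) →ₗ[ℝ] ℝ := fun a =>
    { toFun := fun f => f a, map_add' := fun _ _ => rfl, map_smul' := fun _ _ => rfl }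
  let F : CliffordAlgebra Q →ₗ[ℝ] ℝ := ev a ∘ₗ tensorConjHom Q (k + 1) ∘ₗ vecWedge Q v
  let G : CliffordAlgebra Q →ₗ[ℝ] ℝ := ∑ m : Fin (k + 1),
    ((-1) ^ (m : ℕ) * QuadraticMap.associated (R := ℝ) (M := V) Q v (a m)) •
      (ev (m.removeNth a) ∘ₗ tensorConjHom Q k)
  have hG : ∀ A, G A = ∑ m : Fin (k + 1),
      (-1) ^ (m : ℕ) * QuadraticMap.associated (R := ℝ) (M := V) Q v (a m) *
        tensorConj Q k A (m.removeNth a) := fun A => by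
    simp only [G, LinearMap.sum_apply]
    rfl
  rw [← hG]
  refine LinearMap.congr_fun (f := F) (hom_ext_wedgeList fun j b => ?_) A
  rw [hG]
  change tensorConj Q (k + 1) (vecWedge Q v (wedgeList Q (List.ofFn b))) a = _
  by_cases hj : j = k
  · subst hj
    have : vecWedge Q v (wedgeList Q (List.ofFn b)) =
        wedgeList Q (List.ofFn (Fin.cons v b : Fin (j + 1) → V)) := by
      rw [List.ofFn_succ, wedgeList_cons]; simp
    rw [this, tensorConj_wedgeList, Matrix.det_succ_row_zero]
    refine Finset.sum_congr rfl fun m _ => ?_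
    rw [tensorConj_wedgeList]
    rfl
  · rw [tensorConj_eq_zero (by omega) (vecWedge_mem v (wedgeList_ofFn_mem b))]
    simp only [tensorConj_eq_zero hj (wedgeList_ofFn_mem b), AlternatingMap.zero_apply, mul_zero,
      Finset.sum_const_zero]

/-! ### Wedge products -/

variable (Q) in
/-- The multilinear form `(aᵢ) ↦ ∏ᵢ bᵢ · aᵢ`. -/
def prodForm {ι : Type*} [Fintype ι] (b : ι → V) : MultilinearMap ℝ (fun _ : ι => V) ℝ :=
  (MultilinearMap.mkPiAlgebra ℝ ι ℝ).compLinearMap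
    fun i => QuadraticMap.associated (R := ℝ) (M := V) Q (b i)

theorem alternatization_prodForm {ι : Type*} [Fintype ι] [DecidableEq ι] (b a : ι → V) :
    MultilinearMap.alternatization (prodForm Q b) a =
      (Matrix.of fun i j => QuadraticMap.associated (R := ℝ) (M := V) Q (b i) (a j)).det := by
  rw [MultilinearMap.alternatization_apply, ← Matrix.det_transpose, Matrix.det_apply]
  refine Finset.sum_congr rfl fun σ _ => ?_
  simp [prodForm]

/-- As an alternatization the conjugate can be fed to the shuffle product, which is compatible with
alternatization. -/
theorem tensorConj_wedgeList_eq {k : ℕ} (b : Fin k → V) :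
    tensorConj Q k (wedgeList Q (List.ofFn b)) =
      MultilinearMap.alternatization (prodForm Q b) := by
  ext a; rw [tensorConj_wedgeList, alternatization_prodForm]

end Conjugate

end GeomAlg

namespace GeomCalc

open CliffordAlgebra GeomAlg

variable {V : Type*} [AddCommGroup V] [Module ℝ V]

/-- The wedge product of alternating forms as a bilinear map. -/
def altWedgeHom (j k : ℕ) : (V [⋀^Fin j]→ₗ[ℝ] ℝ) →ₗ[ℝ] (V [⋀^Fin k]→ₗ[ℝ] ℝ) →ₗ[ℝ]
    (V [⋀^Fin (j + k)]→ₗ[ℝ] ℝ) :=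
  TensorProduct.curry ((AlternatingMap.domDomCongrₗ ℝ finSumFinEquiv).toLinearMap ∘ₗ
    LinearMap.compAlternatingMapₗ ℝ (LinearMap.mul' ℝ ℝ) ∘ₗ AlternatingMap.domCoprod')

theorem altWedgeHom_apply {j k : ℕ} (α : V [⋀^Fin j]→ₗ[ℝ] ℝ) (β : V [⋀^Fin k]→ₗ[ℝ] ℝ) :
    altWedgeHom j k α β = altWedge α β := rfl

variable [FiniteDimensional ℝ V] {Q : QuadraticForm ℝ V}

/-- The shuffle product of two alternatizations is the alternatization of the tensor product, and
the tensor product of two products of linear forms is the product over the concatenated family. -/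
theorem altWedge_tensorConj {j k : ℕ} (b : Fin j → V) (c : Fin k → V) :
    altWedge (tensorConj Q j (wedgeList Q (List.ofFn b)))
      (tensorConj Q k (wedgeList Q (List.ofFn c))) =
        tensorConj Q (j + k) (wedgeList Q (List.ofFn (Fin.append b c))) := by
  rw [tensorConj_wedgeList_eq, tensorConj_wedgeList_eq, altWedge,
    ← MultilinearMap.domCoprod_alternization, ← LinearMap.compMultilinearMap_alternatization]
  have : (LinearMap.mul' ℝ ℝ).compMultilinearMap ((prodForm Q b).domCoprod (prodForm Q c)) =
      prodForm Q (Sum.elim b c) := by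
    ext a
    simp [prodForm]
  rw [this]
  ext a
  rw [AlternatingMap.domDomCongr_apply, alternatization_prodForm, tensorConj_wedgeList,
    ← Matrix.det_submatrix_equiv_self finSumFinEquiv]
  congr 1
  ext x y
  rcases x with x | x <;> simp

theorem wedge_wedgeList (l l' : List V) :
    wedge Q (wedgeList Q l) (wedgeList Q l') = wedgeList Q (l ++ l') := by
  apply (equivExterior Q).injective
  rw [equivExterior_wedge, equivExterior_wedgeList, equivExterior_wedgeList,
    equivExterior_wedgeList, List.map_append, List.prod_append]

variable (Q) in
/-- The wedge product of multivectors as a bilinear map. -/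
def wedgeHom : CliffordAlgebra Q →ₗ[ℝ] CliffordAlgebra Q →ₗ[ℝ] CliffordAlgebra Q :=
  LinearMap.mk₂ ℝ (wedge Q)
    (fun A B C => (equivExterior Q).injective (by simp only [equivExterior_wedge, map_add, add_mul]))
    (fun r A B => (equivExterior Q).injective (by
      simp only [equivExterior_wedge, map_smul, smul_mul_assoc]))
    (fun A B C => (equivExterior Q).injective (by simp only [equivExterior_wedge, map_add, mul_add]))
    (fun r A B => (equivExterior Q).injective (by
      simp only [equivExterior_wedge, map_smul, mul_smul_comm]))

theorem tensorConj_wedge (m : ℕ) (A B : CliffordAlgebra Q) :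
    tensorConj Q m (wedge Q A B) = ∑ jk : Finset.HasAntidiagonal.antidiagonal m,
      (altWedge (tensorConj Q jk.1.1 A) (tensorConj Q jk.1.2 B)).domDomCongr
        (finCongr (Finset.HasAntidiagonal.mem_antidiagonal.1 jk.2)) := by
  let F : CliffordAlgebra Q →ₗ[ℝ] CliffordAlgebra Q →ₗ[ℝ] V [⋀^Fin m]→ₗ[ℝ] ℝ :=
    (wedgeHom Q).compr₂ (tensorConjHom Q m)
  let G : CliffordAlgebra Q →ₗ[ℝ] CliffordAlgebra Q →ₗ[ℝ] V [⋀^Fin m]→ₗ[ℝ] ℝ :=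
    ∑ jk : Finset.HasAntidiagonal.antidiagonal m,
      ((altWedgeHom jk.1.1 jk.1.2).compl₁₂ (tensorConjHom Q jk.1.1)
        (tensorConjHom Q jk.1.2)).compr₂ (AlternatingMap.domDomCongrₗ ℝ
          (finCongr (Finset.HasAntidiagonal.mem_antidiagonal.1 jk.2))).toLinearMap
  have hG : ∀ A B, G A B = ∑ jk : Finset.HasAntidiagonal.antidiagonal m,
      (altWedge (tensorConj Q jk.1.1 A) (tensorConj Q jk.1.2 B)).domDomCongr
        (finCongr (Finset.HasAntidiagonal.mem_antidiagonal.1 jk.2)) := fun A B => by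
    simp only [G, LinearMap.sum_apply]
    rfl
  rw [← hG]
  refine LinearMap.congr_fun₂ (f := F) (hom_ext_wedgeList fun j b => hom_ext_wedgeList
    fun k c => ?_) A B
  rw [hG]
  change tensorConj Q m (wedge Q (wedgeList Q (List.ofFn b)) (wedgeList Q (List.ofFn c))) = _
  rw [wedge_wedgeList, ← List.ofFn_fin_append]
  -- By bilinearity the factors are wedges of `j` and of `k` vectors, which have a conjugate in one
  -- degree only. At most one term of the antidiagonal survives, and none if `j + k ≠ m`, when the
  -- left side vanishes too.
  have hz : ∀ jk : Finset.HasAntidiagonal.antidiagonal m, jk.1 ≠ (j, k) →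
      (altWedge (tensorConj Q jk.1.1 (wedgeList Q (List.ofFn b)))
        (tensorConj Q jk.1.2 (wedgeList Q (List.ofFn c)))).domDomCongr
        (finCongr (Finset.HasAntidiagonal.mem_antidiagonal.1 jk.2)) = 0 := by
    intro jk hjk
    have : altWedge (tensorConj Q jk.1.1 (wedgeList Q (List.ofFn b)))
        (tensorConj Q jk.1.2 (wedgeList Q (List.ofFn c))) = 0 := by
      rw [← altWedgeHom_apply]
      by_cases h1 : j = jk.1.1
      · have h2 : k ≠ jk.1.2 := fun h2 => hjk (Prod.ext h1.symm h2.symm)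
        rw [tensorConj_eq_zero h2 (wedgeList_ofFn_mem c), map_zero]
      · rw [tensorConj_eq_zero h1 (wedgeList_ofFn_mem b), map_zero, LinearMap.zero_apply]
    rw [this]; rfl
  by_cases hm : j + k = m
  · subst hm
    rw [Finset.sum_eq_single_of_mem ⟨(j, k), Finset.HasAntidiagonal.mem_antidiagonal.2 rfl⟩
      (Finset.mem_univ _) fun jk _ hjk => hz jk fun h => hjk (Subtype.ext h)]
    rw [altWedge_tensorConj]
    rfl
  · rw [tensorConj_eq_zero hm (wedgeList_ofFn_mem _), Finset.sum_eq_zero fun jk _ => hz jk ?_]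
    intro h
    have := Finset.HasAntidiagonal.mem_antidiagonal.1 jk.2
    rw [h] at this
    exact hm this

end GeomCalc

end

noncomputable section

namespace GeomAlg

open CliffordAlgebra

/-! ### Wedges of a basis and of its reciprocal basis are dual. -/

section DualBases

variable {V : Type*} [AddCommGroup V] [Module ℝ V]

/-- The members of a family with index in `J`, in increasing order. -/
def sortedTuple {n : ℕ} (b : Fin n → V) (J : Finset (Fin n)) : Fin J.card → V :=
  b ∘ J.orderEmbOfFin rfl

theorem ofFn_sortedTuple {n : ℕ} (b : Fin n → V) (J : Finset (Fin n)) :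
    List.ofFn (sortedTuple b J) = (J.sort (· ≤ ·)).map b := by
  apply List.ext_getElem
  · simp
  · intro i h1 h2
    simp [sortedTuple, Finset.orderEmbOfFin_apply]

theorem alternating_sum_apply {ι : Type*} {k : ℕ} (s : Finset ι) (f : ι → V [⋀^Fin k]→ₗ[ℝ] ℝ)
    (a : Fin k → V) : (∑ i ∈ s, f i) a = ∑ i ∈ s, f i a :=
  map_sum ({ toFun := fun f => f a, map_add' := fun _ _ => rfl, map_smul' := fun _ _ => rfl } :
    (V [⋀^Fin k]→ₗ[ℝ] ℝ) →ₗ[ℝ] ℝ) f s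

/-- Alternating maps are equal if they agree on increasing tuples of basis vectors. -/
theorem alternating_ext_sortedTuple {n k : ℕ} (b : Module.Basis (Fin n) ℝ V)
    {f g : V [⋀^Fin k]→ₗ[ℝ] ℝ}
    (h : ∀ (J : Finset (Fin n)) (hJ : J.card = k),
      f (b ∘ J.orderEmbOfFin hJ) = g (b ∘ J.orderEmbOfFin hJ)) : f = g := by
  apply exteriorPower.alternatingMapLinearEquiv.injective
  refine (b.exteriorPower k).ext fun s => ?_
  rw [exteriorPower.basis_apply, exteriorPower.ιMulti_family,
    exteriorPower.alternatingMapLinearEquiv_apply_ιMulti,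
    exteriorPower.alternatingMapLinearEquiv_apply_ιMulti]
  exact h s.1 s.2

variable [FiniteDimensional ℝ V] {Q : QuadraticForm ℝ V}

theorem basis_exteriorAlgebra_eq {n : ℕ} (b : Module.Basis (Fin n) ℝ V) (J : Finset (Fin n)) :
    b.ExteriorAlgebra J = equivExterior Q (wedgeList Q (List.ofFn (sortedTuple b J))) := by
  rw [ExteriorAlgebra.basis_apply_ofCard b rfl, equivExterior_wedgeList, List.map_ofFn]
  rfl

theorem hom_ext_basis {n : ℕ} (b : Module.Basis (Fin n) ℝ V) {W : Type*} [AddCommGroup W]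
    [Module ℝ W] {f g : CliffordAlgebra Q →ₗ[ℝ] W}
    (h : ∀ J, f (wedgeList Q (List.ofFn (sortedTuple b J))) =
      g (wedgeList Q (List.ofFn (sortedTuple b J)))) : f = g := by
  refine (b.ExteriorAlgebra.map (equivExterior Q).symm).ext fun J => ?_
  rw [Module.Basis.map_apply, basis_exteriorAlgebra_eq (Q := Q), LinearEquiv.symm_apply_apply]
  exact h J

theorem tensorConj_sortedTuple_self {n : ℕ} {b b' : Fin n → V}
    (hb : ∀ i j, QuadraticMap.associated (R := ℝ) (M := V) Q (b i) (b' j) = if i = j then 1 else 0)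
    (J : Finset (Fin n)) :
    tensorConj Q J.card (wedgeList Q (List.ofFn (sortedTuple b J))) (sortedTuple b' J) = 1 := by
  rw [tensorConj_wedgeList, ← Matrix.det_one (n := Fin J.card)]
  congr 1
  ext i j
  simp [sortedTuple, hb, Matrix.one_apply]

theorem tensorConj_sortedTuple_of_ne {n : ℕ} {b b' : Fin n → V}
    (hb : ∀ i j, QuadraticMap.associated (R := ℝ) (M := V) Q (b i) (b' j) = if i = j then 1 else 0)
    {J K : Finset (Fin n)} (h : J ≠ K) :
    tensorConj Q K.card (wedgeList Q (List.ofFn (sortedTuple b J))) (sortedTuple b' K) = 0 := by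
  by_cases hc : J.card = K.card
  -- Distinct index sets of equal size: an index of `J` outside `K` gives a zero row in the matrix
  -- of dot products.
  · obtain ⟨i, hi, hiK⟩ : ∃ i ∈ J, i ∉ K := by
      by_contra! hcon
      exact h (Finset.eq_of_subset_of_card_le hcon hc.ge)
    have hi' : i ∈ Set.range (J.orderEmbOfFin hc) := by
      rw [Finset.range_orderEmbOfFin]; exact hi
    obtain ⟨m, rfl⟩ := hi'
    have h1 : List.ofFn (sortedTuple b J) = List.ofFn (b ∘ J.orderEmbOfFin hc) := by
      apply List.ext_getElem
      · simp [hc]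
      · intro i h1 h2
        simp [sortedTuple, Finset.orderEmbOfFin_apply]
    rw [h1, tensorConj_wedgeList]
    refine Matrix.det_eq_zero_of_row_eq_zero m fun j => ?_
    simp only [Matrix.of_apply, Function.comp_apply, sortedTuple, hb, ite_eq_right_iff]
    intro h2
    rw [h2] at hiK
    exact absurd (Finset.orderEmbOfFin_mem K rfl j) hiK
  · rw [tensorConj_eq_zero hc (wedgeList_ofFn_mem _), AlternatingMap.zero_apply]

/-- The expansion of a multivector in the wedge products of a basis: the coefficients are the
components of its tensor conjugate in the reciprocal basis. -/
theorem sum_tensorConj_smul_wedgeList {n : ℕ} (b : Module.Basis (Fin n) ℝ V) {b' : Fin n → V}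
    (hb : ∀ i j, QuadraticMap.associated (R := ℝ) (M := V) Q (b i) (b' j) = if i = j then 1 else 0)
    (A : CliffordAlgebra Q) :
    ∑ J : Finset (Fin n), tensorConj Q J.card A (sortedTuple b' J) •
      wedgeList Q (List.ofFn (sortedTuple b J)) = A := by
  let F : CliffordAlgebra Q →ₗ[ℝ] CliffordAlgebra Q := ∑ J : Finset (Fin n),
    LinearMap.smulRight
      { toFun := fun A => tensorConj Q J.card A (sortedTuple b' J)
        map_add' := fun A B => by rw [tensorConj_add]; rfl
        map_smul' := fun r A => by rw [tensorConj_smul]; rfl }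
      (wedgeList Q (List.ofFn (sortedTuple b J)))
  have hF : ∀ A, F A = ∑ J : Finset (Fin n), tensorConj Q J.card A (sortedTuple b' J) •
      wedgeList Q (List.ofFn (sortedTuple b J)) := fun A => by
    simp only [F, LinearMap.sum_apply]; rfl
  rw [← hF]
  refine LinearMap.congr_fun (g := LinearMap.id) (hom_ext_basis b fun J => ?_) A
  rw [hF, Finset.sum_eq_single_of_mem J (Finset.mem_univ _), tensorConj_sortedTuple_self hb,
    one_smul]
  · rfl
  · intro K _ hK
    rw [tensorConj_sortedTuple_of_ne hb hK.symm, zero_smul]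

/-- The multivector with given tensor conjugate. -/
theorem tensorConj_sum_smul_wedgeList {n : ℕ} {b : Fin n → V} (b' : Module.Basis (Fin n) ℝ V)
    (hb : ∀ i j, QuadraticMap.associated (R := ℝ) (M := V) Q (b i) (b' j) = if i = j then 1 else 0)
    (w : ∀ k, V [⋀^Fin k]→ₗ[ℝ] ℝ) (k : ℕ) :
    tensorConj Q k (∑ J : Finset (Fin n), w J.card (sortedTuple b' J) •
      wedgeList Q (List.ofFn (sortedTuple b J))) = w k := by
  refine alternating_ext_sortedTuple b' fun J hJ => ?_
  subst hJ
  change tensorConj Q J.card _ (sortedTuple b' J) = _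
  rw [tensorConj_sum, alternating_sum_apply, Finset.sum_eq_single_of_mem J (Finset.mem_univ _),
    tensorConj_smul, AlternatingMap.smul_apply, tensorConj_sortedTuple_self hb, smul_eq_mul,
    mul_one]
  · rfl
  · intro K _ hK
    rw [tensorConj_smul, AlternatingMap.smul_apply, tensorConj_sortedTuple_of_ne hb hK, smul_zero]

end DualBases

/-! ### The order of the factors -/

section Reverse

variable {V : Type*} [AddCommGroup V] [Module ℝ V]

theorem prod_mul_ι (a : V) (l : List V) :
    (l.map (ExteriorAlgebra.ι ℝ)).prod * ExteriorAlgebra.ι ℝ a =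
      (-1 : ℝ) ^ l.length • (ExteriorAlgebra.ι ℝ a * (l.map (ExteriorAlgebra.ι ℝ)).prod) := by
  induction l with
  | nil => simp
  | cons b l ih =>
    have h : ExteriorAlgebra.ι ℝ b * ExteriorAlgebra.ι ℝ a =
        -(ExteriorAlgebra.ι ℝ a * ExteriorAlgebra.ι ℝ b) :=
      eq_neg_of_add_eq_zero_left (ExteriorAlgebra.ι_add_mul_swap b a)
    rw [List.map_cons, List.prod_cons, mul_assoc, ih, mul_smul_comm, ← mul_assoc, h,
      List.length_cons, pow_succ, mul_neg_one, neg_smul, ← mul_assoc, neg_mul, smul_neg]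

/-- Moving the first factor past the `l.length` others costs that many signs, and these add up to a
triangular number. -/
theorem prod_reverse (l : List V) :
    (l.map (ExteriorAlgebra.ι ℝ)).prod = (-1 : ℝ) ^ (l.length * (l.length - 1) / 2) •
      (l.reverse.map (ExteriorAlgebra.ι ℝ)).prod := by
  induction l with
  | nil => simp
  | cons a l ih =>
    rw [List.reverse_cons, List.map_append, List.prod_append, List.map_singleton,
      List.prod_singleton, prod_mul_ι, List.map_cons, List.prod_cons, ih, List.length_reverse,
      smul_smul, ← pow_add, mul_smul_comm]
    congr 1
    have h1 : (a :: l).length * ((a :: l).length - 1) / 2 =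
        l.length + l.length * (l.length - 1) / 2 := by
      rw [List.length_cons, Nat.triangle_succ, add_comm]
    rw [h1, add_right_comm, pow_add, ← two_mul, pow_mul]
    simp

variable [FiniteDimensional ℝ V] {Q : QuadraticForm ℝ V}

theorem dot_wedgeList (k : ℕ) (A : CliffordAlgebra Q) (a : Fin k → V) :
    dot Q (grade Q k A) (wedgeList Q (List.ofFn a)) =
      algebraMap ℝ _ ((-1) ^ (k * (k - 1) / 2) * tensorConj Q k A a) := by
  have h : wedgeList Q (List.ofFn a) = (-1 : ℝ) ^ (k * (k - 1) / 2) •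
      wedgeList Q (List.ofFn a).reverse := by
    apply (equivExterior Q).injective
    rw [map_smul, equivExterior_wedgeList, equivExterior_wedgeList, prod_reverse,
      List.length_ofFn]
  rw [dot_eq (grade_mem k A) (wedgeList_ofFn_mem a), h, mul_smul_comm, map_smul,
    tensorConj_apply, smul_eq_mul]

end Reverse

/-! ### Isometries -/

section Isometry

variable {V W : Type*} [AddCommGroup V] [Module ℝ V] [AddCommGroup W] [Module ℝ W]
  {Q : QuadraticForm ℝ V} {R : QuadraticForm ℝ W}

theorem associated_isometry (f : Q →qᵢ R) (a b : V) :
    QuadraticMap.associated (R := ℝ) (M := W) R (f a) (f b) =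
      QuadraticMap.associated (R := ℝ) (M := V) Q a b := by
  simp only [QuadraticMap.associated_apply, ← map_add, f.map_app]

theorem contractLeft_map (f : V →ₗ[ℝ] W) (d : Module.Dual ℝ W) (x : ExteriorAlgebra ℝ V) :
    contractLeft (Q := (0 : QuadraticForm ℝ W)) d (ExteriorAlgebra.map f x) =
      ExteriorAlgebra.map f (contractLeft (Q := (0 : QuadraticForm ℝ V)) (d ∘ₗ f) x) := by
  induction x using CliffordAlgebra.left_induction with
  | algebraMap r =>
    have h1 : ExteriorAlgebra.map f (algebraMap ℝ _ r) = algebraMap ℝ _ r := AlgHom.commutes _ _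
    have h2 := contractLeft_algebraMap (Q := (0 : QuadraticForm ℝ V)) (d ∘ₗ f) r
    have h3 := contractLeft_algebraMap (Q := (0 : QuadraticForm ℝ W)) d r
    refine (congrArg _ h1).trans (h3.trans ?_)
    refine Eq.trans ?_ (congrArg _ h2.symm)
    rw [map_zero]
  | add x y hx hy => simp only [map_add, hx, hy]
  | ι_mul x v hx =>
    have h1 : ExteriorAlgebra.map f (ι 0 v * x) =
        ι 0 (f v) * ExteriorAlgebra.map f x := by
      rw [map_mul]; congr 1; exact ExteriorAlgebra.map_apply_ι f v
    have h2 := contractLeft_ι_mul (Q := (0 : QuadraticForm ℝ V)) (d ∘ₗ f) v x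
    have h3 := contractLeft_ι_mul (Q := (0 : QuadraticForm ℝ W)) d (f v) (ExteriorAlgebra.map f x)
    refine (congrArg _ h1).trans (h3.trans ?_)
    refine Eq.trans ?_ (congrArg _ h2.symm)
    rw [map_sub, map_smul, hx, map_mul]
    congr 2
    exact (ExteriorAlgebra.map_apply_ι f v).symm

/-- `equivExterior` differs from the identity on products by contractions with the bilinear form,
which an isometry preserves. Hence an isometry respects everything defined through `equivExterior`:
grades, scalar parts and wedges. -/
theorem equivExterior_map (f : Q →qᵢ R) (A : CliffordAlgebra Q) :
    equivExterior R (CliffordAlgebra.map f A) =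
      ExteriorAlgebra.map f.toLinearMap (equivExterior Q A) := by
  induction A using CliffordAlgebra.left_induction with
  | algebraMap r =>
    rw [AlgHom.commutes, equivExterior_algebraMap, equivExterior_algebraMap, AlgHom.commutes]
  | add x y hx hy => simp only [map_add, hx, hy]
  | ι_mul x v hx =>
    rw [map_mul, CliffordAlgebra.map_apply_ι, equivExterior_ι_mul, hx, equivExterior_ι_mul,
      map_sub, map_mul, ExteriorAlgebra.map_apply_ι, contractLeft_map]
    congr 4
    ext b
    have := associated_isometry f v b
    simp only [map_neg, LinearMap.comp_apply, LinearMap.neg_apply]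
    rw [← this]
    rfl

theorem map_mem_pureGrade (f : Q →qᵢ R) {k : ℕ} {A : CliffordAlgebra Q} (hA : A ∈ pureGrade Q k) :
    CliffordAlgebra.map f A ∈ pureGrade R k := by
  refine pureGrade_induction (fun k A => CliffordAlgebra.map f A ∈ pureGrade R k) ?_ ?_ ?_ k A hA
  · intro r; rw [AlgHom.commutes]; exact mem_pureGrade_zero.2 ⟨r, rfl⟩
  · intro k a A _ hA
    have : CliffordAlgebra.map f (vecWedge Q a A) =
        vecWedge R (f a) (CliffordAlgebra.map f A) := by
      apply (equivExterior R).injective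
      rw [equivExterior_map, equivExterior_vecWedge, equivExterior_vecWedge, map_mul,
        equivExterior_map, ExteriorAlgebra.map_apply_ι]
      rfl
    rw [this]
    exact vecWedge_mem _ hA
  · intro k A B hA hB; rw [map_add]; exact Submodule.add_mem _ hA hB

theorem map_scalarPart (f : Q →qᵢ R) (A : CliffordAlgebra Q) :
    scalarPart R (CliffordAlgebra.map f A) = scalarPart Q A := by
  change ExteriorAlgebra.algebraMapInv (equivExterior R _) =
    ExteriorAlgebra.algebraMapInv (equivExterior Q A)
  rw [equivExterior_map, ← AlgHom.comp_apply]
  congr 1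
  ext v
  simp [ExteriorAlgebra.algebraMapInv]

variable [FiniteDimensional ℝ V] [FiniteDimensional ℝ W]

theorem map_grade (f : Q →qᵢ R) (k : ℕ) (A : CliffordAlgebra Q) :
    CliffordAlgebra.map f (grade Q k A) = grade R k (CliffordAlgebra.map f A) := by
  conv_rhs => rw [← sum_grade A]
  rw [map_sum, map_sum]
  by_cases hk : k < Module.finrank ℝ V + 1
  · rw [Finset.sum_eq_single_of_mem k (Finset.mem_range.2 hk),
      grade_eq_self (map_mem_pureGrade f (grade_mem k A))]
    exact fun j _ hj => grade_eq_zero (map_mem_pureGrade f (grade_mem j A)) hj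
  · rw [grade_eq_zero_of_finrank_lt (by omega), map_zero, Finset.sum_eq_zero]
    intro j hj
    have := Finset.mem_range.1 hj
    exact grade_eq_zero (map_mem_pureGrade f (grade_mem j A)) (by omega)

theorem map_wedge (f : Q →qᵢ R) (A B : CliffordAlgebra Q) :
    CliffordAlgebra.map f (wedge Q A B) =
      wedge R (CliffordAlgebra.map f A) (CliffordAlgebra.map f B) := by
  apply (equivExterior R).injective
  rw [equivExterior_map, equivExterior_wedge, equivExterior_wedge, map_mul, equivExterior_map,
    equivExterior_map]

end Isometry

end GeomAlg

end

noncomputable section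

namespace GeomCalc

open Filter

/-! ### Smooth isometries to a fixed bilinear form, with symmetric derivative. -/

section Isometries

variable {E : Type*} [NormedAddCommGroup E] [NormedSpace ℝ E] [FiniteDimensional ℝ E]

/-- The square root near the identity in a Banach algebra. -/
theorem exists_local_sqrt (A : Type*) [NormedRing A] [NormedAlgebra ℝ A] [CompleteSpace A] :
    ∃ Z : A → A, ContDiffAt ℝ ∞ Z 1 ∧ Z 1 = 1 ∧
      (∀ᶠ Y in 𝓝 1, Z Y * Z Y = Y) ∧ ∀ᶠ X in 𝓝 1, Z (X * X) = X := by
  -- Squaring has derivative twice the identity at `1`, so the inverse function theorem applies. Its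
  -- left inverse clause is the local uniqueness of the root.
  have hd : HasFDerivAt (fun X : A => X * X)
      ((ContinuousLinearEquiv.smulLeft (Units.mk0 (2 : ℝ) two_ne_zero) : A ≃L[ℝ] A) :
        A →L[ℝ] A) 1 := by
    have := (hasFDerivAt_id (𝕜 := ℝ) (1 : A)).mul' (hasFDerivAt_id (1 : A))
    refine this.congr_fderiv ?_
    ext X
    simp [two_smul]
  have hc : ContDiffAt ℝ ∞ (fun X : A => X * X) 1 := contDiffAt_id.mul contDiffAt_id
  have hs := hc.hasStrictFDerivAt' hd (by simp)
  refine ⟨hc.localInverse hd (by simp), ?_, ?_, ?_, ?_⟩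
  · have := hc.to_localInverse hd (by simp)
    rwa [mul_one] at this
  · have := hc.localInverse_apply_image hd (by simp)
    rwa [mul_one] at this
  · have := hs.eventually_right_inverse
    rwa [mul_one] at this
  · exact hs.eventually_left_inverse

variable (B : E →L[ℝ] E →L[ℝ] ℝ)

/-- The Cayley transform of an operator that is antisymmetric for a bilinear form is an isometry. -/
theorem cayley_isometry {X : E →L[ℝ] E} (hX : ∀ v w, B (X v) w = -B v (X w))
    (hu : IsUnit (1 - X)) (v w : E) :
    B ((Ring.inverse (1 - X) * (1 + X)) v) ((Ring.inverse (1 - X) * (1 + X)) w) = B v w := by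
  have hcomm : Ring.inverse (1 - X) * (1 + X) = (1 + X) * Ring.inverse (1 - X) := by
    have h : (1 + X) * (1 - X) = (1 - X) * (1 + X) := by noncomm_ring
    calc Ring.inverse (1 - X) * (1 + X)
        = Ring.inverse (1 - X) * (((1 + X) * (1 - X)) * Ring.inverse (1 - X)) := by
          rw [mul_assoc, Ring.mul_inverse_cancel _ hu, mul_one]
      _ = (Ring.inverse (1 - X) * (1 - X)) * ((1 + X) * Ring.inverse (1 - X)) := by
          rw [h]; simp only [mul_assoc]
      _ = _ := by rw [Ring.inverse_mul_cancel _ hu, one_mul]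
  have h1 : ∀ v, (1 - X) (Ring.inverse (1 - X) v) = v := fun v => by
    rw [← mul_apply_eq_comp, Ring.mul_inverse_cancel _ hu]; rfl
  rw [hcomm]
  -- With `v = (1 - X) v'` and `w = (1 - X) w'` the claim compares `(1 + X)` and `(1 - X)` on both
  -- arguments; the cross terms cancel by antisymmetry.
  conv_rhs => rw [← h1 v, ← h1 w]
  simp only [mul_apply_eq_comp, add_apply,
    sub_apply, one_apply_eq_self, map_add, map_sub, hX]
  ring

-- The Cayley transform of the linear function `κ (y - y₀)`. Its argument vanishes at `y₀`, where
-- each of the two factors contributes `κ` to the derivative, whence `2 • κ`.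
set_option synthInstance.maxHeartbeats 400000 in
theorem exists_cayley {A : Type*} [NormedRing A] [NormedAlgebra ℝ A] [CompleteSpace A]
    (κ : E →L[ℝ] A) (y₀ : E) :
    ∃ R : E → A, ContDiffAt ℝ ∞ R y₀ ∧ R y₀ = 1 ∧ HasFDerivAt R (2 • κ) y₀ ∧
      ∀ᶠ y in 𝓝 y₀, IsUnit (1 - κ (y - y₀)) ∧
        R y = Ring.inverse (1 - κ (y - y₀)) * (1 + κ (y - y₀)) := by
  have hκd : HasFDerivAt (fun y => κ (y - y₀)) κ y₀ :=
    κ.hasFDerivAt.comp y₀ ((hasFDerivAt_id y₀).sub_const y₀)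
  have hκs : ContDiffAt ℝ ∞ (fun y => κ (y - y₀)) y₀ :=
    κ.contDiff.contDiffAt.comp y₀ (contDiffAt_id.sub contDiffAt_const)
  have hκ0 : 1 - κ (y₀ - y₀) = ((1 : Aˣ) : A) := by simp
  have hinvs : ContDiffAt ℝ ∞ (fun y => Ring.inverse (1 - κ (y - y₀))) y₀ := by
    have h1 := contDiffAt_ringInverse (n := ∞) ℝ (1 : Aˣ)
    rw [← hκ0] at h1
    exact h1.comp y₀ (contDiffAt_const.sub hκs)
  have hinvd : HasFDerivAt (fun y => Ring.inverse (1 - κ (y - y₀))) κ y₀ := by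
    have h1 := hasFDerivAt_ringInverse (𝕜 := ℝ) (1 : Aˣ)
    rw [← hκ0] at h1
    have := h1.comp y₀ (hκd.const_sub 1)
    refine this.congr_fderiv ?_
    ext v
    simp only [ContinuousLinearMap.comp_apply, neg_apply, ContinuousLinearMap.mulLeftRight_apply,
      inv_one, Units.val_one, one_mul, mul_one, neg_neg]
  refine ⟨fun y => Ring.inverse (1 - κ (y - y₀)) * (1 + κ (y - y₀)),
    hinvs.mul (contDiffAt_const.add hκs), by simp, ?_, ?_⟩
  · have := hinvd.mul' (hκd.const_add 1)
    refine this.congr_fderiv ?_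
    ext v
    simp [two_smul]
  · have hc : ContinuousAt (fun y => 1 - κ (y - y₀)) y₀ :=
      (contDiffAt_const.sub hκs).continuousAt
    refine (hc.eventually (Units.isOpen.mem_nhds ?_)).mono fun y hy => ⟨hy, rfl⟩
    change IsUnit (1 - κ (y₀ - y₀))
    rw [hκ0]
    exact Units.isUnit _

/-- A trilinear form is represented by a bilinear operator. -/
theorem exists_trilinear_rep (S : (E →L[ℝ] ℝ) →L[ℝ] E) (hS : ∀ f, B (S f) = f)
    (t : E → E → E → ℝ) (h1 : ∀ v v' w u, t (v + v') w u = t v w u + t v' w u)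
    (h2 : ∀ (c : ℝ) v w u, t (c • v) w u = c * t v w u)
    (h3 : ∀ v w w' u, t v (w + w') u = t v w u + t v w' u)
    (h4 : ∀ (c : ℝ) v w u, t v (c • w) u = c * t v w u)
    (h5 : ∀ v w u u', t v w (u + u') = t v w u + t v w u')
    (h6 : ∀ (c : ℝ) v w u, t v w (c • u) = c * t v w u) :
    ∃ κ : E →L[ℝ] E →L[ℝ] E, ∀ v w u, B (κ v w) u = t v w u := by
  let K : E → E → E →L[ℝ] ℝ := fun v w =>
    LinearMap.toContinuousLinearMap { toFun := t v w, map_add' := h5 v w, map_smul' := fun c u => h6 c v w u }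
  let X : E →ₗ[ℝ] E →ₗ[ℝ] E := LinearMap.mk₂ ℝ (fun v w => S (K v w))
    (fun v v' w => by rw [← map_add]; congr 1; ext u; exact h1 v v' w u)
    (fun c v w => by rw [← map_smul]; congr 1; ext u; exact h2 c v w u)
    (fun v w w' => by rw [← map_add]; congr 1; ext u; exact h3 v w w' u)
    (fun c v w => by rw [← map_smul]; congr 1; ext u; exact h4 c v w u)
  refine ⟨((LinearMap.toContinuousLinearMap : (E →ₗ[ℝ] E) ≃ₗ[ℝ] E →L[ℝ] E).toLinearMap ∘ₗ
      X).toContinuousLinearMap, fun v w u => ?_⟩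
  change B (S (K v w)) u = _
  rw [hS]; rfl

set_option synthInstance.maxHeartbeats 400000 in
set_option maxHeartbeats 1600000 in
/-- Isometries from a smooth family of nondegenerate symmetric bilinear forms to one of them, with
symmetric first derivative. -/
theorem exists_smooth_isometry {G : E → E →L[ℝ] E →L[ℝ] ℝ} {y₀ : E} (hG : ContDiffAt ℝ ∞ G y₀)
    (hsymm : ∀ y v w, G y v w = G y w v) (hnd : ∀ v, (∀ w, G y₀ v w = 0) → v = 0) :
    ∃ U : E → E →L[ℝ] E, ContDiffAt ℝ ∞ U y₀ ∧ U y₀ = 1 ∧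
      (∀ᶠ y in 𝓝 y₀, ∀ v w, G y₀ (U y v) (U y w) = G y v w) ∧
      ∀ v w, fderiv ℝ U y₀ v w = fderiv ℝ U y₀ w v := by
  set B := G y₀ with hB
  have hfin : Module.finrank ℝ E = Module.finrank ℝ (E →L[ℝ] ℝ) := by
    rw [← (LinearMap.toContinuousLinearMap : (E →ₗ[ℝ] ℝ) ≃ₗ[ℝ] E →L[ℝ] ℝ).finrank_eq]
    exact (Subspace.dual_finrank_eq (K := ℝ) (V := E)).symm
  have hinj : Function.Injective (B : E →ₗ[ℝ] (E →L[ℝ] ℝ)) := by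
    rw [← LinearMap.ker_eq_bot, LinearMap.ker_eq_bot']
    intro v hv
    exact hnd v fun w => by
      have := DFunLike.congr_fun hv w
      exact this
  let S : (E →L[ℝ] ℝ) →L[ℝ] E :=
    ((LinearMap.linearEquivOfInjective _ hinj hfin).symm : (E →L[ℝ] ℝ) →ₗ[ℝ] E).toContinuousLinearMap
  have hS : ∀ f, B (S f) = f := fun f =>
    (LinearMap.linearEquivOfInjective _ hinj hfin).apply_symm_apply f
  have hext : ∀ v w, (∀ u, B v u = B w u) → v = w := fun v w h =>
    hinj (ContinuousLinearMap.ext h)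
  -- `P y` is the operator with `B (P y v) w = G y v w`. A square root of it that is self-adjoint
  -- for `B` carries `G y` to `B`.
  let P : E → E →L[ℝ] E := fun y => S ∘L G y
  have hP : ContDiffAt ℝ ∞ P y₀ :=
    contDiffAt_const.clm_comp hG
  have hPB : ∀ y v w, B (P y v) w = G y v w := fun y v w => by
    change B (S (G y v)) w = _; rw [hS]
  have hP0 : P y₀ = 1 := by
    ext v; exact hext _ _ fun u => by rw [hPB]; rfl
  let adj : (E →L[ℝ] E) → (E →L[ℝ] E) := fun X => S ∘L (B ∘L X).flip
  have hadj : ∀ X v w, B (adj X v) w = B v (X w) := fun X v w => by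
    change B (S ((B ∘L X).flip v)) w = _
    rw [hS]
    exact hsymm y₀ _ _
  have hadj_cont : Continuous adj := by
    have h1 : Continuous fun X : E →L[ℝ] E => (B ∘L X).flip :=
      (ContinuousLinearMap.flipₗᵢ ℝ E E ℝ).continuous.comp
        (ContinuousLinearMap.compL ℝ E E (E →L[ℝ] ℝ) B).continuous
    exact (ContinuousLinearMap.compL ℝ E (E →L[ℝ] ℝ) E S).continuous.comp h1
  have hadj1 : adj 1 = 1 := by
    ext v; exact hext _ _ fun u => by rw [hadj]; rfl
  obtain ⟨Z, hZs, hZ1, hZr, hZl⟩ := exists_local_sqrt (E →L[ℝ] E)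
  let Z1 : E → E →L[ℝ] E := fun y => Z (P y)
  have hPt : Tendsto P (𝓝 y₀) (𝓝 1) := by rw [← hP0]; exact hP.continuousAt
  have hZ1s : ContDiffAt ℝ ∞ Z1 y₀ := by
    rw [← hP0] at hZs; exact hZs.comp y₀ hP
  have hZ10 : Z1 y₀ = 1 := by change Z (P y₀) = 1; rw [hP0, hZ1]
  have hZ1t : Tendsto Z1 (𝓝 y₀) (𝓝 1) := by rw [← hZ10]; exact hZ1s.continuousAt
  -- The adjoint of the root is also a root of `P y`, because `P y` is self-adjoint, and it is also
  -- near `1`. Local uniqueness of the root makes the two equal.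
  have hself : ∀ᶠ y in 𝓝 y₀, ∀ v w, B (Z1 y v) w = B v (Z1 y w) := by
    have ht : Tendsto (fun y => adj (Z1 y)) (𝓝 y₀) (𝓝 1) := by
      have := (hadj_cont.tendsto 1).comp hZ1t
      rwa [hadj1] at this
    filter_upwards [ht.eventually hZl, hPt.eventually hZr] with y h1 h2
    have h3 : adj (Z1 y) * adj (Z1 y) = P y := by
      ext v
      refine hext _ _ fun u => ?_
      rw [mul_apply_eq_comp, hadj, hadj, ← mul_apply_eq_comp, h2,
        hsymm y₀, hPB, hPB, hsymm]
    rw [h3] at h1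
    intro v w
    rw [show Z1 y = adj (Z1 y) from h1, hadj, ← show Z1 y = adj (Z1 y) from h1]
  have hiso : ∀ᶠ y in 𝓝 y₀, ∀ v w, B (Z1 y v) (Z1 y w) = G y v w := by
    filter_upwards [hself, hPt.eventually hZr] with y h1 h2 v w
    rw [← h1, ← mul_apply_eq_comp, h2, hPB]
  obtain ⟨H, hZ1d⟩ := hZ1s.differentiableAt (by simp)
  obtain ⟨DG, hGd⟩ := hG.differentiableAt (by simp)
  have happ : ∀ v, HasFDerivAt (fun y => Z1 y v) (H.flip v) y₀ := fun v =>
    ((ContinuousLinearMap.apply ℝ E v).hasFDerivAt.comp y₀ hZ1d)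
  have hGapp : ∀ v w, HasFDerivAt (fun y => G y v w) ((DG.flip v).flip w) y₀ := fun v w => by
    have h1 := (hGd.clm_apply (hasFDerivAt_const v y₀)).clm_apply (hasFDerivAt_const w y₀)
    refine h1.congr_fderiv ?_
    ext u
    simp
  have hDGs : ∀ v w u, DG v w u = DG v u w := by
    intro v w u
    have h1 := (hGapp w u).unique ((hGapp u w).congr_of_eventuallyEq
      (Eventually.of_forall fun y => hsymm y w u))
    exact DFunLike.congr_fun h1 v
  -- Differentiating self-adjointness makes the two terms in the derivative of the isometry equation
  -- equal.
  have hHB : ∀ v w u, B (H v w) u = 2⁻¹ * DG v w u := by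
    intro v w u
    have h1 : B (H v w) u = B w (H v u) := by
      have hl : HasFDerivAt (fun y => B (Z1 y w) u) (B.flip u ∘L H.flip w) y₀ :=
        (B.flip u).hasFDerivAt.comp y₀ (happ w)
      have hr : HasFDerivAt (fun y => B w (Z1 y u)) (B w ∘L H.flip u) y₀ :=
        (B w).hasFDerivAt.comp y₀ (happ u)
      have := hl.unique (hr.congr_of_eventuallyEq (hself.mono fun y hy => hy w u))
      exact DFunLike.congr_fun this v
    have h2 : B w (H v u) + B (H v w) u = DG v w u := by
      have hl := B.hasFDerivAt_of_bilinear (happ w) (happ u)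
      have := hl.unique ((hGapp w u).congr_of_eventuallyEq (hiso.mono fun y hy => hy w u))
      have := DFunLike.congr_fun this v
      simpa [hZ10] using this
    linarith only [h1, h2]
  -- Multiplying by the Cayley transform adds `2 • κ` to the derivative `H`. The choice makes `B` of
  -- the sum equal to `2⁻¹ * (DG v w u + DG w v u - DG u v w)`, the Christoffel symbol of the first
  -- kind, which is symmetric in `v` and `w`. The form is antisymmetric in `w` and `u`, so the
  -- transform is an isometry.
  obtain ⟨κ, hκ⟩ := exists_trilinear_rep B S hS (fun v w u => 4⁻¹ * (DG w v u - DG u v w))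
    (fun v v' w u => by simp only [map_add, add_apply]; ring)
    (fun c v w u => by simp only [map_smul, smul_apply, smul_eq_mul]; ring)
    (fun v w w' u => by simp only [map_add, add_apply]; ring)
    (fun c v w u => by simp only [map_smul, smul_apply, smul_eq_mul]; ring)
    (fun v w u u' => by simp only [map_add, add_apply]; ring)
    (fun c v w u => by simp only [map_smul, smul_apply, smul_eq_mul]; ring)
  have hκa : ∀ v w u, B (κ v w) u = -B w (κ v u) := fun v w u => by
    rw [hsymm y₀ w, hκ, hκ]; ring
  obtain ⟨R, hRs, hR0, hRd, hRc⟩ := exists_cayley κ y₀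
  have hRiso : ∀ᶠ y in 𝓝 y₀, ∀ v w, B (R y v) (R y w) = B v w := by
    filter_upwards [hRc] with y hy v w
    rw [hy.2]
    exact cayley_isometry B (hκa _) hy.1 v w
  refine ⟨fun y => R y * Z1 y, hRs.mul hZ1s, by simp [hR0, hZ10], ?_, ?_⟩
  · filter_upwards [hRiso, hiso] with y h1 h2 v w
    rw [mul_apply_eq_comp, mul_apply_eq_comp, h1, h2]
  · intro v w
    have hd : ∀ v, fderiv ℝ (fun y => R y * Z1 y) y₀ v = H v + (2 : ℝ) • κ v := fun v => by
      have h1 : fderiv ℝ (fun y => R y * Z1 y) y₀ v = R y₀ * H v + (2 • κ) v * Z1 y₀ := by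
        rw [show fderiv ℝ (fun y => R y * Z1 y) y₀ = _ from (hRd.mul' hZ1d).fderiv]; rfl
      rw [h1, hR0, hZ10, one_mul, mul_one, two_smul, two_smul]; rfl
    rw [hd, hd]
    refine hext _ _ fun u => ?_
    rw [add_apply, add_apply, map_add, map_add, add_apply, add_apply, smul_apply, smul_apply,
      map_smul, map_smul, smul_apply, smul_apply, hκ, hκ, hHB, hHB, hDGs u v w, smul_eq_mul,
      smul_eq_mul]
    ring

end Isometries

end GeomCalc

end

noncomputable section

namespace GeomCalc

open Filter Module

/-! ### Calculus of maps into finite-dimensional spaces that carry no norm, such as geometric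
algebras. -/

section WeakCalculus

variable {E : Type*} [NormedAddCommGroup E] [NormedSpace ℝ E]
  {M : Type*} [TopologicalSpace M] [ChartedSpace E M]
  {W : Type*} [AddCommGroup W] [Module ℝ W]
  {W' : Type*} [AddCommGroup W'] [Module ℝ W'] {W'' : Type*} [AddCommGroup W''] [Module ℝ W'']

theorem contMDiffAt_mul {φ ψ : M → ℝ} {p : M} (hφ : ContMDiffAt 𝓘(ℝ, E) 𝓘(ℝ, ℝ) ∞ φ p)
    (hψ : ContMDiffAt 𝓘(ℝ, E) 𝓘(ℝ, ℝ) ∞ ψ p) :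
    ContMDiffAt 𝓘(ℝ, E) 𝓘(ℝ, ℝ) ∞ (fun x => φ x * ψ x) p :=
  hφ.smul hψ

theorem contMDiffAt_sum {ι : Type*} {s : Finset ι} {φ : ι → M → ℝ} {p : M}
    (hφ : ∀ i ∈ s, ContMDiffAt 𝓘(ℝ, E) 𝓘(ℝ, ℝ) ∞ (φ i) p) :
    ContMDiffAt 𝓘(ℝ, E) 𝓘(ℝ, ℝ) ∞ (fun x => ∑ i ∈ s, φ i x) p :=
  contMDiffAt_finsetSum hφ

theorem mvfderiv_congr {φ ψ : M → ℝ} {p : M} (h : φ =ᶠ[𝓝 p] ψ) :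
    mvfderiv 𝓘(ℝ, E) φ p = mvfderiv 𝓘(ℝ, E) ψ p := by
  ext a
  change (mfderiv 𝓘(ℝ, E) 𝓘(ℝ, ℝ) φ p a : ℝ) = (mfderiv 𝓘(ℝ, E) 𝓘(ℝ, ℝ) ψ p a : ℝ)
  rw [h.mfderiv_eq]
  rfl

theorem mvfderiv_add_apply {φ ψ : M → ℝ} {p : M} (hφ : ContMDiffAt 𝓘(ℝ, E) 𝓘(ℝ, ℝ) ∞ φ p)
    (hψ : ContMDiffAt 𝓘(ℝ, E) 𝓘(ℝ, ℝ) ∞ ψ p) (a : TangentSpace 𝓘(ℝ, E) p) :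
    mvfderiv 𝓘(ℝ, E) (fun x => φ x + ψ x) p a =
      mvfderiv 𝓘(ℝ, E) φ p a + mvfderiv 𝓘(ℝ, E) ψ p a :=
  DFunLike.congr_fun (mvfderiv_add (hφ.mdifferentiableAt (by simp))
    (hψ.mdifferentiableAt (by simp))) a

theorem mvfderiv_mul_apply {φ ψ : M → ℝ} {p : M} (hφ : ContMDiffAt 𝓘(ℝ, E) 𝓘(ℝ, ℝ) ∞ φ p)
    (hψ : ContMDiffAt 𝓘(ℝ, E) 𝓘(ℝ, ℝ) ∞ ψ p) (a : TangentSpace 𝓘(ℝ, E) p) :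
    mvfderiv 𝓘(ℝ, E) (fun x => φ x * ψ x) p a =
      φ p * mvfderiv 𝓘(ℝ, E) ψ p a + ψ p * mvfderiv 𝓘(ℝ, E) φ p a := by
  have := DFunLike.congr_fun (mvfderiv_mul (hφ.mdifferentiableAt (by simp))
    (hψ.mdifferentiableAt (by simp))) a
  exact this

theorem mvfderiv_const_apply (c : ℝ) {p : M} (a : TangentSpace 𝓘(ℝ, E) p) :
    mvfderiv 𝓘(ℝ, E) (fun _ : M => c) p a = 0 := by
  rw [mvfderiv_const]; rfl

theorem mvfderiv_sum_apply {ι : Type*} {s : Finset ι} {φ : ι → M → ℝ} {p : M}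
    (hφ : ∀ i ∈ s, ContMDiffAt 𝓘(ℝ, E) 𝓘(ℝ, ℝ) ∞ (φ i) p) (a : TangentSpace 𝓘(ℝ, E) p) :
    mvfderiv 𝓘(ℝ, E) (fun x => ∑ i ∈ s, φ i x) p a = ∑ i ∈ s, mvfderiv 𝓘(ℝ, E) (φ i) p a := by
  classical
  induction s using Finset.induction_on with
  | empty => simp only [Finset.sum_empty]; exact mvfderiv_const_apply 0 a
  | insert i s hi ih =>
    simp only [Finset.sum_insert hi]
    rw [mvfderiv_add_apply (hφ i (by simp)) (contMDiffAt_sum fun j hj => hφ j (by simp [hj])),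
      ih fun j hj => hφ j (by simp [hj])]

variable (E) in
/-- A map to a finite-dimensional space is smooth at a point if its composition with each linear
functional is. -/
def WeakSmoothAt (F : M → W) (p : M) : Prop :=
  ∀ ℓ : Dual ℝ W, ContMDiffAt 𝓘(ℝ, E) 𝓘(ℝ, ℝ) ∞ (fun x => ℓ (F x)) p

namespace WeakSmoothAt

variable {p : M} {F G : M → W}

theorem congr (hF : WeakSmoothAt E F p) (h : G =ᶠ[𝓝 p] F) : WeakSmoothAt E G p := fun ℓ =>
  (hF ℓ).congr_of_eventuallyEq (h.fun_comp ℓ)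

theorem const (w : W) : WeakSmoothAt E (fun _ : M => w) p := fun _ => contMDiffAt_const

theorem add (hF : WeakSmoothAt E F p) (hG : WeakSmoothAt E G p) :
    WeakSmoothAt E (fun x => F x + G x) p := fun ℓ => by
  simp only [map_add]; exact (hF ℓ).add (hG ℓ)

theorem sum {ι : Type*} {s : Finset ι} {F : ι → M → W} (hF : ∀ i ∈ s, WeakSmoothAt E (F i) p) :
    WeakSmoothAt E (fun x => ∑ i ∈ s, F i x) p := fun ℓ => by
  simp only [map_sum]; exact contMDiffAt_sum fun i hi => hF i hi ℓ

theorem smul {φ : M → ℝ} (hφ : ContMDiffAt 𝓘(ℝ, E) 𝓘(ℝ, ℝ) ∞ φ p) (hF : WeakSmoothAt E F p) :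
    WeakSmoothAt E (fun x => φ x • F x) p := fun ℓ => by
  simp only [map_smul, smul_eq_mul]; exact contMDiffAt_mul hφ (hF ℓ)

theorem map (L : W →ₗ[ℝ] W') (hF : WeakSmoothAt E F p) : WeakSmoothAt E (fun x => L (F x)) p :=
  fun ℓ => hF (ℓ ∘ₗ L)

/-- Expanding the first argument in a basis reduces this to products of a scalar function and a
linear image of `H`. -/
theorem bilin [FiniteDimensional ℝ W] (B : W →ₗ[ℝ] W' →ₗ[ℝ] W'') {H : M → W'}
    (hF : WeakSmoothAt E F p) (hH : WeakSmoothAt E H p) :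
    WeakSmoothAt E (fun x => B (F x) (H x)) p := by
  let b := finBasis ℝ W
  have := sum (E := E) (s := Finset.univ) fun i _ => smul (hF (b.coord i)) (hH.map (B (b i)))
  refine this.congr (Eventually.of_forall fun x => ?_)
  change B (F x) (H x) = ∑ i, b.repr (F x) i • B (b i) (H x)
  conv_lhs => rw [← b.sum_repr (F x)]
  simp only [map_sum, map_smul, LinearMap.sum_apply, LinearMap.smul_apply]

theorem of_apply [FiniteDimensional ℝ W] {F : M → W →ₗ[ℝ] W'}
    (hF : ∀ w, WeakSmoothAt E (fun x => F x w) p) : WeakSmoothAt E F p := by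
  let b := finBasis ℝ W
  have := sum (E := E) (s := Finset.univ) fun i _ =>
    (hF (b i)).map (LinearMap.smulRightₗ (R := ℝ) (M₂ := W) (M := W') (b.coord i))
  refine this.congr (Eventually.of_forall fun x => ?_)
  refine b.ext fun j => ?_
  simp only [LinearMap.sum_apply, LinearMap.smulRightₗ_apply, LinearMap.smulRight_apply, Basis.coord_apply, Basis.repr_self,
    Finsupp.single_apply, ite_smul, one_smul, zero_smul, Finset.sum_ite_eq, Finset.mem_univ,
    if_true]

theorem apply [FiniteDimensional ℝ W] [FiniteDimensional ℝ W'] {F : M → W →ₗ[ℝ] W'} {w : M → W}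
    (hF : WeakSmoothAt E F p) (hw : WeakSmoothAt E w p) : WeakSmoothAt E (fun x => F x (w x)) p :=
  hF.bilin LinearMap.id hw

theorem of_real {φ : M → ℝ} (hφ : ContMDiffAt 𝓘(ℝ, E) 𝓘(ℝ, ℝ) ∞ φ p) : WeakSmoothAt E φ p := by
  have := smul hφ (const (E := E) (1 : ℝ))
  simpa only [smul_eq_mul, mul_one] using this

end WeakSmoothAt

variable [FiniteDimensional ℝ W] [FiniteDimensional ℝ W'] [FiniteDimensional ℝ W'']

variable (E) in
/-- The derivative of a map to a finite-dimensional space that is smooth at a point. -/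
def weakDeriv (F : M → W) (p : M) : TangentSpace 𝓘(ℝ, E) p →ₗ[ℝ] W :=
  ∑ i, (mvfderiv 𝓘(ℝ, E) (fun x => (finBasis ℝ W).coord i (F x)) p).toLinearMap.smulRight
    (finBasis ℝ W i)

section

variable {p : M} {F G : M → W}

/-- This characterizes the derivative by linear functionals and frees it from the basis used in its
definition; the calculus rules below are all checked on functionals. -/
theorem dual_weakDeriv (hF : WeakSmoothAt E F p) (ℓ : Dual ℝ W) (a : TangentSpace 𝓘(ℝ, E) p) :
    ℓ (weakDeriv E F p a) = mvfderiv 𝓘(ℝ, E) (fun x => ℓ (F x)) p a := by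
  let b := finBasis ℝ W
  have h : (fun x => ℓ (F x)) = fun x => ∑ i, ℓ (b i) * b.coord i (F x) := by
    ext x
    conv_lhs => rw [← b.sum_repr (F x)]
    simp only [map_sum, map_smul, smul_eq_mul, mul_comm (ℓ _)]
    rfl
  rw [h, mvfderiv_sum_apply fun i _ => contMDiffAt_mul contMDiffAt_const (hF (b.coord i))]
  simp only [weakDeriv, LinearMap.sum_apply, map_sum, LinearMap.smulRight_apply, map_smul]
  refine Finset.sum_congr rfl fun i _ => ?_
  rw [mvfderiv_mul_apply contMDiffAt_const (hF (b.coord i)), mvfderiv_const_apply, mul_zero,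
    add_zero, smul_eq_mul, mul_comm]
  rfl

theorem eq_weakDeriv (hF : WeakSmoothAt E F p) {a : TangentSpace 𝓘(ℝ, E) p} {w : W}
    (h : ∀ ℓ : Dual ℝ W, mvfderiv 𝓘(ℝ, E) (fun x => ℓ (F x)) p a = ℓ w) :
    weakDeriv E F p a = w := by
  refine sub_eq_zero.1 ((forall_dual_apply_eq_zero_iff ℝ _).1 fun ℓ => ?_)
  rw [map_sub, dual_weakDeriv hF, h, sub_self]

theorem weakDeriv_congr (hF : WeakSmoothAt E F p) (h : G =ᶠ[𝓝 p] F) :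
    weakDeriv E G p = weakDeriv E F p := by
  ext a
  refine eq_weakDeriv (hF.congr h) fun ℓ => ?_
  rw [dual_weakDeriv hF, mvfderiv_congr (h.mono fun x hx => congrArg ℓ hx)]

theorem weakDeriv_const (w : W) (a : TangentSpace 𝓘(ℝ, E) p) :
    weakDeriv E (fun _ : M => w) p a = 0 :=
  eq_weakDeriv (WeakSmoothAt.const w) fun ℓ => by rw [mvfderiv_const_apply, map_zero]

theorem weakDeriv_add (hF : WeakSmoothAt E F p) (hG : WeakSmoothAt E G p)
    (a : TangentSpace 𝓘(ℝ, E) p) :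
    weakDeriv E (fun x => F x + G x) p a = weakDeriv E F p a + weakDeriv E G p a :=
  eq_weakDeriv (hF.add hG) fun ℓ => by
    simp only [map_add, dual_weakDeriv hF, dual_weakDeriv hG]
    exact mvfderiv_add_apply (hF ℓ) (hG ℓ) a

theorem weakDeriv_map (L : W →ₗ[ℝ] W') (hF : WeakSmoothAt E F p) (a : TangentSpace 𝓘(ℝ, E) p) :
    weakDeriv E (fun x => L (F x)) p a = L (weakDeriv E F p a) :=
  eq_weakDeriv (hF.map L) fun ℓ => (dual_weakDeriv hF (ℓ ∘ₗ L) a).symm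

theorem weakDeriv_bilin (B : W →ₗ[ℝ] W' →ₗ[ℝ] W'') {H : M → W'}
    (hF : WeakSmoothAt E F p) (hH : WeakSmoothAt E H p) (a : TangentSpace 𝓘(ℝ, E) p) :
    weakDeriv E (fun x => B (F x) (H x)) p a =
      B (weakDeriv E F p a) (H p) + B (F p) (weakDeriv E H p a) := by
  refine eq_weakDeriv (hF.bilin B hH) fun ℓ => ?_
  let b := finBasis ℝ W
  have h : (fun x => ℓ (B (F x) (H x))) =
      fun x => ∑ i, b.coord i (F x) * ℓ (B (b i) (H x)) := by
    ext x
    conv_lhs => rw [← b.sum_repr (F x)]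
    simp only [map_sum, map_smul, smul_eq_mul, LinearMap.sum_apply, LinearMap.smul_apply]
    rfl
  have h' : ∀ w w', ℓ (B w w') = ∑ i, b.coord i w * ℓ (B (b i) w') := fun w w' => by
    conv_lhs => rw [← b.sum_repr w]
    simp only [map_sum, map_smul, smul_eq_mul, LinearMap.sum_apply, LinearMap.smul_apply]
    rfl
  have hs := fun i => hH (ℓ ∘ₗ B (b i))
  rw [h]
  refine (mvfderiv_sum_apply (fun i _ => contMDiffAt_mul (hF (b.coord i)) (hs i)) a).trans ?_
  rw [map_add, h', h', ← Finset.sum_add_distrib]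
  refine Finset.sum_congr rfl fun i _ => ?_
  refine (mvfderiv_mul_apply (hF (b.coord i)) (hs i) a).trans ?_
  rw [dual_weakDeriv hF, ← dual_weakDeriv (E := E) hH (ℓ ∘ₗ B (b i)), add_comm, mul_comm]
  rfl

theorem weakDeriv_smul {φ : M → ℝ} (hφ : ContMDiffAt 𝓘(ℝ, E) 𝓘(ℝ, ℝ) ∞ φ p) (w : W)
    (a : TangentSpace 𝓘(ℝ, E) p) :
    weakDeriv E (fun x => φ x • w) p a = mvfderiv 𝓘(ℝ, E) φ p a • w := by
  refine eq_weakDeriv (WeakSmoothAt.smul hφ (WeakSmoothAt.const w)) fun ℓ => ?_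
  simp only [map_smul, smul_eq_mul]
  rw [mvfderiv_mul_apply hφ contMDiffAt_const, mvfderiv_const_apply, mul_zero, zero_add, mul_comm]

end

end WeakCalculus

end GeomCalc

end

noncomputable section

namespace GeomCalc

open Filter Module

section

variable {D V F : Type*} [NormedAddCommGroup D] [NormedSpace ℝ D] [NormedAddCommGroup V]
  [NormedSpace ℝ V] [FiniteDimensional ℝ V] [NormedAddCommGroup F] [NormedSpace ℝ F]

theorem contDiffAt_of_clm_apply {f : D → V →L[ℝ] F} {y : D}
    (h : ∀ v, ContDiffAt ℝ ∞ (fun x => f x v) y) : ContDiffAt ℝ ∞ f y := by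
  have hd : finrank ℝ V = finrank ℝ (Fin (finrank ℝ V) → ℝ) := (finrank_fin_fun ℝ).symm
  let e₁ := ContinuousLinearEquiv.ofFinrankEq hd
  let e₂ := (e₁.arrowCongr (1 : F ≃L[ℝ] F)).trans (ContinuousLinearEquiv.piRing (Fin (finrank ℝ V)))
  rw [← Function.id_comp f, ← e₂.symm_comp_self]
  exact e₂.symm.contDiff.contDiffAt.comp y (contDiffAt_pi.mpr fun i => h _)

end

/-! ### Coordinate components, the Lie bracket in a chart, and the existence of gauges. -/

section Frames

variable {E : Type*} [NormedAddCommGroup E] [NormedSpace ℝ E] [FiniteDimensional ℝ E]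
  {M : Type*} [TopologicalSpace M] [ChartedSpace E M] [IsManifold 𝓘(ℝ, E) ∞ M]

/-- The coordinate components, in the chart at `p`, of tangent vectors at `x`. -/
def coordComp (p x : M) : TangentSpace 𝓘(ℝ, E) x →L[ℝ] E :=
  (trivializationAt E (TangentSpace 𝓘(ℝ, E)) p).continuousLinearMapAt ℝ x

variable {p x q : M}

theorem mem_baseSet (hx : x ∈ (chartAt E p).source) :
    x ∈ (trivializationAt E (TangentSpace 𝓘(ℝ, E)) p).baseSet := hx

theorem coordComp_coordVec (hx : x ∈ (chartAt E p).source) (v : E) :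
    coordComp p x (coordVec p x v) = v :=
  (trivializationAt E (TangentSpace 𝓘(ℝ, E)) p).continuousLinearMapAt_symmL (mem_baseSet hx) v

theorem coordVec_coordComp (hx : x ∈ (chartAt E p).source) (v : TangentSpace 𝓘(ℝ, E) x) :
    coordVec p x (coordComp p x v) = v :=
  (trivializationAt E (TangentSpace 𝓘(ℝ, E)) p).symmL_continuousLinearMapAt (mem_baseSet hx) v

theorem eventually_mem_chart (p : M) : ∀ᶠ x in 𝓝 p, x ∈ (chartAt E p).source :=
  (chartAt E p).open_source.mem_nhds (mem_chart_source E p)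

theorem weakSmoothAt_iff_contMDiffAt {W : Type*} [NormedAddCommGroup W] [NormedSpace ℝ W]
    [FiniteDimensional ℝ W] {F : M → W} :
    WeakSmoothAt E F p ↔ ContMDiffAt 𝓘(ℝ, E) 𝓘(ℝ, W) ∞ F p := by
  constructor
  · intro h
    let b := finBasis ℝ W
    have : F = fun x => ∑ i, b.coord i (F x) • b i := by
      ext x; exact (b.sum_repr (F x)).symm
    rw [this]
    exact contMDiffAt_finsetSum fun i _ => (h (b.coord i)).smul contMDiffAt_const
  · intro h ℓ
    exact (ContinuousLinearMap.contMDiff (ℓ.toContinuousLinearMap)).contMDiffAt.comp p h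

/-- Smoothness of a section may be tested in any trivialization. The chart at `p` is needed at
neighbouring points `q`, whose own preferred chart may be another one, because MDDs act on fields
smooth near `p`. -/
theorem contMDiffAt_section_iff {v : ∀ x : M, TangentSpace 𝓘(ℝ, E) x}
    (hq : q ∈ (chartAt E p).source) :
    ContMDiffAt 𝓘(ℝ, E) 𝓘(ℝ, E).tangent ∞
      (fun y => (⟨y, v y⟩ : TangentBundle 𝓘(ℝ, E) M)) q ↔
    WeakSmoothAt E (fun x => coordComp p x (v x)) q := by
  rw [weakSmoothAt_iff_contMDiffAt]
  have h := (trivializationAt E (TangentSpace 𝓘(ℝ, E)) p).contMDiffAt_section_iff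
    (IB := 𝓘(ℝ, E)) (n := ∞) (s := v) (mem_baseSet hq)
  refine h.trans ⟨fun h => h.congr_of_eventuallyEq ?_, fun h => h.congr_of_eventuallyEq ?_⟩ <;>
  filter_upwards [(chartAt E p).open_source.mem_nhds hq] with x hx
  · exact (trivializationAt E (TangentSpace 𝓘(ℝ, E)) p).continuousLinearMapAt_apply_of_mem ℝ hx _
  · exact ((trivializationAt E (TangentSpace 𝓘(ℝ, E)) p).continuousLinearMapAt_apply_of_mem ℝ hx _).symm

theorem contMDiffAt_coordVec (v : E) (hq : q ∈ (chartAt E p).source) :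
    ContMDiffAt 𝓘(ℝ, E) 𝓘(ℝ, E).tangent ∞
      (fun y => (⟨y, coordVec p y v⟩ : TangentBundle 𝓘(ℝ, E) M)) q := by
  rw [contMDiffAt_section_iff hq]
  refine (WeakSmoothAt.const v).congr ?_
  filter_upwards [(chartAt E p).open_source.mem_nhds hq] with x hx
  exact coordComp_coordVec hx v

/-- Tangent spaces are copies of the model space, identified by the preferred chart at the point, so
at its own base point that chart has the identity as derivative. -/
theorem coordComp_self (v : TangentSpace 𝓘(ℝ, E) p) : coordComp p p v = (v : E) := by
  have h := TangentBundle.continuousLinearMapAt_trivializationAt (𝕜 := ℝ) (I := 𝓘(ℝ, E))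
    (mem_chart_source E p)
  rw [mfderiv_extChartAt_self] at h
  exact DFunLike.congr_fun h v

theorem mvfderiv_eq_fderiv {φ : M → ℝ} (hφ : ContMDiffAt 𝓘(ℝ, E) 𝓘(ℝ, ℝ) ∞ φ p)
    (a : TangentSpace 𝓘(ℝ, E) p) :
    mvfderiv 𝓘(ℝ, E) φ p a =
      fderiv ℝ (φ ∘ (extChartAt 𝓘(ℝ, E) p).symm) (extChartAt 𝓘(ℝ, E) p p) (coordComp p p a) := by
  have h := MDifferentiableAt.mvfderiv (hφ.mdifferentiableAt (by simp))
  rw [h, coordComp_self]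
  simp [writtenInExtChartAt]
  rfl

theorem contMDiffAt_iff_contDiffAt_chart {F : Type*} [NormedAddCommGroup F] [NormedSpace ℝ F]
    {φ : M → F} :
    ContMDiffAt 𝓘(ℝ, E) 𝓘(ℝ, F) ∞ φ p ↔
      ContDiffAt ℝ ∞ (φ ∘ (extChartAt 𝓘(ℝ, E) p).symm) (extChartAt 𝓘(ℝ, E) p p) := by
  rw [contMDiffAt_iff_source, ModelWithCorners.range_eq_univ, contMDiffWithinAt_univ,
    contMDiffAt_iff_contDiffAt]

theorem weakDeriv_eq_fderiv {φ : M → E} (hφ : WeakSmoothAt E φ p)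
    (a : TangentSpace 𝓘(ℝ, E) p) :
    weakDeriv E φ p a =
      fderiv ℝ (φ ∘ (extChartAt 𝓘(ℝ, E) p).symm) (extChartAt 𝓘(ℝ, E) p p) (coordComp p p a) := by
  refine eq_weakDeriv hφ fun ℓ => ?_
  rw [mvfderiv_eq_fderiv (hφ ℓ)]
  have h := ((contMDiffAt_iff_contDiffAt_chart.1 (weakSmoothAt_iff_contMDiffAt.1 hφ)).differentiableAt
    (by simp)).hasFDerivAt
  exact DFunLike.congr_fun (ℓ.toContinuousLinearMap.hasFDerivAt.comp _ h).fderiv _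

theorem eventually_extChartAt_symm (p : M) {P : M → Prop} (h : ∀ᶠ x in 𝓝 p, P x) :
    ∀ᶠ y in 𝓝 (extChartAt 𝓘(ℝ, E) p p), P ((extChartAt 𝓘(ℝ, E) p).symm y) := by
  have := continuousAt_extChartAt_symm (I := 𝓘(ℝ, E)) p
  rw [ContinuousAt, extChartAt_to_inv] at this
  exact this.eventually h

theorem weakSmoothAt_comp_extChartAt {W : Type*} [NormedAddCommGroup W] [NormedSpace ℝ W]
    [FiniteDimensional ℝ W] {G : E → W} (hG : ContDiffAt ℝ ∞ G (extChartAt 𝓘(ℝ, E) p p)) :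
    WeakSmoothAt E (fun x => G (extChartAt 𝓘(ℝ, E) p x)) p := fun ℓ =>
  (ℓ.toContinuousLinearMap.contDiff.contDiffAt.comp _ hG).contMDiffAt.comp p contMDiffAt_extChartAt

theorem weakDeriv_comp_extChartAt {W : Type*} [NormedAddCommGroup W] [NormedSpace ℝ W]
    [FiniteDimensional ℝ W] {G : E → W} (hG : ContDiffAt ℝ ∞ G (extChartAt 𝓘(ℝ, E) p p))
    (a : TangentSpace 𝓘(ℝ, E) p) :
    weakDeriv E (fun x => G (extChartAt 𝓘(ℝ, E) p x)) p a =
      fderiv ℝ G (extChartAt 𝓘(ℝ, E) p p) (coordComp p p a) := by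
  refine eq_weakDeriv (weakSmoothAt_comp_extChartAt hG) fun ℓ => ?_
  rw [mvfderiv_eq_fderiv (weakSmoothAt_comp_extChartAt hG ℓ)]
  have h := (hG.differentiableAt (by simp)).hasFDerivAt
  refine Eq.trans ?_ (DFunLike.congr_fun (ℓ.toContinuousLinearMap.hasFDerivAt.comp _ h).fderiv
    (coordComp p p a))
  refine congrArg (fun f : E →L[ℝ] ℝ => f (coordComp p p a)) (EventuallyEq.fderiv_eq ?_)
  filter_upwards [extChartAt_target_mem_nhds (I := 𝓘(ℝ, E)) p] with y hy
  simp only [Function.comp, PartialEquiv.right_inv _ hy]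
  rfl

theorem inverse_mfderivWithin_extChartAt_symm {x : M} (hx : x ∈ (chartAt E p).source) :
    (mfderivWithin 𝓘(ℝ, E) 𝓘(ℝ, E) (extChartAt 𝓘(ℝ, E) p).symm (Set.range 𝓘(ℝ, E))
      (extChartAt 𝓘(ℝ, E) p x)).inverse = coordComp p x := by
  rw [← TangentBundle.symmL_trivializationAt hx]
  refine ContinuousLinearMap.inverse_eq ?_ ?_
  · ext v; exact coordVec_coordComp hx v
  · ext v; exact coordComp_coordVec hx v

/-- The bracket is defined by pulling back along the inverse chart. Near the base point the
pulled-back field is the field of coordinate components, so the flat formula for the bracket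
applies. -/
theorem coordComp_mlieBracket {v w : ∀ x : M, TangentSpace 𝓘(ℝ, E) x}
    (hv : WeakSmoothAt E (fun x => coordComp p x (v x)) p)
    (hw : WeakSmoothAt E (fun x => coordComp p x (w x)) p) :
    coordComp p p (VectorField.mlieBracket 𝓘(ℝ, E) v w p) =
      weakDeriv E (fun x => coordComp p x (w x)) p (v p) -
        weakDeriv E (fun x => coordComp p x (v x)) p (w p) := by
  let P : (∀ x : M, TangentSpace 𝓘(ℝ, E) x) → E → E := fun v =>
    VectorField.mpullbackWithin 𝓘(ℝ, E) 𝓘(ℝ, E) (extChartAt 𝓘(ℝ, E) p).symm v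
      (Set.range 𝓘(ℝ, E))
  have key : ∀ v, P v =ᶠ[𝓝 (extChartAt 𝓘(ℝ, E) p p)]
      (fun x => coordComp p x (v x)) ∘ (extChartAt 𝓘(ℝ, E) p).symm := fun v => by
    filter_upwards [eventually_extChartAt_symm p (eventually_mem_chart (E := E) p),
      extChartAt_target_mem_nhds (I := 𝓘(ℝ, E)) p] with y hy hy'
    have := inverse_mfderivWithin_extChartAt_symm hy
    rw [(extChartAt 𝓘(ℝ, E) p).right_inv hy'] at this
    exact DFunLike.congr_fun this _
  have hval : ∀ v, P v (extChartAt 𝓘(ℝ, E) p p) = coordComp p p (v p) := fun v => by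
    have h : ∀ x, x = p → coordComp p x (v x) = coordComp p p (v p) := by rintro x rfl; rfl
    exact (key v).eq_of_nhds.trans (h _ (extChartAt_to_inv p))
  have hinv : ∀ z, (mfderiv 𝓘(ℝ, E) 𝓘(ℝ, E) (extChartAt 𝓘(ℝ, E) p) p).inverse z = z := fun z => by
    rw [mfderiv_extChartAt_self]
    exact DFunLike.congr_fun (ContinuousLinearMap.inverse_id (R := ℝ) (M := E)) z
  have hr : (extChartAt 𝓘(ℝ, E) p).symm ⁻¹' Set.univ ∩ Set.range 𝓘(ℝ, E) = Set.univ := by simp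
  have main : VectorField.lieBracketWithin ℝ (P v) (P w)
      ((extChartAt 𝓘(ℝ, E) p).symm ⁻¹' Set.univ ∩ Set.range 𝓘(ℝ, E)) (extChartAt 𝓘(ℝ, E) p p) =
      weakDeriv E (fun x => coordComp p x (w x)) p (v p) -
        weakDeriv E (fun x => coordComp p x (v x)) p (w p) := by
    rw [weakDeriv_eq_fderiv hv, weakDeriv_eq_fderiv hw, hr, VectorField.lieBracketWithin_univ,
      VectorField.lieBracket, hval, hval, (key v).fderiv_eq, (key w).fderiv_eq]
  rw [coordComp_self, ← VectorField.mlieBracketWithin_univ, VectorField.mlieBracketWithin_apply]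
  exact (hinv _).trans main


/-- The metric in the coordinate frame of the chart at `p`. -/
def chartForm (g : PseudoRiemannianMetric E M) (p x : M) : E →ₗ[ℝ] E →ₗ[ℝ] ℝ :=
  (g.form x).compl₁₂ (coordVec p x).toLinearMap (coordVec p x).toLinearMap

theorem contMDiffAt_inner (g : PseudoRiemannianMetric E M) {v w : ∀ x : M, TangentSpace 𝓘(ℝ, E) x}
    (hv : ContMDiffAt 𝓘(ℝ, E) 𝓘(ℝ, E).tangent ∞
      (fun y => (⟨y, v y⟩ : TangentBundle 𝓘(ℝ, E) M)) p)
    (hw : ContMDiffAt 𝓘(ℝ, E) 𝓘(ℝ, E).tangent ∞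
      (fun y => (⟨y, w y⟩ : TangentBundle 𝓘(ℝ, E) M)) p) :
    ContMDiffAt 𝓘(ℝ, E) 𝓘(ℝ, ℝ) ∞ (fun x => g.inner x (v x) (w x)) p := by
  have : ContMDiffAt 𝓘(ℝ, E) (𝓘(ℝ, E).prod 𝓘(ℝ)) ∞
      (fun m ↦ Bundle.TotalSpace.mk' ℝ (E := Bundle.Trivial M ℝ) m (g.inner m (v m) (w m))) p := by
    apply ContMDiffAt.clm_bundle_apply₂ (F₁ := E) (F₂ := E)
    · exact g.contMDiff.contMDiffAt
    · exact hv
    · exact hw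
  rw [Bundle.contMDiffAt_totalSpace] at this
  exact this.2

theorem contMDiffAt_chartForm (g : PseudoRiemannianMetric E M) (p : M) (v w : E) :
    ContMDiffAt 𝓘(ℝ, E) 𝓘(ℝ, ℝ) ∞ (fun x => chartForm g p x v w) p :=
  contMDiffAt_inner g (contMDiffAt_coordVec v (mem_chart_source E p))
    (contMDiffAt_coordVec w (mem_chart_source E p))

/-- Linear isometries from the tangent spaces near `p` to the tangent space at `p`, in terms of
coordinate components, with their inverses, that depend smoothly on the base point and whose
derivative at `p` is symmetric. -/
structure Gauge (g : PseudoRiemannianMetric E M) (p : M) where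
  toFun : M → E →ₗ[ℝ] TangentSpace 𝓘(ℝ, E) p
  invFun : M → TangentSpace 𝓘(ℝ, E) p →ₗ[ℝ] E
  isometry : ∀ᶠ x in 𝓝 p, ∀ v w, g.form p (toFun x v) (toFun x w) = chartForm g p x v w
  left_inv : ∀ᶠ x in 𝓝 p, ∀ v, invFun x (toFun x v) = v
  right_inv : ∀ᶠ x in 𝓝 p, ∀ v, toFun x (invFun x v) = v
  smooth : WeakSmoothAt E toFun p
  smooth_inv : WeakSmoothAt E invFun p
  toFun_self (v) : toFun p (coordComp p p v) = v
  symm (v w) : weakDeriv E toFun p v (coordComp p p w) = weakDeriv E toFun p w (coordComp p p v)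

-- `exists_smooth_isometry` applied to the metric read in the chart at `p`, with target carried to
-- the tangent space at `p` by the coordinate frame there. The inverses are smooth because inversion
-- of operators is smooth at the identity.
set_option synthInstance.maxHeartbeats 400000 in
theorem nonempty_gauge (g : PseudoRiemannianMetric E M) (p : M) : Nonempty (Gauge g p) := by
  have hp := mem_chart_source E p
  let G : E → E →L[ℝ] E →L[ℝ] ℝ := fun y =>
    (chartForm g p ((extChartAt 𝓘(ℝ, E) p).symm y)).toContinuousBilinearMap
  have hG0 : ∀ v w, G (extChartAt 𝓘(ℝ, E) p p) v w = g.form p (coordVec p p v) (coordVec p p w) :=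
    fun v w => by
      change chartForm g p _ v w = chartForm g p p v w
      rw [extChartAt_to_inv]
  have hG : ContDiffAt ℝ ∞ G (extChartAt 𝓘(ℝ, E) p p) :=
    contDiffAt_of_clm_apply fun v => contDiffAt_of_clm_apply fun w =>
      contMDiffAt_iff_contDiffAt_chart.1 (contMDiffAt_chartForm g p v w)
  obtain ⟨U, hU, hU0, hUi, hUs⟩ := exists_smooth_isometry hG (fun y v w => g.symm _ _ _) (by
    intro v hv
    have := g.nondegenerate p (coordVec p p v) fun w => by
      have := hv (coordComp p p w)
      rw [hG0, coordVec_coordComp hp] at this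
      exact this
    rw [← coordComp_coordVec hp v, this, map_zero])
  let L : (E →L[ℝ] E) →ₗ[ℝ] (E →ₗ[ℝ] TangentSpace 𝓘(ℝ, E) p) :=
    { toFun := fun A => (coordVec p p).toLinearMap ∘ₗ A.toLinearMap
      map_add' := fun A B => by ext v; exact map_add (coordVec p p) (A v) (B v)
      map_smul' := fun r A => by ext v; exact map_smul (coordVec p p) r (A v) }
  let L' : (E →L[ℝ] E) →ₗ[ℝ] (TangentSpace 𝓘(ℝ, E) p →ₗ[ℝ] E) :=
    { toFun := fun A => A.toLinearMap ∘ₗ (coordComp p p).toLinearMap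
      map_add' := fun A B => rfl
      map_smul' := fun r A => rfl }
  have hunit : ∀ᶠ y in 𝓝 (extChartAt 𝓘(ℝ, E) p p), IsUnit (U y) :=
    hU.continuousAt.eventually (by rw [hU0]; exact Units.isOpen.mem_nhds isUnit_one)
  have hinv : ContDiffAt ℝ ∞ (fun y => Ring.inverse (U y)) (extChartAt 𝓘(ℝ, E) p p) := by
    have h := contDiffAt_ringInverse ℝ (n := ∞) (1 : (E →L[ℝ] E)ˣ)
    rw [Units.val_one, ← hU0] at h
    exact h.comp _ hU
  have hc := continuousAt_extChartAt (I := 𝓘(ℝ, E)) p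
  refine ⟨⟨fun x => L (U (extChartAt 𝓘(ℝ, E) p x)),
    fun x => L' (Ring.inverse (U (extChartAt 𝓘(ℝ, E) p x))), ?_, ?_, ?_,
    (weakSmoothAt_comp_extChartAt hU).map L, (weakSmoothAt_comp_extChartAt hinv).map L', ?_, ?_⟩⟩
  · filter_upwards [hc.eventually hUi, extChartAt_source_mem_nhds (I := 𝓘(ℝ, E)) p] with x hx hs v w
    have := hx v w
    rw [hG0] at this
    refine this.trans ?_
    change chartForm g p _ v w = _
    rw [(extChartAt 𝓘(ℝ, E) p).left_inv hs]
  · filter_upwards [hc.eventually hunit] with x hx v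
    change Ring.inverse (U _) (coordComp p p (coordVec p p (U _ v))) = v
    rw [coordComp_coordVec hp]
    exact DFunLike.congr_fun (Ring.inverse_mul_cancel _ hx) v
  · filter_upwards [hc.eventually hunit] with x hx v
    change coordVec p p (U _ (Ring.inverse (U _) (coordComp p p v))) = v
    rw [show U _ (Ring.inverse (U _) _) = _ from
      DFunLike.congr_fun (Ring.mul_inverse_cancel _ hx) (coordComp p p v)]
    exact coordVec_coordComp hp v
  · intro v
    change coordVec p p (U _ (coordComp p p v)) = v
    rw [hU0]
    exact coordVec_coordComp hp v
  · intro v w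
    rw [weakDeriv_map L (weakSmoothAt_comp_extChartAt hU),
      weakDeriv_map L (weakSmoothAt_comp_extChartAt hU), weakDeriv_comp_extChartAt hU,
      weakDeriv_comp_extChartAt hU]
    exact congrArg (coordVec p p) (hUs _ _)

end Frames

end GeomCalc

end

noncomputable section

namespace GeomAlg

section

variable {V : Type*} [AddCommGroup V] [Module ℝ V] [FiniteDimensional ℝ V]

instance instFiniteDimensionalExteriorAlgebra : FiniteDimensional ℝ (ExteriorAlgebra ℝ V) :=
  Module.Finite.of_basis (Module.finBasis ℝ V).ExteriorAlgebra

instance instFiniteDimensionalCliffordAlgebra (Q : QuadraticForm ℝ V) :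
    FiniteDimensional ℝ (CliffordAlgebra Q) :=
  Module.Finite.equiv (CliffordAlgebra.equivExterior Q).symm

end

end GeomAlg

namespace GeomCalc

open GeomAlg Filter Module CliffordAlgebra

section

variable {E : Type*} [NormedAddCommGroup E] [NormedSpace ℝ E]
  {M : Type*} [TopologicalSpace M] [ChartedSpace E M]
  {W : Type*} [AddCommGroup W] [Module ℝ W] [FiniteDimensional ℝ W]
  {W' : Type*} [AddCommGroup W'] [Module ℝ W']

/-- For a fixed element the claim holds on scalars and vectors and is stable under products, because
`ExteriorAlgebra.map` is multiplicative. A varying element is then handled by applying a smooth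
family of linear maps. -/
theorem WeakSmoothAt.exteriorAlgebra_map [FiniteDimensional ℝ W'] {U : M → W →ₗ[ℝ] W'}
    {F : M → ExteriorAlgebra ℝ W} {p : M} (hU : WeakSmoothAt E U p) (hF : WeakSmoothAt E F p) :
    WeakSmoothAt E (fun x => ExteriorAlgebra.map (U x) (F x)) p := by
  have h : ∀ z, WeakSmoothAt E (fun x => ExteriorAlgebra.map (U x) z) p := by
    intro z
    induction z using ExteriorAlgebra.induction with
    | algebraMap r => simpa only [AlgHom.commutes] using WeakSmoothAt.const _
    | ι v =>
      simp only [ExteriorAlgebra.map_apply_ι]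
      exact (hU.apply (WeakSmoothAt.const v)).map (ExteriorAlgebra.ι ℝ)
    | mul a b ha hb =>
      simp only [map_mul]
      exact ha.bilin (LinearMap.mul ℝ (ExteriorAlgebra ℝ W')) hb
    | add a b ha hb => simp only [map_add]; exact ha.add hb
  exact (WeakSmoothAt.of_apply (F := fun x => (ExteriorAlgebra.map (U x)).toLinearMap) h).apply hF

end

/-! ### Multivector fields as functions with values in one geometric algebra. -/

section Transport

variable {E : Type*} [NormedAddCommGroup E] [NormedSpace ℝ E] [FiniteDimensional ℝ E]
  {M : Type*} [TopologicalSpace M] [ChartedSpace E M] [IsManifold 𝓘(ℝ, E) ∞ M]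

/-- A choice of gauge at each point. -/
def gauge (g : PseudoRiemannianMetric E M) (p : M) : Gauge g p := (nonempty_gauge g p).some

/-- The linear map between tangent spaces given by the gauge at `p`. -/
def transport (g : PseudoRiemannianMetric E M) (p x : M) :
    TangentSpace 𝓘(ℝ, E) x →ₗ[ℝ] TangentSpace 𝓘(ℝ, E) p :=
  (gauge g p).toFun x ∘ₗ (coordComp p x).toLinearMap

/-- The gauge at `p` is an isometry at `x`. -/
def IsGaugeIsometry (g : PseudoRiemannianMetric E M) (p x : M) : Prop :=
  ∀ v, g.quad p (transport g p x v) = g.quad x v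

open Classical in
/-- The linear map between geometric algebras given by the gauge at `p`. -/
def transportCl (g : PseudoRiemannianMetric E M) (p x : M) : GT g x →ₗ[ℝ] GT g p :=
  if h : IsGaugeIsometry g p x then
    (CliffordAlgebra.map (⟨transport g p x, h⟩ : g.quad x →qᵢ g.quad p)).toLinearMap
  -- A gauge is known to be isometric only near its base point. The default is harmless because only
  -- the germ there is used.
  else 0

variable {g : PseudoRiemannianMetric E M} {p x q : M}

theorem associated_quad (a b : TangentSpace 𝓘(ℝ, E) x) :
    QuadraticMap.associated (R := ℝ) (M := TangentSpace 𝓘(ℝ, E) x) (g.quad x) a b =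
      g.form x a b := by
  have h : (g.form x).flip = g.form x := by ext v w; exact g.symm x w v
  have := QuadraticMap.associated_left_inverse' (S := ℝ) h
  exact DFunLike.congr_fun (DFunLike.congr_fun this a) b

theorem eventually_form_transport (g : PseudoRiemannianMetric E M) (p : M) :
    ∀ᶠ x in 𝓝 p, ∀ v w, g.form p (transport g p x v) (transport g p x w) = g.form x v w := by
  filter_upwards [(gauge g p).isometry, eventually_mem_chart (E := E) p] with x hx hc v w
  refine (hx _ _).trans ?_
  change g.form x (coordVec p x (coordComp p x v)) (coordVec p x (coordComp p x w)) = _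
  rw [coordVec_coordComp hc, coordVec_coordComp hc]

theorem eventually_isGaugeIsometry (g : PseudoRiemannianMetric E M) (p : M) :
    ∀ᶠ x in 𝓝 p, IsGaugeIsometry g p x :=
  (eventually_form_transport g p).mono fun _ hx v => hx v v

theorem transport_self (v : TangentSpace 𝓘(ℝ, E) p) : transport g p p v = v :=
  (gauge g p).toFun_self v

namespace IsGaugeIsometry

variable (h : IsGaugeIsometry g p x)
include h

/-- The gauge as an isometry. -/
def isometry : g.quad x →qᵢ g.quad p := ⟨transport g p x, h⟩

theorem transportCl_eq : ∀ A, transportCl g p x A = CliffordAlgebra.map h.isometry A := fun A => by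
  rw [transportCl, dif_pos h]; rfl

theorem transportCl_mul (A B : GT g x) :
    transportCl g p x (A * B) = transportCl g p x A * transportCl g p x B := by
  simp only [h.transportCl_eq, map_mul]

theorem transportCl_algebraMap (r : ℝ) :
    transportCl g p x (algebraMap ℝ _ r) = algebraMap ℝ _ r := by
  simp only [h.transportCl_eq, AlgHom.commutes]

theorem transportCl_ι (v : TangentSpace 𝓘(ℝ, E) x) :
    transportCl g p x (ι _ v) = ι _ (transport g p x v) := by
  rw [h.transportCl_eq]; exact CliffordAlgebra.map_apply_ι _ v

theorem transportCl_wedge (A B : GT g x) : transportCl g p x (wedge (g.quad x) A B) =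
    wedge (g.quad p) (transportCl g p x A) (transportCl g p x B) := by
  simp only [h.transportCl_eq, map_wedge]

theorem transportCl_grade (k : ℕ) (A : GT g x) : transportCl g p x (grade (g.quad x) k A) =
    grade (g.quad p) k (transportCl g p x A) := by
  simp only [h.transportCl_eq, map_grade]

theorem scalarPart_transportCl (A : GT g x) :
    scalarPart (g.quad p) (transportCl g p x A) = scalarPart (g.quad x) A := by
  rw [h.transportCl_eq, map_scalarPart]

theorem equivExterior_transportCl (A : GT g x) :
    equivExterior (g.quad p) (transportCl g p x A) =
      ExteriorAlgebra.map ((gauge g p).toFun x)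
        (ExteriorAlgebra.map (coordComp p x).toLinearMap (equivExterior (g.quad x) A)) := by
  rw [h.transportCl_eq, equivExterior_map, ← AlgHom.comp_apply, ExteriorAlgebra.map_comp_map]
  rfl

end IsGaugeIsometry

theorem transportCl_self (A : GT g p) : transportCl g p p A = A := by
  have h := (eventually_isGaugeIsometry g p).self_of_nhds
  rw [h.transportCl_eq]
  have : h.isometry = QuadraticMap.Isometry.id _ := by
    ext v; exact transport_self v
  rw [this, CliffordAlgebra.map_id]; rfl

variable (g) in
/-- A multivector field in the exterior algebra of the model space, by the coordinate components
in the chart at `p`. -/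
def chartField (A : MVField g) (p x : M) : ExteriorAlgebra ℝ E :=
  ExteriorAlgebra.map (coordComp p x).toLinearMap (equivExterior (g.quad x) (A x))

theorem map_coordComp_coordVec (hx : x ∈ (chartAt E p).source) (z : ExteriorAlgebra ℝ E) :
    ExteriorAlgebra.map (coordComp p x).toLinearMap
      (ExteriorAlgebra.map (coordVec p x).toLinearMap z) = z := by
  rw [← AlgHom.comp_apply, ExteriorAlgebra.map_comp_map]
  have : (coordComp (E := E) p x).toLinearMap ∘ₗ (coordVec p x).toLinearMap = LinearMap.id := by
    ext v; exact coordComp_coordVec hx v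
  rw [this, ExteriorAlgebra.map_id]; rfl

theorem map_coordVec_coordComp (hx : x ∈ (chartAt E p).source)
    (z : ExteriorAlgebra ℝ (TangentSpace 𝓘(ℝ, E) x)) :
    ExteriorAlgebra.map (coordVec p x).toLinearMap
      (ExteriorAlgebra.map (coordComp p x).toLinearMap z) = z := by
  rw [← AlgHom.comp_apply, ExteriorAlgebra.map_comp_map]
  have : (coordVec (E := E) p x).toLinearMap ∘ₗ (coordComp p x).toLinearMap = LinearMap.id := by
    ext v; exact coordVec_coordComp hx v
  rw [this, ExteriorAlgebra.map_id]; rfl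

theorem equivExterior_coordFrame (J : Finset (Fin (finrank ℝ E))) :
    equivExterior (g.quad x) (coordFrame g p x J) =
      ExteriorAlgebra.map (coordVec p x).toLinearMap ((finBasis ℝ E).ExteriorAlgebra J) := by
  rw [coordFrame, equivExterior_wedgeList, basis_exteriorAlgebra_eq (Q := 0),
    equivExterior_wedgeList, ofFn_sortedTuple, map_list_prod]
  simp only [List.map_map]
  congr 2
  ext i
  exact (ExteriorAlgebra.map_apply_ι _ _).symm

/-- Taking components turns the coordinate multivector frame into a constant basis of the exterior
algebra of the model space, so the frame coefficients are the coordinates of `chartField`. -/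
theorem mvSmoothAt_iff_chartField {A : MVField g} :
    MVSmoothAt g A p ↔ WeakSmoothAt E (chartField g A p) p := by
  constructor
  · rintro ⟨c, hc, hA⟩
    have := WeakSmoothAt.sum (E := E) (s := Finset.univ) fun J _ =>
      (WeakSmoothAt.smul (hc J) (WeakSmoothAt.const ((finBasis ℝ E).ExteriorAlgebra J)))
    refine this.congr ?_
    filter_upwards [hA, eventually_mem_chart (E := E) p] with x hx hc
    simp only [chartField, hx, map_sum, map_smul, equivExterior_coordFrame,
      map_coordComp_coordVec hc]
  · intro h
    refine ⟨fun J x => (finBasis ℝ E).ExteriorAlgebra.coord J (chartField g A p x),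
      fun J => h _, ?_⟩
    filter_upwards [eventually_mem_chart (E := E) p] with x hc
    apply (equivExterior (g.quad x)).injective
    simp only [map_sum, map_smul, equivExterior_coordFrame]
    simp only [← map_smul, ← map_sum]
    refine Eq.trans ?_ (congrArg _ ((finBasis ℝ E).ExteriorAlgebra.sum_repr _).symm)
    exact (map_coordVec_coordComp hc _).symm

/-- The gauge and its inverse are smooth and act on exterior algebras functorially, so they preserve
smoothness in both directions. On the right the values lie in one fixed algebra, where products,
wedges and grades are fixed linear or bilinear maps. -/
theorem mvSmoothAt_iff {A : MVField g} :
    MVSmoothAt g A p ↔ WeakSmoothAt E (fun x => transportCl g p x (A x)) p := by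
  rw [mvSmoothAt_iff_chartField]
  constructor
  · intro h
    have := ((gauge g p).smooth.exteriorAlgebra_map h).map
      (equivExterior (g.quad p)).symm.toLinearMap
    refine this.congr ?_
    filter_upwards [eventually_isGaugeIsometry g p] with x hx
    refine (LinearEquiv.eq_symm_apply _).2 ?_
    exact hx.equivExterior_transportCl (A x)
  · intro h
    have := (gauge g p).smooth_inv.exteriorAlgebra_map
      (h.map (equivExterior (g.quad p)).toLinearMap)
    refine this.congr ?_
    filter_upwards [eventually_isGaugeIsometry g p, (gauge g p).left_inv] with x hx hl
    refine Eq.trans ?_ (congrArg _ (hx.equivExterior_transportCl (A x))).symm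
    rw [← AlgHom.comp_apply, ExteriorAlgebra.map_comp_map]
    have : (gauge g p).invFun x ∘ₗ (gauge g p).toFun x = LinearMap.id := by
      ext v; exact hl v
    rw [this, ExteriorAlgebra.map_id]; rfl

end Transport

end GeomCalc

end

noncomputable section

namespace GeomCalc

open GeomAlg Filter Module CliffordAlgebra

/-! ### Stability of smoothness under the algebraic operations; the reciprocal coordinate frame. -/

section Smoothness

variable {E : Type*} [NormedAddCommGroup E] [NormedSpace ℝ E] [FiniteDimensional ℝ E]
  {M : Type*} [TopologicalSpace M] [ChartedSpace E M] [IsManifold 𝓘(ℝ, E) ∞ M]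
  {g : PseudoRiemannianMetric E M} {p x q : M}

variable (p) in
/-- A vector field is smooth at a point. -/
def VectorSmoothAt (v : ∀ x : M, TangentSpace 𝓘(ℝ, E) x) : Prop :=
  ContMDiffAt 𝓘(ℝ, E) 𝓘(ℝ, E).tangent ∞ (fun y => (⟨y, v y⟩ : TangentBundle 𝓘(ℝ, E) M)) p

theorem vectorSmoothAt_iff {v : ∀ x : M, TangentSpace 𝓘(ℝ, E) x} :
    VectorSmoothAt p v ↔ WeakSmoothAt E (fun x => coordComp p x (v x)) p :=
  contMDiffAt_section_iff (mem_chart_source E p)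

theorem weakSmoothAt_transport {v : ∀ x : M, TangentSpace 𝓘(ℝ, E) x} (hv : VectorSmoothAt p v) :
    WeakSmoothAt E (fun x => transport g p x (v x)) p :=
  (gauge g p).smooth.apply (vectorSmoothAt_iff.1 hv)

namespace MVSmoothAt

theorem congr {A B : MVField g} (hA : MVSmoothAt g A p) (h : ∀ᶠ x in 𝓝 p, B x = A x) :
    MVSmoothAt g B p := by
  rw [mvSmoothAt_iff] at *
  exact hA.congr (h.mono fun x hx => congrArg _ hx)

theorem add {A B : MVField g} (hA : MVSmoothAt g A p) (hB : MVSmoothAt g B p) :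
    MVSmoothAt g (fun x => A x + B x) p := by
  rw [mvSmoothAt_iff] at *
  simp only [map_add]
  exact hA.add hB

theorem smul {φ : M → ℝ} {A : MVField g} (hφ : ContMDiffAt 𝓘(ℝ, E) 𝓘(ℝ, ℝ) ∞ φ p)
    (hA : MVSmoothAt g A p) : MVSmoothAt g (fun x => φ x • A x) p := by
  rw [mvSmoothAt_iff] at *
  simp only [map_smul]
  exact hA.smul hφ

theorem sum {ι : Type*} {s : Finset ι} {A : ι → MVField g} (hA : ∀ i ∈ s, MVSmoothAt g (A i) p) :
    MVSmoothAt g (fun x => ∑ i ∈ s, A i x) p := by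
  rw [mvSmoothAt_iff]
  simp only [map_sum]
  exact WeakSmoothAt.sum fun i hi => mvSmoothAt_iff.1 (hA i hi)

theorem mul {A B : MVField g} (hA : MVSmoothAt g A p) (hB : MVSmoothAt g B p) :
    MVSmoothAt g (fun x => A x * B x) p := by
  rw [mvSmoothAt_iff] at *
  refine (hA.bilin (LinearMap.mul ℝ (GT g p)) hB).congr ?_
  filter_upwards [eventually_isGaugeIsometry g p] with x hx
  exact hx.transportCl_mul _ _

theorem wedge {A B : MVField g} (hA : MVSmoothAt g A p) (hB : MVSmoothAt g B p) :
    MVSmoothAt g (fun x => wedge (g.quad x) (A x) (B x)) p := by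
  rw [mvSmoothAt_iff] at *
  refine (hA.bilin (wedgeHom (g.quad p)) hB).congr ?_
  filter_upwards [eventually_isGaugeIsometry g p] with x hx
  exact hx.transportCl_wedge _ _

theorem grade {A : MVField g} (hA : MVSmoothAt g A p) (k : ℕ) :
    MVSmoothAt g (fun x => grade (g.quad x) k (A x)) p := by
  rw [mvSmoothAt_iff] at *
  refine (hA.map (GeomAlg.grade (g.quad p) k)).congr ?_
  filter_upwards [eventually_isGaugeIsometry g p] with x hx
  exact hx.transportCl_grade _ _

theorem algebraMap {φ : M → ℝ} (hφ : ContMDiffAt 𝓘(ℝ, E) 𝓘(ℝ, ℝ) ∞ φ p) :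
    MVSmoothAt g (fun x => algebraMap ℝ (GT g x) (φ x)) p := by
  rw [mvSmoothAt_iff]
  refine ((WeakSmoothAt.of_real hφ).map (Algebra.linearMap ℝ (GT g p))).congr ?_
  filter_upwards [eventually_isGaugeIsometry g p] with x hx
  exact hx.transportCl_algebraMap _

theorem ι {v : ∀ x : M, TangentSpace 𝓘(ℝ, E) x} (hv : VectorSmoothAt p v) :
    MVSmoothAt g (fun x => ι (g.quad x) (v x)) p := by
  rw [mvSmoothAt_iff]
  refine ((weakSmoothAt_transport (g := g) hv).map (CliffordAlgebra.ι (g.quad p))).congr ?_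
  filter_upwards [eventually_isGaugeIsometry g p] with x hx
  exact hx.transportCl_ι _

theorem wedgeList {ι : Type*} {l : List ι} {v : ι → ∀ x : M, TangentSpace 𝓘(ℝ, E) x}
    (hv : ∀ i ∈ l, VectorSmoothAt p (v i)) :
    MVSmoothAt g (fun x => wedgeList (g.quad x) (l.map fun i => v i x)) p := by
  induction l with
  | nil =>
    have := algebraMap (g := g) (p := p) (φ := fun _ => 1) contMDiffAt_const
    simp only [map_one] at this
    exact this
  | cons i l ih =>
    exact (MVSmoothAt.ι (hv i (by simp))).wedge (ih fun j hj => hv j (by simp [hj]))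

theorem scalarPart {A : MVField g} (hA : MVSmoothAt g A p) :
    ContMDiffAt 𝓘(ℝ, E) 𝓘(ℝ, ℝ) ∞ (fun x => scalarPart (g.quad x) (A x)) p := by
  rw [mvSmoothAt_iff] at hA
  refine (hA (GeomAlg.scalarPart (g.quad p))).congr_of_eventuallyEq ?_
  filter_upwards [eventually_isGaugeIsometry g p] with x hx
  exact (hx.scalarPart_transportCl _).symm

theorem tensorConj {A : MVField g} (hA : MVSmoothAt g A p) {k : ℕ}
    {v : Fin k → ∀ x : M, TangentSpace 𝓘(ℝ, E) x} (hv : ∀ i, VectorSmoothAt p (v i)) :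
    ContMDiffAt 𝓘(ℝ, E) 𝓘(ℝ, ℝ) ∞
      (fun x => tensorConj (g.quad x) k (A x) fun i => v i x) p := by
  have h := ((hA.grade k).mul (wedgeList (g := g) (l := (List.ofFn v).reverse)
    (v := fun v => v) fun u hu => by
      obtain ⟨i, rfl⟩ := List.mem_ofFn.1 (List.mem_reverse.1 hu)
      exact hv i)).scalarPart
  refine h.congr_of_eventuallyEq (Eventually.of_forall fun x => ?_)
  simp only [tensorConj_apply]
  rw [List.map_reverse, List.map_ofFn]
  rfl

end MVSmoothAt

/-- The reciprocal frame of the coordinate frame of the chart at `p`. -/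
def coordDual (g : PseudoRiemannianMetric E M) (p x : M) (i : Fin (finrank ℝ E)) :
    TangentSpace 𝓘(ℝ, E) x :=
  ((g.form x).toDual (g.form_nondegenerate x)).symm
    ((finBasis ℝ E).coord i ∘ₗ (coordComp p x).toLinearMap)

theorem form_coordDual (i : Fin (finrank ℝ E)) (v : TangentSpace 𝓘(ℝ, E) x) :
    g.form x (coordDual g p x i) v = (finBasis ℝ E).coord i (coordComp p x v) := by
  rw [coordDual, LinearMap.BilinForm.apply_toDual_symm_apply]; rfl

theorem form_coordDual_coordVec (hx : x ∈ (chartAt E p).source) (i j : Fin (finrank ℝ E)) :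
    g.form x (coordDual g p x i) (coordVec p x (finBasis ℝ E j)) = if i = j then 1 else 0 := by
  rw [form_coordDual, coordComp_coordVec hx, Basis.coord_apply, Basis.repr_self,
    Finsupp.single_apply]
  simp only [eq_comm]

theorem vectorSmoothAt_coordVec (v : E) (hq : q ∈ (chartAt E p).source) :
    VectorSmoothAt q fun x => coordVec p x v := contMDiffAt_coordVec v hq

/-- In the gauge at `q` the metric is the constant form of the tangent space at `q`. The reciprocal
vector is then the fixed inverse of its `toDual` applied to a smoothly varying covector, and no
matrix has to be inverted. -/
theorem vectorSmoothAt_coordDual (i : Fin (finrank ℝ E)) (hq : q ∈ (chartAt E p).source) :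
    VectorSmoothAt q fun x => coordDual g p x i := by
  have h1 : WeakSmoothAt E (fun x => ((finBasis ℝ E).coord i ∘ₗ (coordComp p x).toLinearMap) ∘ₗ
      (coordVec q x).toLinearMap) q :=
    .of_apply fun v => .of_real ((contMDiffAt_section_iff hq).1
      (contMDiffAt_coordVec (p := q) v (mem_chart_source E q)) ((finBasis ℝ E).coord i))
  have h2 := h1.bilin (LinearMap.llcomp ℝ _ E ℝ) (gauge g q).smooth_inv
  rw [vectorSmoothAt_iff]
  refine ((gauge g q).smooth_inv.apply (h2.map
    ((g.form q).toDual (g.form_nondegenerate q)).symm.toLinearMap)).congr ?_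
  filter_upwards [(gauge g q).left_inv, (gauge g q).right_inv, eventually_form_transport g q,
    eventually_mem_chart (E := E) q] with x hl hr hf hx
  refine (hl (coordComp q x (coordDual g p x i))).symm.trans (congrArg _ ?_)
  refine (LinearEquiv.eq_symm_apply _).2 (LinearMap.ext fun w => ?_)
  have hw : transport g q x (coordVec q x ((gauge g q).invFun x w)) = w :=
    (congrArg _ (coordComp_coordVec hx _)).trans (hr w)
  refine Eq.trans (?_ : _ = g.form q (transport g q x (coordDual g p x i)) w) ?_
  · rfl
  · conv_lhs => rw [← hw]
    rw [hf, form_coordDual]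
    rfl

/-- The coordinate frame at a point of the chart domain, as a basis. -/
def coordBasis (hx : x ∈ (chartAt E p).source) :
    Basis (Fin (finrank ℝ E)) ℝ (TangentSpace 𝓘(ℝ, E) x) :=
  (finBasis ℝ E).map
    { (coordVec p x).toLinearMap with
      invFun := coordComp p x
      left_inv := coordComp_coordVec hx
      right_inv := coordVec_coordComp hx }

theorem coordBasis_apply (hx : x ∈ (chartAt E p).source) (i : Fin (finrank ℝ E)) :
    coordBasis hx i = coordVec p x (finBasis ℝ E i) := rfl

end Smoothness

end GeomCalc

end

noncomputable section

namespace GeomCalc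

open GeomAlg Filter Module CliffordAlgebra

/-! ### The conjugate of fields: bijectivity, smoothness, linearity and wedge products. -/

section Conjugate

variable {E : Type*} [NormedAddCommGroup E] [NormedSpace ℝ E] [FiniteDimensional ℝ E]
  {M : Type*} [TopologicalSpace M] [ChartedSpace E M] [IsManifold 𝓘(ℝ, E) ∞ M]
  {g : PseudoRiemannianMetric E M} {p x q : M}

/-- The reciprocal coordinate frame at a point of the chart domain, as a basis. -/
def coordDualBasis (g : PseudoRiemannianMetric E M) (hx : x ∈ (chartAt E p).source) :
    Basis (Fin (finrank ℝ E)) ℝ (TangentSpace 𝓘(ℝ, E) x) :=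
  (coordBasis hx).dualBasis.map ((g.form x).toDual (g.form_nondegenerate x)).symm

theorem coordDualBasis_apply (hx : x ∈ (chartAt E p).source) (i : Fin (finrank ℝ E)) :
    coordDualBasis g hx i = coordDual g p x i := by
  rw [coordDualBasis, Basis.map_apply]
  refine congrArg (((g.form x).toDual (g.form_nondegenerate x)).symm : _ → _) ?_
  refine (coordBasis hx).ext fun j => ?_
  rw [Basis.dualBasis_apply_self, coordBasis_apply]
  refine Eq.trans ?_ (congrArg ((finBasis ℝ E).coord i)
    (coordComp_coordVec hx (finBasis ℝ E j))).symm
  rw [Basis.coord_apply, Basis.repr_self, Finsupp.single_apply]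

/-- The coordinate frame of the chart at `p`. -/
abbrev frameVec (p x : M) (i : Fin (finrank ℝ E)) : TangentSpace 𝓘(ℝ, E) x :=
  coordVec p x (finBasis ℝ E i)

/-- The multivector frame made from the reciprocal frame. -/
def coordDualFrame (g : PseudoRiemannianMetric E M) (p x : M) (J : Finset (Fin (finrank ℝ E))) :
    GT g x :=
  wedgeList (g.quad x) (List.ofFn (sortedTuple (coordDual g p x) J))

theorem associated_coordDual_frameVec (hx : x ∈ (chartAt E p).source) (i j : Fin (finrank ℝ E)) :
    QuadraticMap.associated (R := ℝ) (M := TangentSpace 𝓘(ℝ, E) x) (g.quad x)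
      (coordDual g p x i) (frameVec p x j) = if i = j then 1 else 0 := by
  rw [associated_quad, form_coordDual_coordVec hx]

theorem sum_tensorConj_smul_coordDualFrame (hx : x ∈ (chartAt E p).source) (A : GT g x) :
    ∑ J, tensorConj (g.quad x) J.card A (sortedTuple (frameVec p x) J) • coordDualFrame g p x J =
      A := by
  have h : coordDual g p x = coordDualBasis g hx := funext fun i => (coordDualBasis_apply hx i).symm
  simp only [coordDualFrame, h]
  refine sum_tensorConj_smul_wedgeList (coordDualBasis g hx) (fun i j => ?_) A
  rw [coordDualBasis_apply, associated_coordDual_frameVec hx]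

theorem tensorConj_sum_smul_coordDualFrame (hx : x ∈ (chartAt E p).source)
    (w : ∀ k, TangentSpace 𝓘(ℝ, E) x [⋀^Fin k]→ₗ[ℝ] ℝ) (k : ℕ) :
    tensorConj (g.quad x) k (∑ J, w J.card (sortedTuple (frameVec p x) J) •
      coordDualFrame g p x J) = w k :=
  tensorConj_sum_smul_wedgeList (coordBasis hx) (associated_coordDual_frameVec hx) w k

theorem fieldConj_bijective (g : PseudoRiemannianMetric E M) :
    Function.Bijective (fieldConj g) := by
  constructor
  · intro A B h
    funext p
    have hp := mem_chart_source E p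
    rw [← sum_tensorConj_smul_coordDualFrame hp (A p), ← sum_tensorConj_smul_coordDualFrame hp (B p)]
    refine Finset.sum_congr rfl fun J _ => ?_
    rw [show tensorConj (g.quad p) J.card (A p) = _ from congrFun (congrFun h p) J.card]
    rfl
  · intro w
    refine ⟨fun p => ∑ J, w p J.card (sortedTuple (frameVec p p) J) • coordDualFrame g p p J, ?_⟩
    funext p k
    exact tensorConj_sum_smul_coordDualFrame (mem_chart_source E p) (w p) k

/-- The coordinate expression of the form conjugate to `coordDualFrame`. -/
def coordForm (g : PseudoRiemannianMetric E M) (p : M) (J : Finset (Fin (finrank ℝ E))) (k : ℕ) :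
    E [⋀^Fin k]→L[ℝ] ℝ :=
  toContinuousAlternating
    ((tensorConj (g.quad p) k (coordDualFrame g p p J)).compLinearMap (coordVec p p).toLinearMap)

theorem coordDualFrame_mem (J : Finset (Fin (finrank ℝ E))) :
    coordDualFrame g p x J ∈ pureGrade (g.quad x) J.card :=
  wedgeList_ofFn_mem _

/-- The conjugate of `e^J` is `dx^J`: the dot product of `eⁱ` with a vector is its `i`-th coordinate
component, so the components in the chart do not depend on `x`. -/
theorem tensorConj_coordDualFrame (hx : x ∈ (chartAt E p).source)
    (J : Finset (Fin (finrank ℝ E))) (k : ℕ) (v : Fin k → E) :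
    tensorConj (g.quad x) k (coordDualFrame g p x J) (fun i => coordVec p x (v i)) =
      coordForm g p J k v := by
  change _ = tensorConj (g.quad p) k (coordDualFrame g p p J) (fun i => coordVec p p (v i))
  by_cases hk : k = J.card
  · subst hk
    rw [coordDualFrame, coordDualFrame, tensorConj_wedgeList, tensorConj_wedgeList]
    congr 1
    ext i j
    simp only [Matrix.of_apply, associated_quad]
    refine (form_coordDual _ _).trans (Eq.trans ?_ (form_coordDual _ _).symm)
    rw [coordComp_coordVec hx, coordComp_coordVec (mem_chart_source E p)]
  · rw [tensorConj_eq_zero (Ne.symm hk) (coordDualFrame_mem J),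
      tensorConj_eq_zero (Ne.symm hk) (coordDualFrame_mem J)]
    rfl

/-- The coefficients of a multivector field in the frame `coordDualFrame`. -/
def dualCoeff (g : PseudoRiemannianMetric E M) (p : M) (A : MVField g)
    (J : Finset (Fin (finrank ℝ E))) (x : M) : ℝ :=
  tensorConj (g.quad x) J.card (A x) (sortedTuple (frameVec p x) J)

theorem contMDiffAt_dualCoeff {A : MVField g} (hq : q ∈ (chartAt E p).source)
    (hA : MVSmoothAt g A q) (J : Finset (Fin (finrank ℝ E))) :
    ContMDiffAt 𝓘(ℝ, E) 𝓘(ℝ, ℝ) ∞ (dualCoeff g p A J) q :=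
  hA.tensorConj (v := fun i x => sortedTuple (frameVec p x) J i)
    fun _ => vectorSmoothAt_coordVec _ hq

theorem formInChart_fieldConj (A : MVField g) (k : ℕ) :
    ∀ᶠ y in 𝓝 (extChartAt 𝓘(ℝ, E) p p), formInChart (fieldConj g A) p k y =
      ∑ J, dualCoeff g p A J ((extChartAt 𝓘(ℝ, E) p).symm y) • coordForm g p J k := by
  filter_upwards [eventually_extChartAt_symm p (eventually_mem_chart (E := E) p)] with y hy
  ext v
  change tensorConj (g.quad _) k (A ((extChartAt 𝓘(ℝ, E) p).symm y))
    (fun i => coordVec p _ (v i)) = _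
  conv_lhs => rw [← sum_tensorConj_smul_coordDualFrame hy (A _)]
  rw [tensorConj_sum, alternating_sum_apply, ContinuousAlternatingMap.sum_apply]
  refine Finset.sum_congr rfl fun J _ => ?_
  rw [tensorConj_smul, AlternatingMap.smul_apply, tensorConj_coordDualFrame hy]
  rfl

theorem mvSmoothAt_coordDualFrame (hq : q ∈ (chartAt E p).source)
    (J : Finset (Fin (finrank ℝ E))) :
    MVSmoothAt g (fun x => coordDualFrame g p x J) q := by
  have := MVSmoothAt.wedgeList (g := g) (p := q) (l := J.sort (· ≤ ·))
    (v := fun i x => coordDual g p x i) fun i _ => vectorSmoothAt_coordDual i hq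
  simp only [coordDualFrame, ofFn_sortedTuple]
  exact this

/-- Both conditions amount to smoothness of the coefficients in the frame `e^J`. That frame is
smooth on the one side and constant, namely `dx^J`, on the other. -/
theorem mvSmoothAt_iff_formSmoothAt (A : MVField g) (p : M) :
    MVSmoothAt g A p ↔ FormSmoothAt (fieldConj g A) p := by
  have hp := mem_chart_source E p
  constructor
  · intro hA k
    refine ContDiffAt.congr_of_eventuallyEq ?_ (formInChart_fieldConj A k)
    refine ContDiffAt.sum fun J _ => ?_
    exact (contMDiffAt_iff_contDiffAt_chart.1 (contMDiffAt_dualCoeff hp hA J)).smul contDiffAt_const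
  · intro h
    have hc : ∀ J, ContMDiffAt 𝓘(ℝ, E) 𝓘(ℝ, ℝ) ∞ (dualCoeff g p A J) p := fun J => by
      rw [contMDiffAt_iff_contDiffAt_chart]
      -- The coefficient at `J` is the value of the form on the coordinate vectors with indices in
      -- `J`.
      exact (ContinuousAlternatingMap.apply ℝ E ℝ
        (sortedTuple (finBasis ℝ E) J)).contDiff.contDiffAt.comp _ (h J.card)
    refine (MVSmoothAt.sum (s := Finset.univ) fun J _ =>
      (mvSmoothAt_coordDualFrame hp J).smul (hc J)).congr ?_
    filter_upwards [eventually_mem_chart (E := E) p] with x hx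
    exact (sum_tensorConj_smul_coordDualFrame hx (A x)).symm

theorem fieldConj_bijOn (g : PseudoRiemannianMetric E M) :
    Set.BijOn (fieldConj g) (smoothMVFields g) (smoothForms E M) := by
  refine ⟨fun A hA p => (mvSmoothAt_iff_formSmoothAt A p).1 (hA p),
    (fieldConj_bijective g).1.injOn, fun w hw => ?_⟩
  obtain ⟨A, rfl⟩ := (fieldConj_bijective g).2 w
  exact ⟨A, fun p => (mvSmoothAt_iff_formSmoothAt A p).2 (hw p), rfl⟩

theorem fieldConj_linear (α β : M → ℝ) (A B : MVField g) :
    fieldConj g (fun p => α p • A p + β p • B p) =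
      fun p k => α p • fieldConj g A p k + β p • fieldConj g B p k := by
  funext p k
  simp only [fieldConj, tensorConj_add, tensorConj_smul]

theorem fieldConj_wedge (A B : MVField g) :
    fieldConj g (fun p => wedge (g.quad p) (A p) (B p)) =
      formWedge (fieldConj g A) (fieldConj g B) := by
  funext p m
  exact tensorConj_wedge m (A p) (B p)

end Conjugate

end GeomCalc

end

noncomputable section

namespace GeomCalc

open GeomAlg Filter Module CliffordAlgebra

/-! ### Existence of a torsion-free multivector directional derivative. -/

section Existence

variable {E : Type*} [NormedAddCommGroup E] [NormedSpace ℝ E] [FiniteDimensional ℝ E]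
  {M : Type*} [TopologicalSpace M] [ChartedSpace E M] [IsManifold 𝓘(ℝ, E) ∞ M]

/-- The derivative of multivector fields that is, at each point, the derivative in the gauge. -/
def gaugeDeriv (g : PseudoRiemannianMetric E M) (p : M) (a : TangentSpace 𝓘(ℝ, E) p)
    (A : MVField g) : GT g p :=
  weakDeriv E (fun x => transportCl g p x (A x)) p a

variable {g : PseudoRiemannianMetric E M} {p : M}

theorem MVSmoothNear.self {A : MVField g} (h : MVSmoothNear g A p) : MVSmoothAt g A p :=
  h.self_of_nhds

theorem VectorSmoothNear.self {v : ∀ x : M, TangentSpace 𝓘(ℝ, E) x} (h : VectorSmoothNear v p) :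
    VectorSmoothAt p v :=
  h.self_of_nhds

theorem gaugeDeriv_ι {v : ∀ x : M, TangentSpace 𝓘(ℝ, E) x} (hv : VectorSmoothAt p v)
    (a : TangentSpace 𝓘(ℝ, E) p) :
    gaugeDeriv g p a (fun x => ι (g.quad x) (v x)) =
      ι (g.quad p) (weakDeriv E (fun x => transport g p x (v x)) p a) := by
  have hs := weakSmoothAt_transport (g := g) hv
  rw [gaugeDeriv, ← weakDeriv_map (ι (g.quad p)) hs]
  refine congrArg (fun f : _ →ₗ[ℝ] _ => f a) (weakDeriv_congr (hs.map (ι (g.quad p))) ?_)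
  filter_upwards [eventually_isGaugeIsometry g p] with x hx
  exact hx.transportCl_ι _

theorem weakDeriv_transport {v : ∀ x : M, TangentSpace 𝓘(ℝ, E) x} (hv : VectorSmoothAt p v)
    (a : TangentSpace 𝓘(ℝ, E) p) :
    weakDeriv E (fun x => transport g p x (v x)) p a =
      weakDeriv E (gauge g p).toFun p a (coordComp p p (v p)) +
        (gauge g p).toFun p (weakDeriv E (fun x => coordComp p x (v x)) p a) :=
  weakDeriv_bilin LinearMap.id (gauge g p).smooth (vectorSmoothAt_iff.1 hv) a

/-- At each point this is the ordinary derivative of a function with values in a fixed algebra, and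
the transport is an algebra homomorphism near the point. The axioms concern one point at a time, so
the gauges at different points need not be related. -/
theorem isMDD_gaugeDeriv (g : PseudoRiemannianMetric E M) : IsMDD g (gaugeDeriv g) where
  linear_dir p a b α β A _ := by simp only [gaugeDeriv, map_add, map_smul]
  scalar p a φ hφ := by
    have hφ := hφ.self_of_nhds
    have hs := WeakSmoothAt.smul hφ (WeakSmoothAt.const (1 : GT g p))
    rw [Algebra.algebraMap_eq_smul_one, ← weakDeriv_smul hφ]
    refine congrArg (fun f : _ →ₗ[ℝ] _ => f a) (weakDeriv_congr hs ?_)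
    filter_upwards [eventually_isGaugeIsometry g p] with x hx
    exact (hx.transportCl_algebraMap _).trans (Algebra.algebraMap_eq_smul_one _)
  vector p a v hv := by
    rw [gaugeDeriv_ι hv.self]
    exact grade_eq_self (ι_mem_pureGrade _)
  add p a A B hA hB := by
    rw [gaugeDeriv, gaugeDeriv, gaugeDeriv,
      ← weakDeriv_add (mvSmoothAt_iff.1 hA.self) (mvSmoothAt_iff.1 hB.self)]
    simp only [map_add]
  mul p a A B hA hB := by
    have hA := mvSmoothAt_iff.1 hA.self
    have hB := mvSmoothAt_iff.1 hB.self
    have h := weakDeriv_bilin (LinearMap.mul ℝ (GT g p)) hA hB a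
    simp only [transportCl_self] at h
    refine Eq.trans ?_ h
    refine congrArg (fun f : _ →ₗ[ℝ] _ => f a)
      (weakDeriv_congr (hA.bilin (LinearMap.mul ℝ (GT g p)) hB) ?_)
    filter_upwards [eventually_isGaugeIsometry g p] with x hx
    exact hx.transportCl_mul _ _

/-- The derivative of a transported vector field is the derivative of the gauge plus the derivative
of the components. The first parts cancel in the difference by symmetry; the second give the
bracket. -/
theorem isTorsionFree_gaugeDeriv (g : PseudoRiemannianMetric E M) :
    IsTorsionFree g (gaugeDeriv g) := by
  intro p a b ha hb
  have ha := ha.self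
  have hb := hb.self
  rw [gaugeDeriv_ι ha, gaugeDeriv_ι hb, ← map_sub, weakDeriv_transport ha, weakDeriv_transport hb,
    (gauge g p).symm, add_sub_add_left_eq_sub, ← map_sub,
    ← coordComp_mlieBracket (vectorSmoothAt_iff.1 ha) (vectorSmoothAt_iff.1 hb),
    (gauge g p).toFun_self]

end Existence

end GeomCalc

end

noncomputable section

namespace GeomCalc

open GeomAlg Filter Module CliffordAlgebra

theorem _root_.GeomAlg.exists_ι_eq {V : Type*} [AddCommGroup V] [Module ℝ V]
    {Q : QuadraticForm ℝ V} {A : CliffordAlgebra Q} (hA : A ∈ pureGrade Q 1) :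
    ∃ v, ι Q v = A := by
  have h : equivExterior Q A ∈ LinearMap.range (ExteriorAlgebra.ι ℝ (M := V)) ^ 1 := mem_pureGrade.1 hA
  rw [pow_one] at h
  obtain ⟨v, hv⟩ := h
  exact ⟨v, (equivExterior Q).injective ((equivExterior_ι v).trans hv)⟩

/-! ### Consequences of the axioms of an MDD: locality, metric compatibility, product rule for
wedges. -/

section DerivationRules

variable {E : Type*} [NormedAddCommGroup E] [NormedSpace ℝ E] [FiniteDimensional ℝ E]
  {M : Type*} [TopologicalSpace M] [ChartedSpace E M] [IsManifold 𝓘(ℝ, E) ∞ M]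
  {g : PseudoRiemannianMetric E M} {p : M}

theorem MVSmoothNear.smul {φ : M → ℝ} {A : MVField g} (hφ : ScalarSmoothNear (E := E) φ p)
    (hA : MVSmoothNear g A p) : MVSmoothNear g (fun x => φ x • A x) p := by
  filter_upwards [hφ, hA] with x hx hx' using hx'.smul hx

theorem MVSmoothNear.add {A B : MVField g} (hA : MVSmoothNear g A p) (hB : MVSmoothNear g B p) :
    MVSmoothNear g (fun x => A x + B x) p := by
  filter_upwards [hA, hB] with x hx hx' using hx.add hx'

theorem MVSmoothNear.mul {A B : MVField g} (hA : MVSmoothNear g A p) (hB : MVSmoothNear g B p) :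
    MVSmoothNear g (fun x => A x * B x) p := by
  filter_upwards [hA, hB] with x hx hx' using hx.mul hx'

theorem VectorSmoothNear.ι {v : ∀ x : M, TangentSpace 𝓘(ℝ, E) x} (hv : VectorSmoothNear v p) :
    MVSmoothNear g (fun x => CliffordAlgebra.ι (g.quad x) (v x)) p :=
  hv.mono fun _ hx => MVSmoothAt.ι hx

theorem ScalarSmoothNear.const (c : ℝ) : ScalarSmoothNear (E := E) (fun _ : M => c) p :=
  Eventually.of_forall fun _ => contMDiffAt_const

theorem ScalarSmoothNear.algebraMap {φ : M → ℝ} (hφ : ScalarSmoothNear (E := E) φ p) :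
    MVSmoothNear g (fun x => algebraMap ℝ (GT g x) (φ x)) p :=
  hφ.mono fun _ hx => MVSmoothAt.algebraMap hx

namespace IsMDD

variable {D : ∀ p : M, TangentSpace 𝓘(ℝ, E) p → MVField g → GT g p} (hD : IsMDD g D)
  (a : TangentSpace 𝓘(ℝ, E) p)
include hD

theorem smul {φ : M → ℝ} {A : MVField g} (hφ : ScalarSmoothNear (E := E) φ p)
    (hA : MVSmoothNear g A p) : D p a (fun x => φ x • A x) =
      mvfderiv 𝓘(ℝ, E) φ p a • A p + φ p • D p a A := by
  simp only [Algebra.smul_def]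
  rw [hD.mul p a _ _ hφ.algebraMap hA, hD.scalar p a φ hφ]

theorem const_smul {A : MVField g} (c : ℝ) (hA : MVSmoothNear g A p) :
    D p a (fun x => c • A x) = c • D p a A := by
  rw [hD.smul a (ScalarSmoothNear.const c) hA, mvfderiv_const_apply, zero_smul, zero_add]

/-- Locality needs no bump function. The indicator `φ` of the set where `A` does not vanish
satisfies `A = φ A` everywhere and is zero near `p`, hence smooth there, and the Leibniz rule
finishes. -/
theorem eq_zero {A : MVField g} (hA : MVSmoothNear g A p) (h : ∀ᶠ x in 𝓝 p, A x = 0) :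
    D p a A = 0 := by
  classical
  let φ : M → ℝ := fun x => if A x = 0 then 0 else 1
  have hφ0 : φ =ᶠ[𝓝 p] fun _ => 0 := h.mono fun x hx => if_pos hx
  have hφ : ScalarSmoothNear (E := E) φ p := hφ0.eventuallyEq_nhds.mono fun x hx =>
    contMDiffAt_const.congr_of_eventuallyEq hx
  have hA' : A = fun x => φ x • A x := by
    funext x
    by_cases hx : A x = 0
    · simp [hx]
    · simp [φ, hx]
  rw [hA', hD.smul a hφ hA, h.self_of_nhds, show φ p = 0 from hφ0.self_of_nhds, smul_zero,
    zero_smul, add_zero]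

theorem congr {A B : MVField g} (hA : MVSmoothNear g A p) (hB : MVSmoothNear g B p)
    (h : ∀ᶠ x in 𝓝 p, A x = B x) : D p a A = D p a B := by
  have hB' := hB.smul (ScalarSmoothNear.const (E := E) (-1))
  have h0 := hD.eq_zero a (hA.add hB') (h.mono fun x hx => by simp [hx])
  rw [hD.add p a _ _ hA hB', hD.const_smul a _ hB, neg_one_smul, add_neg_eq_zero] at h0
  exact h0

theorem sum {κ : Type*} {s : Finset κ} {A : κ → MVField g} (hA : ∀ i ∈ s, MVSmoothNear g (A i) p) :
    MVSmoothNear g (fun x => ∑ i ∈ s, A i x) p ∧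
      D p a (fun x => ∑ i ∈ s, A i x) = ∑ i ∈ s, D p a (A i) := by
  classical
  induction s using Finset.induction_on with
  | empty =>
    have h : MVSmoothNear g (fun _ => 0) p :=
      (ScalarSmoothNear.algebraMap (ScalarSmoothNear.const 0)).mono fun x hx => by
        simpa only [map_zero] using hx
    simp only [Finset.sum_empty]
    exact ⟨h, hD.eq_zero a h (Eventually.of_forall fun _ => rfl)⟩
  | insert i s hi ih =>
    have ih := ih fun j hj => hA j (by simp [hj])
    simp only [Finset.sum_insert hi]
    refine ⟨(hA i (by simp)).add ih.1, ?_⟩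
    rw [hD.add p a _ _ (hA i (by simp)) ih.1, ih.2]

theorem exists_vector {v : ∀ x : M, TangentSpace 𝓘(ℝ, E) x} (hv : VectorSmoothNear v p) :
    ∃ w, D p a (fun x => ι (g.quad x) (v x)) = ι (g.quad p) w := by
  have h := hD.vector p a v hv
  obtain ⟨w, hw⟩ := exists_ι_eq (h ▸ grade_mem 1 _)
  exact ⟨w, hw.symm⟩

/-- Compatibility with the metric is not an axiom: it follows by applying the Leibniz rule to `b · c
= ½ (b c + c b)`. -/
theorem metric {u v : ∀ x : M, TangentSpace 𝓘(ℝ, E) x} (hu : VectorSmoothNear u p)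
    (hv : VectorSmoothNear v p) {u' v' : TangentSpace 𝓘(ℝ, E) p}
    (hu' : D p a (fun x => ι (g.quad x) (u x)) = ι (g.quad p) u')
    (hv' : D p a (fun x => ι (g.quad x) (v x)) = ι (g.quad p) v') :
    mvfderiv 𝓘(ℝ, E) (fun x => g.form x (u x) (v x)) p a = g.form p u' (v p) + g.form p (u p) v' := by
  have key : ∀ x (b c : TangentSpace 𝓘(ℝ, E) x), algebraMap ℝ (GT g x) (g.form x b c) =
      (2⁻¹ : ℝ) • (ι (g.quad x) b * ι (g.quad x) c + ι (g.quad x) c * ι (g.quad x) b) := by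
    intro x b c
    rw [ι_mul_ι_add_swap, ← associated_quad, QuadraticMap.associated_apply, Algebra.algebraMap_eq_smul_one,
      Algebra.algebraMap_eq_smul_one, smul_smul]
    congr 1
  have hs : ScalarSmoothNear (E := E) (fun x => g.form x (u x) (v x)) p := by
    filter_upwards [hu, hv] with x hx hx' using contMDiffAt_inner g hx hx'
  have h := hD.scalar p a _ hs
  have hu1 := hu.ι (g := g)
  have hv1 := hv.ι (g := g)
  simp only [key] at h
  rw [hD.const_smul a _ ((hu1.mul hv1).add (hv1.mul hu1)), hD.add p a _ _ (hu1.mul hv1) (hv1.mul hu1),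
    hD.mul p a _ _ hu1 hv1, hD.mul p a _ _ hv1 hu1, hu', hv'] at h
  have h2 := congrArg (scalarPart (g.quad p)) h
  rw [scalarPart_algebraMap] at h2
  rw [← h2, ← scalarPart_algebraMap (Q := g.quad p) (g.form p u' (v p) + g.form p (u p) v'), map_add,
    key, key, ← smul_add]
  congr 2
  abel

/-- Differentiate `v ∧ A = ½ (v A + (-1)^k A v)`. To read the result as wedges again, the derivative
of `A` must have the same grade `k`. -/
theorem vecWedge {v : ∀ x : M, TangentSpace 𝓘(ℝ, E) x} (hv : VectorSmoothNear v p)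
    {A : MVField g} (hA : MVSmoothNear g A p) {k : ℕ} (hk : ∀ x, A x ∈ pureGrade (g.quad x) k)
    (hDk : D p a A ∈ pureGrade (g.quad p) k) {v' : TangentSpace 𝓘(ℝ, E) p}
    (hv' : D p a (fun x => ι (g.quad x) (v x)) = ι (g.quad p) v') :
    D p a (fun x => vecWedge (g.quad x) (v x) (A x)) =
      GeomAlg.vecWedge (g.quad p) v' (A p) + GeomAlg.vecWedge (g.quad p) (v p) (D p a A) := by
  have h : (fun x => GeomAlg.vecWedge (g.quad x) (v x) (A x)) = fun x =>
      (2⁻¹ : ℝ) • (ι (g.quad x) (v x) * A x + (-1 : ℝ) ^ k • (A x * ι (g.quad x) (v x))) :=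
    funext fun x => vecWedge_eq (hk x)
  have hv1 := hv.ι (g := g)
  have hr := (hA.mul hv1).smul (ScalarSmoothNear.const (E := E) ((-1) ^ k))
  rw [h, hD.const_smul a _ ((hv1.mul hA).add hr), hD.add p a _ _ (hv1.mul hA) hr,
    hD.const_smul a _ (hA.mul hv1), hD.mul p a _ _ hv1 hA, hD.mul p a _ _ hA hv1, hv',
    vecWedge_eq (hk p), vecWedge_eq hDk, ← smul_add]
  congr 1
  rw [smul_add]
  abel

end IsMDD

end DerivationRules

end GeomCalc

end

noncomputable section

namespace GeomCalc

open GeomAlg Filter Module CliffordAlgebra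

/-! ### The curl in components, and curl-free frames. -/

section Curl

variable {E : Type*} [NormedAddCommGroup E] [NormedSpace ℝ E] [FiniteDimensional ℝ E]
  {M : Type*} [TopologicalSpace M] [ChartedSpace E M] [IsManifold 𝓘(ℝ, E) ∞ M]
  {g : PseudoRiemannianMetric E M} {p : M}
  {D : ∀ p : M, TangentSpace 𝓘(ℝ, E) p → MVField g → GT g p}
  {e : ∀ p : M, Basis (Fin (finrank ℝ E)) ℝ (TangentSpace 𝓘(ℝ, E) p)}

theorem curl_eq (A : MVField g) : curl g D e A p = ∑ i, vecWedge (g.quad p)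
    ((g.form p).dualBasis (g.form_nondegenerate p) (e p) i) (D p (e p i) A) := by
  simp only [curl, wedge_ι]

theorem sum_form_dualBasis_smul (b : Basis (Fin (finrank ℝ E)) ℝ (TangentSpace 𝓘(ℝ, E) p))
    (a : TangentSpace 𝓘(ℝ, E) p) :
    ∑ i, g.form p ((g.form p).dualBasis (g.form_nondegenerate p) b i) a • b i = a := by
  conv_rhs => rw [← b.sum_repr a]
  refine Finset.sum_congr rfl fun i _ => ?_
  congr 1
  conv_lhs => rw [← b.sum_repr a]
  rw [map_sum, Finset.sum_eq_single_of_mem i (Finset.mem_univ _), map_smul,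
    LinearMap.BilinForm.apply_dualBasis_left, if_pos rfl, smul_eq_mul, mul_one]
  intro j _ hj
  rw [map_smul, LinearMap.BilinForm.apply_dualBasis_left, if_neg hj, smul_zero]

theorem sum_form_smul_dualBasis (b : Basis (Fin (finrank ℝ E)) ℝ (TangentSpace 𝓘(ℝ, E) p))
    (a : TangentSpace 𝓘(ℝ, E) p) :
    ∑ i, g.form p a (b i) • (g.form p).dualBasis (g.form_nondegenerate p) b i = a := by
  conv_rhs => rw [← ((g.form p).dualBasis (g.form_nondegenerate p) b).sum_repr a]
  simp only [LinearMap.BilinForm.dualBasis_repr_apply]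

theorem sum_linear_dir (hD : IsMDD g D) {A : MVField g} (hA : MVSmoothNear g A p) {κ : Type*}
    (s : Finset κ) (c : κ → ℝ) (v : κ → TangentSpace 𝓘(ℝ, E) p) :
    D p (∑ i ∈ s, c i • v i) A = ∑ i ∈ s, c i • D p (v i) A := by
  classical
  induction s using Finset.induction_on with
  | empty => simpa using hD.linear_dir p 0 0 0 0 A hA
  | insert i s hi ih =>
    have := hD.linear_dir p (v i) (∑ j ∈ s, c j • v j) (c i) 1 A hA
    rw [one_smul, one_smul] at this
    rw [Finset.sum_insert hi, Finset.sum_insert hi, this, ih]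

/-- Expand each `eⁱ ∧ D_{eᵢ} A` by `tensorConj_vecWedge` and sum over `i` first: the numbers `eⁱ ·
aₘ` are the coordinates of `aₘ` in the basis, so linearity in the direction gives the derivative
along `aₘ`. In particular the chosen basis disappears. -/
theorem tensorConj_curl (hD : IsMDD g D) {A : MVField g} (hA : MVSmoothNear g A p) (k : ℕ)
    (a : Fin (k + 1) → TangentSpace 𝓘(ℝ, E) p) :
    tensorConj (g.quad p) (k + 1) (curl g D e A p) a =
      ∑ m, (-1) ^ m.val * tensorConj (g.quad p) k (D p (a m) A) (m.removeNth a) := by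
  rw [curl_eq, tensorConj_sum, alternating_sum_apply]
  simp only [tensorConj_vecWedge, associated_quad]
  rw [Finset.sum_comm]
  refine Finset.sum_congr rfl fun m _ => ?_
  conv_rhs => rw [← sum_form_dualBasis_smul (g := g) (e p) (a m), sum_linear_dir hD hA,
    tensorConj_sum, alternating_sum_apply, Finset.mul_sum]
  refine Finset.sum_congr rfl fun i _ => ?_
  rw [tensorConj_smul, AlternatingMap.smul_apply, smul_eq_mul, mul_assoc]

theorem tensorConj_zero_curl (A : MVField g) : tensorConj (g.quad p) 0 (curl g D e A p) = 0 := by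
  ext a
  rw [tensorConj_apply, grade_zero_eq]
  have h : ∀ v B, scalarPart (g.quad p) (vecWedge (g.quad p) v B) = 0 := fun v B => by
    change ExteriorAlgebra.algebraMapInv (equivExterior (g.quad p) _) = 0
    rw [equivExterior_vecWedge, map_mul]
    simp [ExteriorAlgebra.algebraMapInv]
  rw [curl_eq, map_sum, Finset.sum_eq_zero fun i _ => h _ _, map_zero, zero_mul, map_zero]
  rfl

theorem mlieBracket_coordVec (α β : E) :
    VectorField.mlieBracket 𝓘(ℝ, E) (fun x => coordVec p x α) (fun x => coordVec p x β) p = 0 := by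
  have hp := mem_chart_source E p
  have hc : ∀ α : E, (fun x => coordComp p x (coordVec p x α)) =ᶠ[𝓝 p] fun _ => α := fun α =>
    (eventually_mem_chart (E := E) p).mono fun x hx => coordComp_coordVec hx α
  have hs : ∀ α : E, WeakSmoothAt E (fun x => coordComp p x (coordVec p x α)) p := fun α =>
    (WeakSmoothAt.const α).congr (hc α)
  have h := coordComp_mlieBracket (hs α) (hs β)
  rw [weakDeriv_congr (WeakSmoothAt.const β) (hc β), weakDeriv_congr (WeakSmoothAt.const α) (hc α),
    weakDeriv_const, weakDeriv_const, sub_zero] at h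
  rw [← coordVec_coordComp hp (VectorField.mlieBracket _ _ _ p), h, map_zero]

theorem vectorSmoothNear_coordVec (α : E) : VectorSmoothNear (fun x => coordVec p x α) p :=
  (eventually_mem_chart (E := E) p).mono fun _ hq => vectorSmoothAt_coordVec α hq

theorem vectorSmoothNear_coordDual (i : Fin (finrank ℝ E)) :
    VectorSmoothNear (fun x => coordDual g p x i) p :=
  (eventually_mem_chart (E := E) p).mono fun _ hq => vectorSmoothAt_coordDual i hq

/-- The derivative of a vector of the reciprocal coordinate frame is symmetric. -/
theorem form_deriv_coordDual_comm (hD : IsMDD g D) (hT : IsTorsionFree g D)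
    (i : Fin (finrank ℝ E)) {a b wa wb : TangentSpace 𝓘(ℝ, E) p}
    (ha : D p a (fun x => ι (g.quad x) (coordDual g p x i)) = ι (g.quad p) wa)
    (hb : D p b (fun x => ι (g.quad x) (coordDual g p x i)) = ι (g.quad p) wb) :
    g.form p wa b = g.form p wb a := by
  have hp := mem_chart_source E p
  obtain ⟨α, rfl⟩ : ∃ α : E, coordVec p p α = a := ⟨_, coordVec_coordComp hp a⟩
  obtain ⟨β, rfl⟩ : ∃ β : E, coordVec p p β = b := ⟨_, coordVec_coordComp hp b⟩
  have hs := fun α : E => vectorSmoothNear_coordVec (p := p) α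
  have hi := vectorSmoothNear_coordDual (g := g) (p := p) i
  obtain ⟨v, hv⟩ := hD.exists_vector (coordVec p p α) (hs β)
  obtain ⟨w, hw⟩ := hD.exists_vector (coordVec p p β) (hs α)
  -- The dot product of `eⁱ` with a field of constant components is constant, so metric
  -- compatibility gives `D_a eⁱ · b = -(eⁱ · D_a b)` for coordinate fields.
  have hconst : ∀ (α : E) (c : TangentSpace 𝓘(ℝ, E) p),
      mvfderiv 𝓘(ℝ, E) (fun x => g.form x (coordDual g p x i) (coordVec p x α)) p c = 0 := by
    intro α c
    rw [mvfderiv_congr (ψ := fun _ => (finBasis ℝ E).coord i α), mvfderiv_const_apply]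
    filter_upwards [eventually_mem_chart (E := E) p] with x hx
    rw [form_coordDual, coordComp_coordVec hx]
  have h1 := hD.metric _ hi (hs β) ha hv
  have h2 := hD.metric _ hi (hs α) hb hw
  rw [hconst] at h1 h2
  -- Fields of constant components commute, so vanishing torsion makes `D_a b` symmetric in the two
  -- coordinate fields.
  have h3 := hT p _ _ (hs α) (hs β)
  rw [hv, hw, mlieBracket_coordVec, map_zero, sub_eq_zero] at h3
  have h4 := congrArg (equivExterior (g.quad p)) h3
  rw [equivExterior_ι, equivExterior_ι, ExteriorAlgebra.ι_inj] at h4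
  rw [h4] at h1
  linarith

/-- Expanded in the reciprocal basis, the curl is a double sum of the symmetric coefficients of
`form_deriv_coordDual_comm` against antisymmetric wedges, so it equals its own negative. -/
theorem curl_coordDual (hD : IsMDD g D) (hT : IsTorsionFree g D) (i : Fin (finrank ℝ E)) :
    curl g D e (fun x => ι (g.quad x) (coordDual g p x i)) p = 0 := by
  choose w hw using fun a => hD.exists_vector a (vectorSmoothNear_coordDual (g := g) (p := p) i)
  have hsymm := fun a b => form_deriv_coordDual_comm hD hT i (hw a) (hw b)
  apply (equivExterior (g.quad p)).injective
  rw [curl_eq, map_sum, map_zero]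
  simp only [hw, equivExterior_vecWedge, equivExterior_ι]
  set f := (g.form p).dualBasis (g.form_nondegenerate p) (e p) with hf
  have hexp : ∀ j, ExteriorAlgebra.ι ℝ (w (e p j)) =
      ∑ k, g.form p (w (e p j)) (e p k) • ExteriorAlgebra.ι ℝ (f k) := fun j => by
    conv_lhs => rw [← sum_form_smul_dualBasis (g := g) (e p) (w (e p j))]
    simp only [map_sum, map_smul]
    rfl
  have hS : ∑ j, ExteriorAlgebra.ι ℝ (f j) * ExteriorAlgebra.ι ℝ (w (e p j)) =
      ∑ j, ∑ k, g.form p (w (e p j)) (e p k) •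
        (ExteriorAlgebra.ι ℝ (f j) * ExteriorAlgebra.ι ℝ (f k)) := by
    simp only [hexp, Finset.mul_sum, mul_smul_comm]
  have hanti : ∀ j k, ExteriorAlgebra.ι ℝ (f j) * ExteriorAlgebra.ι ℝ (f k) =
      -(ExteriorAlgebra.ι ℝ (f k) * ExteriorAlgebra.ι ℝ (f j)) := fun j k =>
    eq_neg_of_add_eq_zero_left (ExteriorAlgebra.ι_add_mul_swap _ _)
  have hneg : ∑ j, ExteriorAlgebra.ι ℝ (f j) * ExteriorAlgebra.ι ℝ (w (e p j)) =
      -∑ j, ExteriorAlgebra.ι ℝ (f j) * ExteriorAlgebra.ι ℝ (w (e p j)) := by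
    rw [hS]
    conv_lhs => rw [Finset.sum_comm]
    rw [← Finset.sum_neg_distrib]
    refine Finset.sum_congr rfl fun j _ => ?_
    rw [← Finset.sum_neg_distrib]
    refine Finset.sum_congr rfl fun k _ => ?_
    rw [hsymm, hanti, smul_neg]
  have h2 := add_eq_zero_iff_eq_neg.2 hneg
  rw [← two_smul ℝ] at h2
  exact (smul_eq_zero_iff_right two_ne_zero).1 h2

/-- The wedge product of curl-free smooth vector fields is curl-free. -/
theorem curl_wedgeList (hD : IsMDD g D) (l : List (∀ x : M, TangentSpace 𝓘(ℝ, E) x))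
    (hl : ∀ v ∈ l, VectorSmoothNear v p ∧ curl g D e (fun x => ι (g.quad x) (v x)) p = 0) :
    MVSmoothNear g (fun x => wedgeList (g.quad x) (l.map fun v => v x)) p ∧
      (∀ a, D p a (fun x => wedgeList (g.quad x) (l.map fun v => v x)) ∈
        pureGrade (g.quad p) l.length) ∧
      curl g D e (fun x => wedgeList (g.quad x) (l.map fun v => v x)) p = 0 := by
  -- Preservation of the grade by the derivative is carried along because the product rule for
  -- wedges requires it.
  induction l with
  | nil =>
    have h1 : (fun x => wedgeList (g.quad x) (([] : List (∀ x : M, TangentSpace 𝓘(ℝ, E) x)).map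
        fun v => v x)) = fun x => algebraMap ℝ (GT g x) 1 := funext fun x => (map_one _).symm
    have h0 : ∀ a, D p a (fun x => algebraMap ℝ (GT g x) 1) = 0 := fun a => by
      rw [hD.scalar p a _ (ScalarSmoothNear.const 1), mvfderiv_const_apply, map_zero]
    rw [h1]
    refine ⟨(ScalarSmoothNear.const 1).algebraMap, fun a => ?_, ?_⟩
    · rw [h0]; exact Submodule.zero_mem _
    · rw [curl_eq]; exact Finset.sum_eq_zero fun i _ => by rw [h0, map_zero]
  | cons v l ih =>
    obtain ⟨hs, hg, hc⟩ := ih fun u hu => hl u (by simp [hu])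
    obtain ⟨hv, hvc⟩ := hl v (by simp)
    set A : MVField g := fun x => wedgeList (g.quad x) (l.map fun v => v x) with hA
    have hAg : ∀ x, A x ∈ pureGrade (g.quad x) l.length := fun x => by
      simpa using wedgeList_mem (Q := g.quad x) (l.map fun v => v x)
    have h1 : (fun x => wedgeList (g.quad x) ((v :: l).map fun v => v x)) =
        fun x => vecWedge (g.quad x) (v x) (A x) := funext fun x => wedgeList_cons _ _
    choose w hw using fun a => hD.exists_vector a hv
    have hd : ∀ a, D p a (fun x => vecWedge (g.quad x) (v x) (A x)) =
        vecWedge (g.quad p) (w a) (A p) + vecWedge (g.quad p) (v p) (D p a A) := fun a =>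
      hD.vecWedge a hv hs hAg (hg a) (hw a)
    rw [h1]
    refine ⟨?_, fun a => ?_, ?_⟩
    · filter_upwards [hv, hs] with x hx hx'
      simpa only [wedge_ι] using (MVSmoothAt.ι hx).wedge hx'
    · rw [hd]
      exact Submodule.add_mem _ (vecWedge_mem _ (hAg p)) (vecWedge_mem _ (hg a))
    · rw [curl_eq] at hvc hc ⊢
      apply (equivExterior (g.quad p)).injective
      have hvc := congrArg (equivExterior (g.quad p)) hvc
      have hc := congrArg (equivExterior (g.quad p)) hc
      rw [map_sum, map_zero] at hvc hc ⊢
      simp only [hd, hw, map_add, equivExterior_vecWedge, equivExterior_ι,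
        Finset.sum_add_distrib, ← mul_assoc] at hvc hc ⊢
      -- The terms that differentiate `v` add up to the curl of `v` wedged with `A`. In the others
      -- `v` is moved to the front past `eⁱ`, leaving minus `v` wedged with the curl of `A`.
      rw [← Finset.sum_mul, hvc, zero_mul, zero_add]
      have hanti : ∀ a b : TangentSpace 𝓘(ℝ, E) p, ExteriorAlgebra.ι ℝ a * ExteriorAlgebra.ι ℝ b =
          -(ExteriorAlgebra.ι ℝ b * ExteriorAlgebra.ι ℝ a) := fun a b =>
        eq_neg_of_add_eq_zero_left (ExteriorAlgebra.ι_add_mul_swap _ _)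
      simp only [hanti _ (v p), neg_mul, mul_assoc]
      rw [Finset.sum_neg_distrib, ← Finset.mul_sum, hc, mul_zero, neg_zero]

theorem curl_coordDualFrame (hD : IsMDD g D) (hT : IsTorsionFree g D)
    (J : Finset (Fin (finrank ℝ E))) :
    MVSmoothNear g (fun x => coordDualFrame g p x J) p ∧
      curl g D e (fun x => coordDualFrame g p x J) p = 0 := by
  have h := curl_wedgeList (e := e) hD
    ((J.sort (· ≤ ·)).map fun i => fun x => coordDual g p x i) fun v hv => by
      obtain ⟨i, -, rfl⟩ := List.mem_map.1 hv
      exact ⟨vectorSmoothNear_coordDual i, curl_coordDual hD hT i⟩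
  simp only [List.map_map] at h
  simp only [coordDualFrame, ofFn_sortedTuple]
  exact ⟨h.1, h.2.2⟩

end Curl

end GeomCalc

end

noncomputable section

namespace GeomCalc

open GeomAlg Filter Module CliffordAlgebra

/-! ### The curl corresponds to the exterior derivative. -/

section ExteriorDerivative

variable {E : Type*} [NormedAddCommGroup E] [NormedSpace ℝ E] [FiniteDimensional ℝ E]
  {M : Type*} [TopologicalSpace M] [ChartedSpace E M] [IsManifold 𝓘(ℝ, E) ∞ M]
  {g : PseudoRiemannianMetric E M} {p : M}
  {D : ∀ p : M, TangentSpace 𝓘(ℝ, E) p → MVField g → GT g p}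

theorem fderiv_formInChart_apply {A : MVField g} (hA : MVSmoothAt g A p) {k : ℕ} (v : Fin k → E)
    (a : TangentSpace 𝓘(ℝ, E) p) :
    fderiv ℝ (fun y => formInChart (fieldConj g A) p k y v) (extChartAt 𝓘(ℝ, E) p p)
        (coordComp p p a) =
      ∑ J, mvfderiv 𝓘(ℝ, E) (dualCoeff g p A J) p a * coordForm g p J k v := by
  have hc := fun J => contMDiffAt_dualCoeff (mem_chart_source E p) hA J
  have h : (fun y => formInChart (fieldConj g A) p k y v) =ᶠ[𝓝 (extChartAt 𝓘(ℝ, E) p p)]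
      (fun x => ∑ J, dualCoeff g p A J x * coordForm g p J k v) ∘ (extChartAt 𝓘(ℝ, E) p).symm := by
    filter_upwards [formInChart_fieldConj (p := p) A k] with y hy
    rw [hy, ContinuousAlternatingMap.sum_apply]
    rfl
  rw [h.fderiv_eq, ← mvfderiv_eq_fderiv (contMDiffAt_sum fun J _ =>
    contMDiffAt_mul (hc J) contMDiffAt_const),
    mvfderiv_sum_apply fun J _ => contMDiffAt_mul (hc J) contMDiffAt_const]
  refine Finset.sum_congr rfl fun J _ => ?_
  rw [mvfderiv_mul_apply (hc J) contMDiffAt_const, mvfderiv_const_apply, mul_zero, zero_add,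
    mul_comm]

/-- With `A = ∑ c_J e^J` near `p` and every `e^J` curl-free, only the derivatives of the
coefficients contribute to the curl. The conjugate has the coordinate expression `∑ c_J dx^J`, whose
exterior derivative has the same components. -/
theorem fieldConj_curl (hD : IsMDD g D) (hT : IsTorsionFree g D)
    (e : ∀ p : M, Basis (Fin (finrank ℝ E)) ℝ (TangentSpace 𝓘(ℝ, E) p)) {A : MVField g}
    (hA : MVSmoothNear g A p) :
    fieldConj g (curl g D e A) p = formExtDeriv (fieldConj g A) p := by
  have hp := mem_chart_source E p
  funext k
  rcases k with _ | k
  · exact tensorConj_zero_curl A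
  ext a
  have hc : ∀ J, ScalarSmoothNear (E := E) (dualCoeff g p A J) p := fun J => by
    filter_upwards [hA, eventually_mem_chart (E := E) p] with x hx hx'
      using contMDiffAt_dualCoeff hx' hx J
  have hF := fun J => curl_coordDualFrame (e := e) hD hT (p := p) J
  have hsum := fun a => hD.sum a (s := Finset.univ)
    (A := fun J x => dualCoeff g p A J x • coordDualFrame g p x J) fun J _ => (hF J).1.smul (hc J)
  have hDA : ∀ a, D p a A = ∑ J, (mvfderiv 𝓘(ℝ, E) (dualCoeff g p A J) p a •
      coordDualFrame g p p J + dualCoeff g p A J p • D p a fun x => coordDualFrame g p x J) := by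
    intro a
    -- The expansion of `A` holds only on the chart domain, so locality of `D` is needed.
    rw [hD.congr a hA (hsum a).1 ((eventually_mem_chart (E := E) p).mono fun x hx =>
      (sum_tensorConj_smul_coordDualFrame hx (A x)).symm), (hsum a).2]
    exact Finset.sum_congr rfl fun J _ => hD.smul a (hc J) (hF J).1
  -- No single derivative of `e^J` need vanish; this alternating sum does, being a component of its
  -- curl.
  have hframe : ∀ J, ∑ m, (-1) ^ m.val * tensorConj (g.quad p) k
      (D p (a m) fun x => coordDualFrame g p x J) (m.removeNth a) = 0 := fun J => by
    rw [← tensorConj_curl (e := e) hD (hF J).1, (hF J).2]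
    exact congrArg (fun f : _ [⋀^Fin (k + 1)]→ₗ[ℝ] ℝ => f a) (map_zero (tensorConjHom (g.quad p) (k + 1)))
  have hdiff : DifferentiableAt ℝ (formInChart (fieldConj g A) p k) (extChartAt 𝓘(ℝ, E) p p) :=
    ((mvSmoothAt_iff_formSmoothAt A p).1 hA.self k).differentiableAt (by simp)
  refine (tensorConj_curl hD hA k a).trans ?_
  refine Eq.trans ?_ (extDeriv_apply hdiff fun i => coordComp p p (a i)).symm
  have hext : ∀ m : Fin (k + 1), ((-1) ^ m.val • fderiv ℝ (fun y => formInChart (fieldConj g A) p k y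
      (m.removeNth fun i => coordComp p p (a i))) (extChartAt 𝓘(ℝ, E) p p) (coordComp p p (a m)) : ℝ) =
      (-1) ^ m.val * ∑ J, mvfderiv 𝓘(ℝ, E) (dualCoeff g p A J) p (a m) *
        tensorConj (g.quad p) k (coordDualFrame g p p J) (m.removeNth a) := fun m => by
    have hJ : ∀ J, coordForm g p J k (m.removeNth fun i => coordComp p p (a i)) =
        tensorConj (g.quad p) k (coordDualFrame g p p J) (m.removeNth a) := fun J =>
      (tensorConj_coordDualFrame hp J k _).symm.trans
        (congrArg _ (funext fun i => coordVec_coordComp hp _))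
    rw [fderiv_formInChart_apply hA.self, zsmul_eq_mul, Int.cast_pow, Int.cast_neg, Int.cast_one]
    simp only [hJ]
  refine Eq.trans ?_ (Finset.sum_congr rfl fun m _ => (hext m).symm)
  simp only [hDA, tensorConj_sum, alternating_sum_apply, tensorConj_add, tensorConj_smul,
    AlternatingMap.add_apply, AlternatingMap.smul_apply, smul_eq_mul, Finset.sum_add_distrib, mul_add]
  -- The terms with derivatives of coefficients agree on both sides. It remains to see that the
  -- terms with derivatives of the frame sum to zero, which is `hframe` for each `J`.
  rw [add_eq_left]
  simp only [Finset.mul_sum]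
  rw [Finset.sum_comm]
  refine Finset.sum_eq_zero fun J _ => ?_
  simp only [mul_left_comm _ (dualCoeff g p A J p)]
  rw [← Finset.mul_sum, hframe, mul_zero]

end ExteriorDerivative

end GeomCalc

end

open GeomAlg GeomCalc in
theorem mainTheorem4 {E : Type*} [NormedAddCommGroup E] [NormedSpace ℝ E] [FiniteDimensional ℝ E]
    {M : Type*} [TopologicalSpace M] [ChartedSpace E M] [IsManifold 𝓘(ℝ, E) ∞ M]
    (g : PseudoRiemannianMetric E M) :
    -- bijection, also for fields that are not smooth, and matching smoothness point by point
    Function.Bijective (fieldConj g) ∧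
    (∀ (A : MVField g) (p : M), MVSmoothAt g A p ↔ FormSmoothAt (fieldConj g A) p) ∧
    Set.BijOn (fieldConj g) (smoothMVFields g) (smoothForms E M) ∧
    -- linearity
    (∀ (α β : M → ℝ) (A B : MVField g),
      fieldConj g (fun p => α p • A p + β p • B p) =
        fun p k => α p • fieldConj g A p k + β p • fieldConj g B p k) ∧
    -- wedge products
    (∀ A B : MVField g,
      fieldConj g (fun p => wedge (g.quad p) (A p) (B p)) =
        formWedge (fieldConj g A) (fieldConj g B)) ∧
    -- the torsion-free derivative exists, and its curl is the exterior derivative of forms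
    (∃ D, IsMDD g D ∧ IsTorsionFree g D) ∧
    (∀ D, IsMDD g D → IsTorsionFree g D →
      ∀ (e : ∀ p : M, Module.Basis (Fin (Module.finrank ℝ E)) ℝ (TangentSpace 𝓘(ℝ, E) p))
        (A : MVField g) (p : M), MVSmoothNear g A p →
        fieldConj g (curl g D e A) p = formExtDeriv (fieldConj g A) p) ∧
    -- the conjugate with the vectors wedged in the given order differs by the reversal sign
    (∀ (p : M) (k : ℕ) (A : GT g p) (a : Fin k → TangentSpace 𝓘(ℝ, E) p),
      dot (g.quad p) (grade (g.quad p) k A) (wedgeList (g.quad p) (List.ofFn a)) =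
        algebraMap ℝ (GT g p)
          ((-1) ^ (k * (k - 1) / 2) * tensorConj (g.quad p) k A a)) := by
  refine ⟨fieldConj_bijective g, mvSmoothAt_iff_formSmoothAt, fieldConj_bijOn g, fieldConj_linear,
    fieldConj_wedge, ⟨gaugeDeriv g, isMDD_gaugeDeriv g, isTorsionFree_gaugeDeriv g⟩,
    fun D hD hT e A p hA => fieldConj_curl hD hT e hA, fun p k A a => dot_wedgeList k A a⟩
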